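/- Let $\Bbbk$ be a field of characteristic zero, $\ell>1$ an odd integer and $\zeta\in\Bbbk$ a primitive $\ell$-th root of unity. Let $U_q$ be the quantum algebra of $\mathfrak{sl}_2$ over $\mathbb Q(v)$, with generators $E,F,K^{\pm1}$, relations $KE=v^2EK$, $KF=v^{-2}FK$, $EF-FE=(K-K^{-1})/(v-v^{-1})$, and Hopf structure $$\Delta E=E\otimes1+K\otimes E,\quad \Delta F=F\otimes K^{-1}+1\otimes F,\quad \Delta K=K\otimes K,$$ $$\varepsilon(E)=\varepsilon(F)=0,\ \varepsilon(K)=1,\qquad S(E)=-K^{-1}E,\ S(F)=-FK,\ S(K)=K^{-1}.$$ Let $U_{\mathcal A}$ be Lusztig's integral form, i.e. the subalgebra over $\mathcal A=\mathbb Z[v,v^{-1}]$ generated by $K^{\pm1}$ and all divided powers $E^{(n)}=E^n/[n]!$, $F^{(n)}=F^n/[n]!$ ($n\ge0$), where $[n]!=\prod_{i=1}^n\frac{v^i-v^{-i}}{v-v^{-1}}$. Let $U_\zeta$ be the quotient of $\Bbbk\otimes_{\mathcal A}U_{\mathcal A}$ (where $v\mapsto\zeta$) by the two-sided ideal generated by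 $K^\ell-1$, let $\mathbf u_\zeta\subset U_\zeta$ be the subalgebra generated by $E,F,K$ (the Frobenius–Lusztig kernel), and let $U=U(\mathfrak{sl}_2)$ be the enveloping algebra over $\Bbbk$, with its usual Hopf structure and the standard elements $e,f$ of $\mathfrak{sl}_2$. Theorem 1. The Hopf structure of $U_q$ induces a Hopf algebra structure $(\Delta_\zeta,\varepsilon_\zeta,S_\zeta)$ on $U_\zeta$, and there is a unique map of Hopf algebras $\mathrm{Fr}:U_\zeta\to U$ with $\mathrm{Fr}(E)=\mathrm{Fr}(F)=0$, $\mathrm{Fr}(K)=1$, $\mathrm{Fr}(E^{(\ell)})=e$, $\mathrm{Fr}(F^{(\ell)})=f$. For the right coaction $\rho=(I\otimes\mathrm{Fr})\Delta_\zeta:U_\zeta\to U_\zeta\otimes U$ one has $\mathbf u_\zeta=\{a\in U_\zeta:\rho(a)=a\otimes1\}$. There is an algebra homomorphism $\gamma:U\to U_\zeta$ with $$\gamma(e)=E^{(\ell)},\qquad \gamma(f)=F^{(\ell)},$$ which satisfies $\mathrm{Fr}\circ\gamma=I$, is a right $U$-comodule map, i.e. $\rho\circ\gamma=(\gamma\otimes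 I)\circ\Delta$, and has a convolution inverse $\gamma^{-1}$. The formula $$v\cdot a=\sum\gamma(v_1)\,a\,\gamma^{-1}(v_2)\qquad(v\in U,\ a\in\mathbf u_\zeta,\ \Delta v=\sum v_1\otimes v_2)$$ defines a left $U$-module algebra structure on $\mathbf u_\zeta$ (so $v\cdot a\in\mathbf u_\zeta$). For the resulting smash product $\mathbf u_\zeta\#U$, that is, the space $\mathbf u_\zeta\otimes U$ with multiplication $(a\#v)(b\#w)=\sum a(v_1\cdot b)\#v_2w$, the map $$\mathbf u_\zeta\#U\to U_\zeta,\qquad a\#v\mapsto a\,\gamma(v),$$ is an isomorphism of algebras. -/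

import Mathlib

open scoped TensorProduct

noncomputable section

namespace QuantumSL2

/-! ### The enveloping algebra as a Hopf algebra -/

section Enveloping

attribute [local instance 100] LieRing.ofAssociativeRing

variable (k : Type*) [CommRing k] (L : Type*) [LieRing L] [LieAlgebra k L]

/-- The comultiplication of `U(L)`: the algebra map with `x ↦ x ⊗ 1 + 1 ⊗ x` for `x` in `L`. -/
def envComul : UniversalEnvelopingAlgebra k L →ₐ[k]
    UniversalEnvelopingAlgebra k L ⊗[k] UniversalEnvelopingAlgebra k L :=
  UniversalEnvelopingAlgebra.lift k
    { toFun := fun x => UniversalEnvelopingAlgebra.ι k x ⊗ₜ 1 + 1 ⊗ₜ UniversalEnvelopingAlgebra.ι k x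
      map_add' := fun x y => by
        simp only [map_add, TensorProduct.add_tmul, TensorProduct.tmul_add]; abel
      map_smul' := fun c x => by
        simp only [map_smul, TensorProduct.smul_tmul', TensorProduct.tmul_smul, smul_add,
          RingHom.id_apply]
      map_lie' := fun {x y} => by
        simp only [LieHom.map_lie, LieRing.of_associative_ring_bracket, add_mul, mul_add,
          Algebra.TensorProduct.tmul_mul_tmul, one_mul, mul_one, TensorProduct.sub_tmul,
          TensorProduct.tmul_sub]
        abel }

/-- The counit of `U(L)`: the algebra map that kills `L`. -/
def envCounit : UniversalEnvelopingAlgebra k L →ₐ[k] k :=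
  UniversalEnvelopingAlgebra.lift k
    { toFun := fun _ => 0
      map_add' := fun _ _ => by simp
      map_smul' := fun _ _ => by simp
      map_lie' := fun {_ _} => by simp }

/-- The antipode of `U(L)`, as an algebra map to the opposite algebra: `x ↦ -x` for `x` in `L`. -/
def envAntipode : UniversalEnvelopingAlgebra k L →ₐ[k] (UniversalEnvelopingAlgebra k L)ᵐᵒᵖ :=
  UniversalEnvelopingAlgebra.lift k
    { toFun := fun x => MulOpposite.op (-UniversalEnvelopingAlgebra.ι k x)
      map_add' := fun x y => by
        rw [← MulOpposite.op_add, map_add, neg_add]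
      map_smul' := fun c x => by
        rw [RingHom.id_apply, ← MulOpposite.op_smul, map_smul, smul_neg]
      map_lie' := fun {x y} => by
        simp only [LieHom.map_lie, LieRing.of_associative_ring_bracket, ← MulOpposite.op_mul,
          ← MulOpposite.op_sub]
        congr 1
        noncomm_ring }

variable {k L}

@[simp] theorem envComul_ι (x : L) : envComul k L (UniversalEnvelopingAlgebra.ι k x) =
    UniversalEnvelopingAlgebra.ι k x ⊗ₜ 1 + 1 ⊗ₜ UniversalEnvelopingAlgebra.ι k x := by
  rw [envComul, UniversalEnvelopingAlgebra.lift_ι_apply]; rfl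

@[simp] theorem envCounit_ι (x : L) : envCounit k L (UniversalEnvelopingAlgebra.ι k x) = 0 := by
  rw [envCounit, UniversalEnvelopingAlgebra.lift_ι_apply]; rfl

@[simp] theorem envAntipode_ι (x : L) : envAntipode k L (UniversalEnvelopingAlgebra.ι k x) =
    MulOpposite.op (-UniversalEnvelopingAlgebra.ι k x) := by
  rw [envAntipode, UniversalEnvelopingAlgebra.lift_ι_apply]; rfl

theorem env_hom_ext {A : Type*} [Ring A] [Algebra k A]
    {f g : UniversalEnvelopingAlgebra k L →ₐ[k] A}
    (h : ∀ x : L, f (UniversalEnvelopingAlgebra.ι k x) = g (UniversalEnvelopingAlgebra.ι k x)) :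
    f = g :=
  UniversalEnvelopingAlgebra.hom_ext k (LieHom.ext h)

/-- An induction principle: `U(L)` is generated by `L`. -/
theorem env_mem_of_ι_mem (S : Subalgebra k (UniversalEnvelopingAlgebra k L))
    (h : ∀ x : L, UniversalEnvelopingAlgebra.ι k x ∈ S) (u : UniversalEnvelopingAlgebra k L) :
    u ∈ S := by
  let j : L →ₗ⁅k⁆ S :=
    { toFun := fun x => ⟨UniversalEnvelopingAlgebra.ι k x, h x⟩
      map_add' := fun x y => by ext; simp
      map_smul' := fun c x => by ext; simp
      map_lie' := fun {x y} => by
        ext; simp [LieRing.of_associative_ring_bracket] }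
  have : S.val.comp (UniversalEnvelopingAlgebra.lift k j) = AlgHom.id k _ := by
    refine env_hom_ext fun x => ?_
    rw [AlgHom.comp_apply, UniversalEnvelopingAlgebra.lift_ι_apply]; rfl
  have h2 := congr($this u)
  rw [AlgHom.comp_apply, AlgHom.id_apply] at h2
  rw [← h2]
  exact (UniversalEnvelopingAlgebra.lift k j u).2

instance envBialgebra : Bialgebra k (UniversalEnvelopingAlgebra k L) :=
  Bialgebra.ofAlgHom (envComul k L) (envCounit k L)
    (env_hom_ext fun x => by
      simp [-UniversalEnvelopingAlgebra.ι_apply, TensorProduct.add_tmul, TensorProduct.tmul_add,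
        Algebra.TensorProduct.one_def, add_assoc])
    (env_hom_ext fun x => by simp [-UniversalEnvelopingAlgebra.ι_apply])
    (env_hom_ext fun x => by simp [-UniversalEnvelopingAlgebra.ι_apply])

theorem env_comul_apply (u : UniversalEnvelopingAlgebra k L) :
    Coalgebra.comul (R := k) u = envComul k L u := rfl

theorem env_counit_apply (u : UniversalEnvelopingAlgebra k L) :
    Coalgebra.counit (R := k) u = envCounit k L u := rfl

/-- The antipode of `U(L)` as a linear map. -/
def envAntipodeLin : UniversalEnvelopingAlgebra k L →ₗ[k] UniversalEnvelopingAlgebra k L :=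
  (MulOpposite.opLinearEquiv k).symm.toLinearMap ∘ₗ (envAntipode k L).toLinearMap

theorem envAntipodeLin_mul (a b : UniversalEnvelopingAlgebra k L) :
    envAntipodeLin (k := k) (a * b) = envAntipodeLin (k := k) b * envAntipodeLin (k := k) a := by
  simp [envAntipodeLin]

theorem env_antipode_left (u : UniversalEnvelopingAlgebra k L) :
    LinearMap.mul' k _ ((envAntipodeLin (k := k) (L := L)).rTensor _ (envComul k L u)) =
      algebraMap k _ (envCounit k L u) := by
  let S : Subalgebra k (UniversalEnvelopingAlgebra k L) :=
    { carrier := {u | LinearMap.mul' k _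
        ((envAntipodeLin (k := k) (L := L)).rTensor _ (envComul k L u)) =
          algebraMap k _ (envCounit k L u)}
      mul_mem' := by
        intro a b ha hb
        simp only [Set.mem_ofPred_eq] at ha hb ⊢
        have key : ∀ s t : UniversalEnvelopingAlgebra k L ⊗[k] UniversalEnvelopingAlgebra k L,
            ∀ c : k, LinearMap.mul' k _ ((envAntipodeLin (k := k) (L := L)).rTensor _ s) =
              algebraMap k _ c →
            LinearMap.mul' k _ ((envAntipodeLin (k := k) (L := L)).rTensor _ (s * t)) =
              algebraMap k _ c *
                LinearMap.mul' k _ ((envAntipodeLin (k := k) (L := L)).rTensor _ t) := by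
          intro s t c hs
          induction t with
          | zero => simp
          | add x y hx hy => rw [mul_add, map_add, map_add, hx, hy, map_add, map_add, mul_add]
          | tmul x y =>
            have : LinearMap.mul' k _ ((envAntipodeLin (k := k) (L := L)).rTensor _
                (s * x ⊗ₜ[k] y)) = envAntipodeLin (k := k) x *
                LinearMap.mul' k _ ((envAntipodeLin (k := k) (L := L)).rTensor _ s) * y := by
              clear hs
              induction s with
              | zero => simp
              | add p q hp hq =>
                rw [add_mul, map_add, map_add, hp, hq, map_add, map_add, mul_add, add_mul]
              | tmul p q => simp [envAntipodeLin_mul, mul_assoc]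
            rw [this, hs, ← Algebra.commutes, mul_assoc]
            simp
        rw [map_mul, key _ _ _ ha, hb, map_mul, map_mul]
      add_mem' := by
        intro a b ha hb
        simp only [Set.mem_ofPred_eq] at ha hb ⊢
        simp only [map_add, ha, hb]
      algebraMap_mem' := by
        intro r
        simp [envAntipodeLin, Algebra.TensorProduct.algebraMap_apply] }
  refine env_mem_of_ι_mem S (fun x => ?_) u
  change LinearMap.mul' k _ ((envAntipodeLin (k := k) (L := L)).rTensor _ (envComul k L _)) =
      algebraMap k _ (envCounit k L _)
  simp [-UniversalEnvelopingAlgebra.ι_apply, envAntipodeLin]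

theorem env_antipode_right (u : UniversalEnvelopingAlgebra k L) :
    LinearMap.mul' k _ ((envAntipodeLin (k := k) (L := L)).lTensor _ (envComul k L u)) =
      algebraMap k _ (envCounit k L u) := by
  let S : Subalgebra k (UniversalEnvelopingAlgebra k L) :=
    { carrier := {u | LinearMap.mul' k _
        ((envAntipodeLin (k := k) (L := L)).lTensor _ (envComul k L u)) =
          algebraMap k _ (envCounit k L u)}
      mul_mem' := by
        intro a b ha hb
        simp only [Set.mem_ofPred_eq] at ha hb ⊢
        have key : ∀ s t : UniversalEnvelopingAlgebra k L ⊗[k] UniversalEnvelopingAlgebra k L,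
            ∀ c : k, LinearMap.mul' k _ ((envAntipodeLin (k := k) (L := L)).lTensor _ t) =
              algebraMap k _ c →
            LinearMap.mul' k _ ((envAntipodeLin (k := k) (L := L)).lTensor _ (s * t)) =
              LinearMap.mul' k _ ((envAntipodeLin (k := k) (L := L)).lTensor _ s) *
                algebraMap k _ c := by
          intro s t c ht
          induction s with
          | zero => simp
          | add x y hx hy => rw [add_mul, map_add, map_add, hx, hy, map_add, map_add, add_mul]
          | tmul x y =>
            have : LinearMap.mul' k _ ((envAntipodeLin (k := k) (L := L)).lTensor _
                (x ⊗ₜ[k] y * t)) = x *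
                LinearMap.mul' k _ ((envAntipodeLin (k := k) (L := L)).lTensor _ t) *
                  envAntipodeLin (k := k) y := by
              clear ht
              induction t with
              | zero => simp
              | add p q hp hq =>
                rw [mul_add, map_add, map_add, hp, hq, map_add, map_add, mul_add, add_mul]
              | tmul p q => simp [envAntipodeLin_mul, mul_assoc]
            rw [this, ht, mul_assoc, Algebra.commutes, ← mul_assoc]
            simp
        rw [map_mul, key _ _ _ hb, ha, map_mul, map_mul]
      add_mem' := by
        intro a b ha hb
        simp only [Set.mem_ofPred_eq] at ha hb ⊢
        simp only [map_add, ha, hb]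
      algebraMap_mem' := by
        intro r
        simp [envAntipodeLin, Algebra.TensorProduct.algebraMap_apply] }
  refine env_mem_of_ι_mem S (fun x => ?_) u
  change LinearMap.mul' k _ ((envAntipodeLin (k := k) (L := L)).lTensor _ (envComul k L _)) =
      algebraMap k _ (envCounit k L _)
  simp [-UniversalEnvelopingAlgebra.ι_apply, envAntipodeLin]

instance envHopfAlgebra : HopfAlgebra k (UniversalEnvelopingAlgebra k L) where
  antipode := envAntipodeLin
  mul_antipode_rTensor_comul := LinearMap.ext env_antipode_left
  mul_antipode_lTensor_comul := LinearMap.ext env_antipode_right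

end Enveloping

/-! ### Module algebras and smash products -/

section Smash

open Coalgebra

/-- The structure of a left `H`-module algebra on the `k`-algebra `A`: an action of `H` with
`h · 1 = ε(h) 1` and `h · (a b) = ∑ (h₁ · a) (h₂ · b)`. -/
structure ModuleAlgebra (k H A : Type*) [CommRing k] [Ring H] [Bialgebra k H] [Ring A]
    [Algebra k A] where
  /-- the action -/
  act : H →ₐ[k] Module.End k A
  act_one : ∀ h, act h 1 = algebraMap k A (counit h)
  act_mul : ∀ h a b, act h (a * b) = LinearMap.mul' k A
    (TensorProduct.map (act.toLinearMap.flip a) (act.toLinearMap.flip b) (comul h))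

variable {k H A : Type*} [CommRing k] [Ring H] [Bialgebra k H] [Ring A] [Algebra k A]

/-- The smash product `A # H`: the space `A ⊗ H` with the multiplication
`(a # h) (b # g) = ∑ a (h₁ · b) # h₂ g`. -/
def SmashProduct (_M : ModuleAlgebra k H A) : Type _ := A ⊗[k] H

namespace SmashProduct

variable (M : ModuleAlgebra k H A)

instance : AddCommGroup (SmashProduct M) := inferInstanceAs (AddCommGroup (A ⊗[k] H))
instance : Module k (SmashProduct M) := inferInstanceAs (Module k (A ⊗[k] H))

/-- The element `a # h`. -/
def mk (a : A) (h : H) : SmashProduct M := (a ⊗ₜ[k] h : A ⊗[k] H)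

/-- The diagonal action of `H` on `A ⊗ H`: `h ▷ (b ⊗ g) = ∑ (h₁ · b) ⊗ h₂ g`. -/
def diag : H →ₐ[k] Module.End k (A ⊗[k] H) :=
  (Module.endTensorEndAlgHom (R := k) (S := k) (A := k) (M := A) (N := H)).comp
    ((Algebra.TensorProduct.map M.act (Algebra.lmul k H)).comp (Bialgebra.comulAlgHom k H))

/-- Left multiplication: `x ↦ (y ↦ x y)` with `(a # h) y = a (h ▷ y)`. -/
def mulLin : A ⊗[k] H →ₗ[k] Module.End k (A ⊗[k] H) :=
  TensorProduct.lift
    ((LinearMap.mul k (Module.End k (A ⊗[k] H))).compl₁₂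
      (LinearMap.rTensorHom H ∘ₗ LinearMap.mul k A) (diag M).toLinearMap)


theorem diag_tmul (h : H) (b : A) (g : H) : diag M h (b ⊗ₜ[k] g) =
    TensorProduct.map (M.act.toLinearMap.flip b) (LinearMap.mulRight k g) (comul h) := by
  have : ∀ t : H ⊗[k] H, (Module.endTensorEndAlgHom (R := k) (S := k) (A := k) (M := A) (N := H))
      (Algebra.TensorProduct.map M.act (Algebra.lmul k H) t) (b ⊗ₜ[k] g) =
      TensorProduct.map (M.act.toLinearMap.flip b) (LinearMap.mulRight k g) t := by
    intro t
    induction t with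
    | zero => simp
    | add x y hx hy => simp only [map_add, LinearMap.add_apply, hx, hy]
    | tmul x y => simp [Module.endTensorEndAlgHom]
  exact this _

theorem mulLin_tmul (a : A) (h : H) (y : A ⊗[k] H) :
    mulLin M (a ⊗ₜ[k] h) y = (LinearMap.mulLeft k a).rTensor H (diag M h y) := rfl

theorem diag_rTensor (h : H) (b : A) (y : A ⊗[k] H) :
    diag M h ((LinearMap.mulLeft k b).rTensor H y) =
      mulLin M (TensorProduct.map (M.act.toLinearMap.flip b) LinearMap.id (comul h)) y := by
  induction y with
  | zero => simp
  | add x y hx hy => rw [map_add, map_add, hx, hy, map_add]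
  | tmul c g =>
    rw [LinearMap.rTensor_tmul, LinearMap.mulLeft_apply, diag_tmul]
    -- both sides are images of the two iterated comultiplications of `h`
    let Ψ : H ⊗[k] (H ⊗[k] H) →ₗ[k] A ⊗[k] H :=
      (LinearMap.mul' k A).rTensor H ∘ₗ (TensorProduct.assoc k A A H).symm.toLinearMap ∘ₗ
        TensorProduct.map (M.act.toLinearMap.flip b)
          (TensorProduct.map (M.act.toLinearMap.flip c) (LinearMap.mulRight k g))
    have hl : ∀ t : H ⊗[k] H,
        TensorProduct.map (M.act.toLinearMap.flip (b * c)) (LinearMap.mulRight k g) t =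
          Ψ (TensorProduct.assoc k H H H (comul.rTensor H t)) := by
      intro t
      induction t with
      | zero => simp
      | add x y hx hy => simp only [map_add, hx, hy]
      | tmul x y =>
        have aux : ∀ s : H ⊗[k] H, Ψ (TensorProduct.assoc k H H H (s ⊗ₜ y)) =
            (LinearMap.mul' k A (TensorProduct.map (M.act.toLinearMap.flip b)
              (M.act.toLinearMap.flip c) s)) ⊗ₜ (y * g) := by
          intro s
          induction s with
          | zero => simp
          | add p q hp hq => simp only [map_add, TensorProduct.add_tmul, hp, hq]
          | tmul p q => simp [Ψ]
        rw [LinearMap.rTensor_tmul, aux, ← M.act_mul]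
        simp
    have hr : ∀ t : H ⊗[k] H,
        mulLin M (TensorProduct.map (M.act.toLinearMap.flip b) LinearMap.id t) (c ⊗ₜ[k] g) =
          Ψ (comul.lTensor H t) := by
      intro t
      induction t with
      | zero => simp
      | add x y hx hy => simp only [map_add, LinearMap.add_apply, hx, hy]
      | tmul x y =>
        rw [TensorProduct.map_tmul, mulLin_tmul, LinearMap.id_apply, diag_tmul,
          LinearMap.lTensor_tmul]
        generalize (comul y : H ⊗[k] H) = s
        induction s with
        | zero => simp
        | add p q hp hq => simp only [map_add, TensorProduct.tmul_add, hp, hq]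
        | tmul p q => simp [Ψ]
    rw [hl, hr, Coalgebra.coassoc_apply]

theorem mulLin_mulLin (x y z : A ⊗[k] H) :
    mulLin M (mulLin M x y) z = mulLin M x (mulLin M y z) := by
  have hL : ∀ (a : A) (w : A ⊗[k] H), mulLin M ((LinearMap.mulLeft k a).rTensor H w) z =
      (LinearMap.mulLeft k a).rTensor H (mulLin M w z) := by
    intro a w
    induction w with
    | zero => simp
    | add p q hp hq => simp only [map_add, LinearMap.add_apply, hp, hq]
    | tmul b g =>
      rw [LinearMap.rTensor_tmul, mulLin_tmul, mulLin_tmul, LinearMap.mulLeft_apply,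
        LinearMap.mulLeft_mul, LinearMap.rTensor_comp, LinearMap.comp_apply]
  have hD : ∀ (h : H) (w : A ⊗[k] H), mulLin M (diag M h w) z = diag M h (mulLin M w z) := by
    intro h w
    induction w with
    | zero => simp
    | add p q hp hq => simp only [map_add, LinearMap.add_apply, hp, hq]
    | tmul b g =>
      rw [mulLin_tmul, diag_rTensor, diag_tmul]
      generalize (comul h : H ⊗[k] H) = t
      induction t with
      | zero => simp
      | add p q hp hq => simp only [map_add, LinearMap.add_apply, hp, hq]
      | tmul p q =>
        simp only [TensorProduct.map_tmul, mulLin_tmul, LinearMap.mulRight_apply, map_mul,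
          LinearMap.id_apply, Module.End.mul_apply]
  induction x with
  | zero => simp
  | add p q hp hq => simp only [map_add, LinearMap.add_apply, hp, hq]
  | tmul a h => rw [mulLin_tmul, hL, hD, mulLin_tmul]

theorem mulLin_one (x : A ⊗[k] H) : mulLin M x (1 ⊗ₜ[k] 1) = x := by
  induction x with
  | zero => simp
  | add p q hp hq => simp only [map_add, LinearMap.add_apply, hp, hq]
  | tmul a h =>
    rw [mulLin_tmul, diag_tmul]
    have : ∀ t : H ⊗[k] H, TensorProduct.map (M.act.toLinearMap.flip 1) (LinearMap.mulRight k 1) t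
        = TensorProduct.map (Algebra.linearMap k A) LinearMap.id ((counit (R := k)).rTensor H t) := by
      intro t
      induction t with
      | zero => simp
      | add p q hp hq => simp only [map_add, hp, hq]
      | tmul p q => simp [M.act_one]
    rw [this, Coalgebra.rTensor_counit_comul]
    simp

theorem one_mulLin (x : A ⊗[k] H) : mulLin M (1 ⊗ₜ[k] 1) x = x := by
  rw [mulLin_tmul, map_one, Module.End.one_apply, LinearMap.mulLeft_one, LinearMap.rTensor_id,
    LinearMap.id_apply]

instance : Ring (SmashProduct M) :=
  { (inferInstance : AddCommGroup (SmashProduct M)) with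
    mul := fun x y => mulLin M x y
    one := mk M 1 1
    left_distrib := fun x y z => map_add (mulLin M x) y z
    right_distrib := fun x y z => LinearMap.congr_fun (map_add (mulLin M) x y) z
    zero_mul := fun x => LinearMap.congr_fun (map_zero (mulLin M)) x
    mul_zero := fun x => map_zero (mulLin M x)
    mul_assoc := mulLin_mulLin M
    one_mul := one_mulLin M
    mul_one := mulLin_one M }

instance : Algebra k (SmashProduct M) :=
  Algebra.ofModule
    (fun r x y => LinearMap.congr_fun (map_smul (mulLin M) r x) y)
    (fun r x y => map_smul (mulLin M x) r y)

theorem one_def : (1 : SmashProduct M) = mk M 1 1 := rfl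

/-- The multiplication rule `(a # h) (b # g) = ∑ a (h₁ · b) # h₂ g`. -/
theorem mk_mul_mk {ι : Type*} (a b : A) (h g : H) (r : Coalgebra.Repr k h ι) :
    mk M a h * mk M b g =
      ∑ i ∈ r.index, mk M (a * M.act (r.left i) b) (r.right i * g) := by
  change mulLin M (a ⊗ₜ[k] h) (b ⊗ₜ[k] g) = ∑ i ∈ r.index,
    ((a * M.act (r.left i) b) ⊗ₜ[k] (r.right i * g) : A ⊗[k] H)
  rw [mulLin_tmul, diag_tmul, ← r.eq]
  simp [map_sum]

end SmashProduct

end Smash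

/-! ### The generic quantum algebra of `sl₂` -/

section Generic

/-- Names of the generators of the quantum algebra. -/
inductive Gen
  | E | F | K | Kinv

variable (Q : Type*) [Field Q] (v : Q)

/-- The defining relations of the quantum algebra of `sl₂` with parameter `v`. -/
inductive Rel : FreeAlgebra Q Gen → FreeAlgebra Q Gen → Prop
  | K_Kinv : Rel (FreeAlgebra.ι Q Gen.K * FreeAlgebra.ι Q Gen.Kinv) 1
  | Kinv_K : Rel (FreeAlgebra.ι Q Gen.Kinv * FreeAlgebra.ι Q Gen.K) 1
  | K_E : Rel (FreeAlgebra.ι Q Gen.K * FreeAlgebra.ι Q Gen.E)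
      (v ^ 2 • (FreeAlgebra.ι Q Gen.E * FreeAlgebra.ι Q Gen.K))
  | K_F : Rel (FreeAlgebra.ι Q Gen.K * FreeAlgebra.ι Q Gen.F)
      ((v ^ 2)⁻¹ • (FreeAlgebra.ι Q Gen.F * FreeAlgebra.ι Q Gen.K))
  | E_F : Rel (FreeAlgebra.ι Q Gen.E * FreeAlgebra.ι Q Gen.F -
        FreeAlgebra.ι Q Gen.F * FreeAlgebra.ι Q Gen.E)
      ((v - v⁻¹)⁻¹ • (FreeAlgebra.ι Q Gen.K - FreeAlgebra.ι Q Gen.Kinv))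

/-- The quantum algebra of `sl₂` over the field `Q` with parameter `v`. -/
def Uq : Type _ := RingQuot (Rel Q v)

instance : Ring (Uq Q v) := inferInstanceAs (Ring (RingQuot (Rel Q v)))
instance : Algebra Q (Uq Q v) := inferInstanceAs (Algebra Q (RingQuot (Rel Q v)))

namespace Uq

/-- The quotient map from the free algebra. -/
def mk : FreeAlgebra Q Gen →ₐ[Q] Uq Q v := RingQuot.mkAlgHom Q (Rel Q v)

/-- The generators of the quantum algebra. -/
def gen (g : Gen) : Uq Q v := mk Q v (FreeAlgebra.ι Q g)

variable {Q v}

theorem mk_rel {x y : FreeAlgebra Q Gen} (h : Rel Q v x y) : mk Q v x = mk Q v y :=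
  RingQuot.mkAlgHom_rel Q h

theorem K_mul_Kinv : gen Q v .K * gen Q v .Kinv = 1 := by
  simpa [gen] using mk_rel (Rel.K_Kinv (Q := Q) (v := v))

theorem Kinv_mul_K : gen Q v .Kinv * gen Q v .K = 1 := by
  simpa [gen] using mk_rel (Rel.Kinv_K (Q := Q) (v := v))

theorem K_mul_E : gen Q v .K * gen Q v .E = v ^ 2 • (gen Q v .E * gen Q v .K) := by
  simpa [gen] using mk_rel (Rel.K_E (Q := Q) (v := v))

theorem K_mul_F : gen Q v .K * gen Q v .F = (v ^ 2)⁻¹ • (gen Q v .F * gen Q v .K) := by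
  simpa [gen] using mk_rel (Rel.K_F (Q := Q) (v := v))

theorem E_mul_F : gen Q v .E * gen Q v .F - gen Q v .F * gen Q v .E =
    (v - v⁻¹)⁻¹ • (gen Q v .K - gen Q v .Kinv) := by
  simpa [gen] using mk_rel (Rel.E_F (Q := Q) (v := v))

/-- Algebra maps out of the quantum algebra. -/
def lift {B : Type*} [Ring B] [Algebra Q B] (φ : Gen → B)
    (h₁ : φ .K * φ .Kinv = 1) (h₂ : φ .Kinv * φ .K = 1)
    (h₃ : φ .K * φ .E = v ^ 2 • (φ .E * φ .K))
    (h₄ : φ .K * φ .F = (v ^ 2)⁻¹ • (φ .F * φ .K))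
    (h₅ : φ .E * φ .F - φ .F * φ .E = (v - v⁻¹)⁻¹ • (φ .K - φ .Kinv)) : Uq Q v →ₐ[Q] B :=
  RingQuot.liftAlgHom Q ⟨FreeAlgebra.lift Q φ, by
    intro x y hxy
    cases hxy <;> simpa⟩

@[simp] theorem lift_gen {B : Type*} [Ring B] [Algebra Q B] (φ : Gen → B)
    (h₁ : φ .K * φ .Kinv = 1) (h₂ : φ .Kinv * φ .K = 1)
    (h₃ : φ .K * φ .E = v ^ 2 • (φ .E * φ .K))
    (h₄ : φ .K * φ .F = (v ^ 2)⁻¹ • (φ .F * φ .K))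
    (h₅ : φ .E * φ .F - φ .F * φ .E = (v - v⁻¹)⁻¹ • (φ .K - φ .Kinv)) (g : Gen) :
    lift φ h₁ h₂ h₃ h₄ h₅ (gen Q v g) = φ g := by
  unfold lift gen
  exact (RingQuot.liftAlgHom_mkAlgHom_apply (S := Q) _ _ _).trans (FreeAlgebra.lift_ι_apply φ g)

theorem Kinv_mul_E (hv : v ≠ 0) :
    gen Q v .Kinv * gen Q v .E = (v ^ 2)⁻¹ • (gen Q v .E * gen Q v .Kinv) := by
  have h : gen Q v .Kinv * (gen Q v .K * gen Q v .E) * gen Q v .Kinv =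
      gen Q v .Kinv * (v ^ 2 • (gen Q v .E * gen Q v .K)) * gen Q v .Kinv := by rw [K_mul_E]
  rw [← mul_assoc, Kinv_mul_K, one_mul, mul_smul_comm, smul_mul_assoc, mul_assoc, mul_assoc,
    K_mul_Kinv, mul_one] at h
  rw [h, smul_smul, inv_mul_cancel₀ (pow_ne_zero 2 hv), one_smul]

theorem Kinv_mul_F (hv : v ≠ 0) :
    gen Q v .Kinv * gen Q v .F = v ^ 2 • (gen Q v .F * gen Q v .Kinv) := by
  have h : gen Q v .Kinv * (gen Q v .K * gen Q v .F) * gen Q v .Kinv =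
      gen Q v .Kinv * ((v ^ 2)⁻¹ • (gen Q v .F * gen Q v .K)) * gen Q v .Kinv := by rw [K_mul_F]
  rw [← mul_assoc, Kinv_mul_K, one_mul, mul_smul_comm, smul_mul_assoc, mul_assoc, mul_assoc,
    K_mul_Kinv, mul_one] at h
  rw [h, smul_smul, mul_inv_cancel₀ (pow_ne_zero 2 hv), one_smul]

/-- Values of the comultiplication on generators: `E ↦ E ⊗ 1 + K ⊗ E`,
`F ↦ F ⊗ K⁻¹ + 1 ⊗ F`, `K ↦ K ⊗ K`. -/
def comulGen : Gen → Uq Q v ⊗[Q] Uq Q v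
  | .E => gen Q v .E ⊗ₜ 1 + gen Q v .K ⊗ₜ gen Q v .E
  | .F => gen Q v .F ⊗ₜ gen Q v .Kinv + 1 ⊗ₜ gen Q v .F
  | .K => gen Q v .K ⊗ₜ gen Q v .K
  | .Kinv => gen Q v .Kinv ⊗ₜ gen Q v .Kinv

/-- The comultiplication of the quantum algebra. -/
def comul (hv : v ≠ 0) : Uq Q v →ₐ[Q] Uq Q v ⊗[Q] Uq Q v :=
  lift comulGen
    (by simp [comulGen, K_mul_Kinv, Algebra.TensorProduct.one_def])
    (by simp [comulGen, Kinv_mul_K, Algebra.TensorProduct.one_def])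
    (by simp [comulGen, mul_add, add_mul, K_mul_E, TensorProduct.smul_tmul'])
    (by
      have : gen Q v .K * gen Q v .Kinv = gen Q v .Kinv * gen Q v .K := by
        rw [K_mul_Kinv, Kinv_mul_K]
      simp [comulGen, mul_add, add_mul, K_mul_F, TensorProduct.smul_tmul', this])
    (by
      have h1 := E_mul_F (Q := Q) (v := v)
      have h2 : (gen Q v .K * gen Q v .F) ⊗ₜ[Q] (gen Q v .E * gen Q v .Kinv) =
          (gen Q v .F * gen Q v .K) ⊗ₜ[Q] (gen Q v .Kinv * gen Q v .E) := by
        rw [K_mul_F, Kinv_mul_E hv, TensorProduct.smul_tmul]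
      simp only [comulGen, mul_add, add_mul, Algebra.TensorProduct.tmul_mul_tmul, one_mul, mul_one]
      rw [h2]
      calc _ = (gen Q v .E * gen Q v .F - gen Q v .F * gen Q v .E) ⊗ₜ[Q] gen Q v .Kinv
            + gen Q v .K ⊗ₜ[Q] (gen Q v .E * gen Q v .F - gen Q v .F * gen Q v .E) := by
              rw [TensorProduct.sub_tmul, TensorProduct.tmul_sub]; abel
        _ = _ := by
              rw [h1, TensorProduct.tmul_smul, ← TensorProduct.smul_tmul', ← smul_add,
                TensorProduct.sub_tmul, TensorProduct.tmul_sub]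
              congr 1
              abel)

/-- Values of the counit on generators: `E, F ↦ 0`, `K ↦ 1`. -/
def counitGen : Gen → Q
  | .E => 0
  | .F => 0
  | .K => 1
  | .Kinv => 1

/-- The counit of the quantum algebra. -/
def counit : Uq Q v →ₐ[Q] Q :=
  lift counitGen (by simp [counitGen]) (by simp [counitGen]) (by simp [counitGen])
    (by simp [counitGen]) (by simp [counitGen])

/-- Values of the antipode on generators: `E ↦ -K⁻¹E`, `F ↦ -FK`, `K ↦ K⁻¹`. -/
def antipodeGen : Gen → (Uq Q v)ᵐᵒᵖ
  | .E => MulOpposite.op (-(gen Q v .Kinv * gen Q v .E))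
  | .F => MulOpposite.op (-(gen Q v .F * gen Q v .K))
  | .K => MulOpposite.op (gen Q v .Kinv)
  | .Kinv => MulOpposite.op (gen Q v .K)

/-- The antipode of the quantum algebra, as an algebra map to the opposite algebra. -/
def antipode (hv : v ≠ 0) : Uq Q v →ₐ[Q] (Uq Q v)ᵐᵒᵖ :=
  lift antipodeGen
    (by simp only [antipodeGen, ← MulOpposite.op_mul, K_mul_Kinv, MulOpposite.op_one])
    (by simp only [antipodeGen, ← MulOpposite.op_mul, Kinv_mul_K, MulOpposite.op_one])
    (by
      simp only [antipodeGen, ← MulOpposite.op_mul, ← MulOpposite.op_smul]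
      congr 1
      have h : gen Q v .E * gen Q v .Kinv = v ^ 2 • (gen Q v .Kinv * gen Q v .E) := by
        rw [Kinv_mul_E hv, smul_smul, mul_inv_cancel₀ (pow_ne_zero 2 hv), one_smul]
      rw [neg_mul, mul_assoc, h, mul_neg, mul_smul_comm, smul_neg])
    (by
      simp only [antipodeGen, ← MulOpposite.op_mul, ← MulOpposite.op_smul]
      congr 1
      have h : gen Q v .F * gen Q v .Kinv = (v ^ 2)⁻¹ • (gen Q v .Kinv * gen Q v .F) := by
        rw [Kinv_mul_F hv, smul_smul, inv_mul_cancel₀ (pow_ne_zero 2 hv), one_smul]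
      rw [neg_mul, mul_assoc, K_mul_Kinv, mul_one, mul_neg, ← mul_assoc, Kinv_mul_F hv,
        smul_mul_assoc, mul_assoc, Kinv_mul_K, mul_one, smul_neg, smul_smul,
        inv_mul_cancel₀ (pow_ne_zero 2 hv), one_smul])
    (by
      simp only [antipodeGen, ← MulOpposite.op_mul, ← MulOpposite.op_smul, ← MulOpposite.op_sub]
      congr 1
      have h1 : gen Q v .F * gen Q v .K * (gen Q v .Kinv * gen Q v .E) =
          gen Q v .F * gen Q v .E := by
        rw [mul_assoc, ← mul_assoc (gen Q v .K), K_mul_Kinv, one_mul]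
      have h2 : gen Q v .Kinv * gen Q v .E * (gen Q v .F * gen Q v .K) =
          gen Q v .E * gen Q v .F := by
        have h3 : gen Q v .F * gen Q v .K = v ^ 2 • (gen Q v .K * gen Q v .F) := by
          rw [K_mul_F, smul_smul, mul_inv_cancel₀ (pow_ne_zero 2 hv), one_smul]
        rw [Kinv_mul_E hv, h3, smul_mul_smul_comm, inv_mul_cancel₀ (pow_ne_zero 2 hv), one_smul,
          mul_assoc, ← mul_assoc (gen Q v .Kinv), Kinv_mul_K, one_mul]
      rw [neg_mul_neg, neg_mul_neg, h1, h2, ← neg_sub (gen Q v .E * gen Q v .F), E_mul_F,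
        ← smul_neg, neg_sub])

end Uq

end Generic

/-! ### Lusztig's integral form and its specialization -/

/-- The ring `ℤ[v, v⁻¹]`. -/
abbrev ZV : Type := LaurentPolynomial ℤ

/-- The field `ℚ(v)`, as the field of fractions of `ℤ[v, v⁻¹]`. -/
abbrev QV : Type := FractionRing ZV

/-- The indeterminate `v` in `ℚ(v)`. -/
def qv : QV := algebraMap ZV QV (LaurentPolynomial.T 1)

theorem qv_ne_zero : qv ≠ 0 := by
  have h : IsUnit (LaurentPolynomial.T 1 : ZV) := LaurentPolynomial.isUnit_T 1
  exact (h.map (algebraMap ZV QV)).ne_zero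

/-- The generic quantum algebra of `sl₂` over `ℚ(v)`. -/
abbrev UGen : Type := Uq QV qv

instance : Algebra ZV UGen := Algebra.compHom UGen (algebraMap ZV QV)

instance : IsScalarTower ZV QV UGen := IsScalarTower.of_algebraMap_eq fun _ => rfl

/-- The quantum integer `[n] = (vⁿ - v⁻ⁿ) / (v - v⁻¹)`. -/
def qInt (n : ℕ) : QV := (qv ^ n - (qv⁻¹) ^ n) / (qv - qv⁻¹)

/-- The quantum factorial `[n]! = [1] [2] ⋯ [n]`. -/
def qFactorial (n : ℕ) : QV := ∏ i ∈ Finset.range n, qInt (i + 1)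

/-- The divided power `x⁽ⁿ⁾ = xⁿ / [n]!`. -/
def divPow (x : UGen) (n : ℕ) : UGen := (qFactorial n)⁻¹ • x ^ n

/-- Lusztig's integral form: the `ℤ[v, v⁻¹]`-subalgebra generated by `K`, `K⁻¹` and all divided
powers of `E` and `F`. -/
def UInt : Subalgebra ZV UGen :=
  Algebra.adjoin ZV ({Uq.gen QV qv .K, Uq.gen QV qv .Kinv} ∪
    (Set.range (divPow (Uq.gen QV qv .E)) ∪ Set.range (divPow (Uq.gen QV qv .F))))

/-- `K` in the integral form. -/
def intK : UInt := ⟨Uq.gen QV qv .K, Algebra.subset_adjoin (Or.inl (Or.inl rfl))⟩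

/-- `E⁽ⁿ⁾` in the integral form. -/
def intE (n : ℕ) : UInt :=
  ⟨divPow (Uq.gen QV qv .E) n, Algebra.subset_adjoin (Or.inr (Or.inl ⟨n, rfl⟩))⟩

/-- `F⁽ⁿ⁾` in the integral form. -/
def intF (n : ℕ) : UInt :=
  ⟨divPow (Uq.gen QV qv .F) n, Algebra.subset_adjoin (Or.inr (Or.inr ⟨n, rfl⟩))⟩

section Specialization

variable (k : Type*) [Field k] (ζ : kˣ)

/-- The specialization `ℤ[v, v⁻¹] → k`, `v ↦ ζ`. -/
def specHom : ZV →+* k := LaurentPolynomial.eval₂ (Int.castRingHom k) ζ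

/-- The field `k`, regarded as a `ℤ[v, v⁻¹]`-algebra through `v ↦ ζ`. -/
def Base (_ζ : kˣ) : Type _ := k

instance : Field (Base k ζ) := inferInstanceAs (Field k)
instance : Algebra k (Base k ζ) := inferInstanceAs (Algebra k k)
instance : Algebra ZV (Base k ζ) := RingHom.toAlgebra (S := Base k ζ) (specHom k ζ)
instance : SMulCommClass ZV k (Base k ζ) where
  smul_comm a c x := mul_left_comm (specHom k ζ a) c x

/-- The specialization `Û_ζ = k ⊗ UInt` of the integral form at `v = ζ`. -/
abbrev UHat : Type _ := Base k ζ ⊗[ZV] UInt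

/-- The relation `K^ℓ = 1`. -/
inductive KRel (ℓ : ℕ) : UHat k ζ → UHat k ζ → Prop
  | K_pow : KRel ℓ ((1 ⊗ₜ[ZV] intK) ^ ℓ) 1

/-- The quantum hyperalgebra `U_ζ`: the quotient of `Û_ζ` by the two-sided ideal generated by
`K^ℓ - 1`. -/
def UZeta (ℓ : ℕ) : Type _ := RingQuot (KRel k ζ ℓ)

variable (ℓ : ℕ)

instance : Ring (UZeta k ζ ℓ) := inferInstanceAs (Ring (RingQuot (KRel k ζ ℓ)))
instance : Algebra k (UZeta k ζ ℓ) := inferInstanceAs (Algebra k (RingQuot (KRel k ζ ℓ)))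

namespace UZeta

/-- The quotient map `Û_ζ → U_ζ`. -/
def ofHat : UHat k ζ →ₐ[k] UZeta k ζ ℓ := RingQuot.mkAlgHom k (KRel k ζ ℓ)

/-- The image in `U_ζ` of an element of the integral form. -/
def sp : UInt →+* UZeta k ζ ℓ :=
  (ofHat k ζ ℓ).toRingHom.comp
    (Algebra.TensorProduct.includeRight : UInt →ₐ[ZV] UHat k ζ).toRingHom

/-- `K` in `U_ζ`. -/
def K : UZeta k ζ ℓ := sp k ζ ℓ intK

/-- The divided power `E⁽ⁿ⁾` in `U_ζ`; the generator `E` is `E⁽¹⁾`. -/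
def E (n : ℕ) : UZeta k ζ ℓ := sp k ζ ℓ (intE n)

/-- The divided power `F⁽ⁿ⁾` in `U_ζ`; the generator `F` is `F⁽¹⁾`. -/
def F (n : ℕ) : UZeta k ζ ℓ := sp k ζ ℓ (intF n)

end UZeta

/-- The Frobenius–Lusztig kernel: the subalgebra of `U_ζ` generated by `E`, `F` and `K`. -/
def frobKernel : Subalgebra k (UZeta k ζ ℓ) :=
  Algebra.adjoin k {UZeta.E k ζ ℓ 1, UZeta.F k ζ ℓ 1, UZeta.K k ζ ℓ}

end Specialization

/-! ### Hopf structures and the maps of the theorem -/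

/-- A Hopf algebra structure on the given `k`-algebra `H`. -/
structure HopfStr (k H : Type*) [Field k] [Ring H] [Algebra k H] where
  /-- the comultiplication -/
  comul : H →ₐ[k] H ⊗[k] H
  /-- the counit -/
  counit : H →ₐ[k] k
  /-- the antipode -/
  antipode : H →ₗ[k] H
  coassoc : ∀ x, TensorProduct.assoc k H H H (comul.toLinearMap.rTensor H (comul x)) =
    comul.toLinearMap.lTensor H (comul x)
  counit_left : ∀ x, counit.toLinearMap.rTensor H (comul x) = 1 ⊗ₜ x
  counit_right : ∀ x, counit.toLinearMap.lTensor H (comul x) = x ⊗ₜ 1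
  antipode_left : ∀ x, LinearMap.mul' k H (antipode.rTensor H (comul x)) =
    algebraMap k H (counit x)
  antipode_right : ∀ x, LinearMap.mul' k H (antipode.lTensor H (comul x)) =
    algebraMap k H (counit x)

section Maps

variable {k : Type*} [Field k] {ζ : kˣ} {ℓ : ℕ}

/-- The Hopf structure on `U_ζ` is induced by that of the generic quantum algebra: for `x` in the
integral form, `Δ x`, `ε x` and `S x` have their coefficients in the integral form (respectively in
`ℤ[v, v⁻¹]`), and specializing them gives the values of the structure maps of `U_ζ`
at the image of `x`. The integral form is free over `ℤ[v, v⁻¹]` and its image spans `U_ζ`, so there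
is at most one such structure; on generators it has the usual values, such as
`Δ(E⁽ⁿ⁾) = ∑ v^{b(n-b)} E⁽ⁿ⁻ᵇ⁾ Kᵇ ⊗ E⁽ᵇ⁾` at `v = ζ`. -/
structure HopfStr.IsInduced (𝓗 : HopfStr k (UZeta k ζ ℓ)) : Prop where
  comul : ∀ x : UInt, ∃ (n : ℕ) (a b : Fin n → UInt),
    Uq.comul qv_ne_zero (x : UGen) = ∑ i, (a i : UGen) ⊗ₜ[QV] (b i : UGen) ∧
    𝓗.comul (UZeta.sp k ζ ℓ x) = ∑ i, UZeta.sp k ζ ℓ (a i) ⊗ₜ[k] UZeta.sp k ζ ℓ (b i)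
  counit : ∀ x : UInt, ∃ c : ZV, Uq.counit (x : UGen) = algebraMap ZV QV c ∧
    𝓗.counit (UZeta.sp k ζ ℓ x) = specHom k ζ c
  antipode : ∀ x : UInt, ∃ y : UInt, Uq.antipode qv_ne_zero (x : UGen) = MulOpposite.op (y : UGen) ∧
    𝓗.antipode (UZeta.sp k ζ ℓ x) = UZeta.sp k ζ ℓ y

/-- The Lie algebra `sl₂`. -/
abbrev SL2 (k : Type*) [Field k] := LieAlgebra.SpecialLinear.sl (Fin 2) k

/-- The enveloping algebra `U = U(sl₂)`. -/
abbrev USl2 (k : Type*) [Field k] := UniversalEnvelopingAlgebra k (SL2 k)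

/-- The element `e` of `U(sl₂)`, the matrix with a `1` in the upper right corner. -/
def e (k : Type*) [Field k] : USl2 k :=
  UniversalEnvelopingAlgebra.ι k (LieAlgebra.SpecialLinear.single (0 : Fin 2) 1 (by decide) (1 : k))

/-- The element `f` of `U(sl₂)`, the matrix with a `1` in the lower left corner. -/
def f (k : Type*) [Field k] : USl2 k :=
  UniversalEnvelopingAlgebra.ι k (LieAlgebra.SpecialLinear.single (1 : Fin 2) 0 (by decide) (1 : k))

/-- `Fr : U_ζ → U` is the Frobenius map: a map of Hopf algebras with `E, F ↦ 0`, `K ↦ 1`,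
`E⁽ˡ⁾ ↦ e`, `F⁽ˡ⁾ ↦ f`. -/
structure IsFrobenius (𝓗 : HopfStr k (UZeta k ζ ℓ)) (Fr : UZeta k ζ ℓ →ₐ[k] USl2 k) : Prop where
  comul : ∀ x, Coalgebra.comul (R := k) (Fr x) =
    TensorProduct.map Fr.toLinearMap Fr.toLinearMap (𝓗.comul x)
  counit : ∀ x, Coalgebra.counit (R := k) (Fr x) = 𝓗.counit x
  antipode : ∀ x, HopfAlgebra.antipode k (Fr x) = Fr (𝓗.antipode x)
  map_E : Fr (UZeta.E k ζ ℓ 1) = 0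
  map_F : Fr (UZeta.F k ζ ℓ 1) = 0
  map_K : Fr (UZeta.K k ζ ℓ) = 1
  map_divE : Fr (UZeta.E k ζ ℓ ℓ) = e k
  map_divF : Fr (UZeta.F k ζ ℓ ℓ) = f k

/-- The right coaction `ρ = (I ⊗ Fr) Δ_ζ` of `U` on `U_ζ`. -/
def coaction (𝓗 : HopfStr k (UZeta k ζ ℓ)) (Fr : UZeta k ζ ℓ →ₐ[k] USl2 k) :
    UZeta k ζ ℓ →ₐ[k] UZeta k ζ ℓ ⊗[k] USl2 k :=
  (Algebra.TensorProduct.map (AlgHom.id k _) Fr).comp 𝓗.comul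

/-- `γ'` is the inverse of `γ : C → A` for the convolution product. -/
structure IsConvInverse {C A : Type*} [Ring C] [Bialgebra k C] [Ring A] [Algebra k A]
    (γ γ' : C →ₗ[k] A) : Prop where
  left : ∀ c, LinearMap.mul' k A (TensorProduct.map γ' γ (Coalgebra.comul c)) =
    algebraMap k A (Coalgebra.counit c)
  right : ∀ c, LinearMap.mul' k A (TensorProduct.map γ γ' (Coalgebra.comul c)) =
    algebraMap k A (Coalgebra.counit c)

/-- The element `∑ γ(v₁) a γ'(v₂)`. -/
def conj {C A : Type*} [Ring C] [Bialgebra k C] [Ring A] [Algebra k A]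
    (γ γ' : C →ₗ[k] A) (v : C) (a : A) : A :=
  LinearMap.mul' k A (TensorProduct.map (LinearMap.mulRight k a ∘ₗ γ) γ' (Coalgebra.comul v))

end Maps

end QuantumSL2

end

noncomputable section

/-! No basis of the integral form is used. Facts about U_q over ℚ(v) are carried to U_ζ by
single-valued relations: a subring P of A × D in which (0, d) ∈ P forces d = 0. If P contains
compatible pairs over the scalars and over the generators of the integral form, and the value
attached to K has ℓ-th power 1, then P defines an algebra map U_ζ → D (`exists_lift_of_rel`).
Different choices of P give Δ, ε, S, the representation behind Fr, and the symmetry E ↔ F. In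
characteristic zero U_ζ is generated by K, E, F, E⁽ˡ⁾, F⁽ˡ⁾ (`subalgebra_eq_top`), so identities
between algebra maps are checked on five elements.

Hopf structure. For Δ the relation is the image of the tensor square of the integral form, and
single-valuedness says that a tensor which vanishes over ℚ(v) also vanishes in U_ζ ⊗ U_ζ
(`sum_sp_tmul_sp_eq_zero`). This holds because the integral form is torsion free and the kernel of v
↦ ζ is principal: a linear relation can be divided by the generator until some coefficient survives
at ζ, and then a term is eliminated.

Frobenius map. U_q acts on divided monomials x_{(a,b)} with Gaussian binomials as coefficients. At
ζ, by the quantum Lucas rule `qbin_add_root`, the vectors whose indices are not both divisible by ℓ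
span a submodule. On the quotient K is 1, E⁽ⁿ⁾ and F⁽ⁿ⁾ are 0 unless ℓ ∣ n, and E⁽ˡ⁾, F⁽ˡ⁾ act as e,
f on polynomials in two variables. That U(sl₂)-module is faithful (`slRep_injective`), so the action
factors through a map Fr : U_ζ → U(sl₂).

Splitting. An algebra map out of U(sl₂) is a pair X, Y with [[X,Y],X] = 2X and [[X,Y],Y] = -2Y
(`slHom`). For X = E⁽ˡ⁾, Y = F⁽ˡ⁾ this follows from the commutation formula `dp_gE_mul_dp_gF`. The
Cartan elements [K;c;t] with t < ℓ specialize directly and are periodic in c modulo ℓ. The two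
exceptional ones, [K;0;ℓ] and [K;-ℓ;ℓ], also have values at ζ, and these differ by 1
(`exists_cartan_kBin_mem_specRel`). This difference produces the right-hand side of the relation.

Smash product. Since e and f are primitive, they act on U_ζ by the commutators with E⁽ˡ⁾ and F⁽ˡ⁾.
These preserve the kernel, because [E⁽ˡ⁾, F] = [K;1-ℓ] E⁽ˡ⁻¹⁾. The map a # v ↦ a γ(v) is onto
because its image contains the five generators. It is injective because a ⊗ v is recovered from ρ(a
γ(v)) = ∑ a γ(v₁) ⊗ v₂ by multiplying with γ⁻¹ (`untwist_comp`). The same formula, followed by the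
counit, shows that every coinvariant lies in the kernel. -/

namespace QuantumSL2

/-! ### Balanced Gaussian binomial coefficients -/

section Gauss

/-- The balanced Gaussian binomial coefficient at a unit `v`. -/
def qbin {R : Type*} [CommRing R] (v : Rˣ) : ℕ → ℕ → R
  | _, 0 => 1
  | 0, _ + 1 => 0
  | n + 1, c + 1 => ((v ^ (c + 1) : Rˣ) : R) * qbin v n (c + 1) +
      ((v ^ ((c : ℤ) - n) : Rˣ) : R) * qbin v n c

section Ring

variable {R S : Type*} [CommRing R] [CommRing S] (v : Rˣ)

@[simp] theorem qbin_zero_right (n : ℕ) : qbin v n 0 = 1 := by cases n <;> rfl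

@[simp] theorem qbin_zero_succ (c : ℕ) : qbin v 0 (c + 1) = 0 := rfl

theorem qbin_succ_succ (n c : ℕ) : qbin v (n + 1) (c + 1) =
    ((v ^ (c + 1) : Rˣ) : R) * qbin v n (c + 1) + ((v ^ ((c : ℤ) - n) : Rˣ) : R) * qbin v n c := rfl

theorem qbin_eq_zero {n c : ℕ} (h : n < c) : qbin v n c = 0 := by
  induction n generalizing c with
  | zero => obtain ⟨c, rfl⟩ : ∃ d, c = d + 1 := ⟨c - 1, by omega⟩; rfl
  | succ n ih =>
    obtain ⟨c, rfl⟩ : ∃ d, c = d + 1 := ⟨c - 1, by omega⟩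
    rw [qbin_succ_succ, ih (by omega), ih (by omega), mul_zero, mul_zero, add_zero]

@[simp] theorem qbin_self (n : ℕ) : qbin v n n = 1 := by
  induction n with
  | zero => rfl
  | succ n ih => rw [qbin_succ_succ, qbin_eq_zero v (Nat.lt_succ_self n), ih]; simp

/-- Pascal's recursion involves no division. One family of binomials thus serves ℤ[v, v⁻¹], ℚ(v) and
the value at ζ, where the quotient of factorials would be meaningless. -/
theorem map_qbin (g : R →+* S) (n c : ℕ) : g (qbin v n c) = qbin (Units.map g v) n c := by
  induction n generalizing c with
  | zero => cases c <;> simp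
  | succ n ih =>
    cases c with
    | zero => simp
    | succ c =>
      rw [qbin_succ_succ, qbin_succ_succ, map_add, map_mul, map_mul, ih, ih, ← map_pow, ← map_zpow]
      rfl

/-- The `q`-Vandermonde convolution for a sequence satisfying Pascal's rule in its upper index. -/
theorem qVandermonde (K : Rˣ) (φ : ℤ → ℕ → R) (h0 : ∀ c, φ c 0 = 1)
    (hP : ∀ c t, φ (c + 1) (t + 1) = ((v ^ ((t : ℤ) + 1) : Rˣ) : R) * φ c (t + 1) +
      ((v ^ ((t : ℤ) - c) * K⁻¹ : Rˣ) : R) * φ c t) (c : ℤ) (n t : ℕ) :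
    φ (c + n) t = ∑ j ∈ Finset.range (t + 1),
      ((v ^ ((n : ℤ) * ((t : ℤ) - j) - c * j) * K⁻¹ ^ j : Rˣ) : R) * qbin v n j * φ c (t - j) := by
  induction n generalizing t with
  | zero =>
    rw [Finset.sum_range_succ', Finset.sum_eq_zero]
    · simp
    · intro j _; simp
  | succ n ih =>
    cases t with
    | zero => simp [h0]
    | succ t =>
      rw [show c + ((n + 1 : ℕ) : ℤ) = (c + n) + 1 by push_cast; ring, hP, ih (t + 1), ih t,
        Finset.sum_range_succ' _ (t + 1), Finset.sum_range_succ' _ (t + 1), mul_add, Finset.mul_sum,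
        Finset.mul_sum, add_right_comm, ← Finset.sum_add_distrib]
      congr 1
      · refine Finset.sum_congr rfl fun j hj => ?_
        rw [Finset.mem_range] at hj
        rw [qbin_succ_succ, Nat.add_sub_add_right]
        -- The two contributions to the coefficient of φ c (t - j) share a monomial in v and K⁻¹.
        -- What remains is v^(j+1) and v^(j-n), the coefficients in Pascal's rule for `qbin v (n +
        -- 1) (j + 1)`.
        have e1 : v ^ ((t : ℤ) + 1) * (v ^ ((n : ℤ) * (((t + 1 : ℕ) : ℤ) - ((j + 1 : ℕ) : ℤ)) -
            c * ((j + 1 : ℕ) : ℤ)) * K⁻¹ ^ (j + 1)) =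
            v ^ (((n + 1 : ℕ) : ℤ) * (((t + 1 : ℕ) : ℤ) - ((j + 1 : ℕ) : ℤ)) -
            c * ((j + 1 : ℕ) : ℤ)) * K⁻¹ ^ (j + 1) * v ^ (j + 1) := by
          rw [← mul_assoc, ← zpow_add, mul_right_comm, ← zpow_natCast v (j + 1), ← zpow_add]
          congr 2; push_cast; ring
        have e2 : v ^ ((t : ℤ) - (c + n)) * K⁻¹ * (v ^ ((n : ℤ) * ((t : ℤ) - j) - c * j) * K⁻¹ ^ j) =
            v ^ (((n + 1 : ℕ) : ℤ) * (((t + 1 : ℕ) : ℤ) - ((j + 1 : ℕ) : ℤ)) -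
            c * ((j + 1 : ℕ) : ℤ)) * K⁻¹ ^ (j + 1) * v ^ ((j : ℤ) - n) := by
          rw [mul_mul_mul_comm, ← zpow_add, mul_right_comm, ← zpow_add, pow_succ' K⁻¹]
          congr 2; push_cast; ring
        have e1' := congrArg (Units.val) e1
        have e2' := congrArg (Units.val) e2
        simp only [Units.val_mul] at e1' e2' ⊢
        linear_combination (qbin v n (j + 1) * φ c (t - j)) * e1' +
          (qbin v n j * φ c (t - j)) * e2'
      · have e1 : v ^ ((t : ℤ) + 1) * v ^ ((n : ℤ) * ((t : ℤ) + 1)) =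
            v ^ (((n : ℤ) + 1) * ((t : ℤ) + 1)) := by
          rw [← zpow_add]; congr 1; ring
        have e1' := congrArg (Units.val) e1
        simp only [Units.val_mul] at e1'
        simp [← e1', mul_assoc]

end Ring

/-! ### Absorption identities -/

section Field

variable {Q : Type*} [Field Q] (v : Qˣ)

/-- `vⁿ - v⁻ⁿ` -/
def qs (n : ℤ) : Q := (v : Q) ^ n - (v : Q) ^ (-n)

@[simp] theorem qs_zero : qs v 0 = 0 := by simp [qs]

/-- The two absorption rules feed each other through Pascal's rule: the first at n gives the second
at n, and both at n give the first at n + 1. Nothing is divided by a factor `qs`, so they stay valid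
at a root of unity, where such factors vanish. -/
theorem qbin_absorb_aux (n : ℕ) :
    (∀ c : ℕ, qs v (c + 1) * qbin v (n + 1) (c + 1) = qs v (n + 1) * qbin v n c) ∧
    (∀ c : ℕ, qs v (n + 1 - c) * qbin v (n + 1) c = qs v (n + 1) * qbin v n c) := by
  have step : ∀ n : ℕ,
      (∀ c : ℕ, qs v (c + 1) * qbin v (n + 1) (c + 1) = qs v (n + 1) * qbin v n c) →
      ∀ c : ℕ, qs v (n + 1 - c) * qbin v (n + 1) c = qs v (n + 1) * qbin v n c := by
    intro n h c
    cases c with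
    | zero => simp
    | succ c =>
      have hP := qbin_succ_succ v n c
      have hA := h c
      rw [← zpow_natCast, Units.val_zpow_eq_zpow_val, Units.val_zpow_eq_zpow_val] at hP
      have hv : (v : Q) ≠ 0 := v.ne_zero
      have key : (v : Q) ^ ((c + 1 : ℕ) : ℤ) * qs v ((n : ℤ) + 1 - ((c + 1 : ℕ) : ℤ)) =
          qs v (n + 1) - (v : Q) ^ ((c : ℤ) - n) * qs v (c + 1) := by
        simp only [qs, mul_sub, ← zpow_add₀ hv]
        push_cast; ring_nf
      -- Only a power of v is cancelled, and it is invertible even when the `qs` factors are zero.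
      refine mul_left_cancel₀ (zpow_ne_zero ((c + 1 : ℕ) : ℤ) hv) ?_
      rw [← mul_assoc, key]
      linear_combination (qs v (n + 1)) * hP - (v : Q) ^ ((c : ℤ) - n) * hA
  induction n with
  | zero =>
    have h : ∀ c : ℕ, qs v (c + 1) * qbin v (0 + 1) (c + 1) = qs v ((0 : ℕ) + 1) * qbin v 0 c := by
      intro c
      cases c with
      | zero => simp
      | succ c => rw [qbin_eq_zero v (by omega), qbin_eq_zero v (by omega), mul_zero, mul_zero]
    exact ⟨h, step 0 h⟩
  | succ n ih =>
    have h : ∀ c : ℕ, qs v (c + 1) * qbin v (n + 1 + 1) (c + 1) =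
        qs v ((n + 1 : ℕ) + 1) * qbin v (n + 1) c := by
      intro c
      have hP := qbin_succ_succ v (n + 1) c
      rw [← zpow_natCast, Units.val_zpow_eq_zpow_val, Units.val_zpow_eq_zpow_val] at hP
      have h1 := ih.1 c
      have h2 := ih.2 c
      have hv : (v : Q) ≠ 0 := v.ne_zero
      have key : (v : Q) ^ ((c + 1 : ℕ) : ℤ) * qs v ((n : ℤ) + 1 - c) =
          qs v ((n + 1 : ℕ) + 1) - (v : Q) ^ ((c : ℤ) - (n + 1 : ℕ)) * qs v (c + 1) := by
        simp only [qs, mul_sub, ← zpow_add₀ hv]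
        push_cast; ring_nf
      rw [hP]
      linear_combination (v : Q) ^ ((c + 1 : ℕ) : ℤ) * h1 - (v : Q) ^ ((c + 1 : ℕ) : ℤ) * h2 +
        qbin v (n + 1) c * key
    exact ⟨h, step _ h⟩

theorem qbin_absorb (n c : ℕ) :
    qs v (c + 1) * qbin v (n + 1) (c + 1) = qs v (n + 1) * qbin v n c :=
  (qbin_absorb_aux v n).1 c

end Field

/-! ### Gaussian binomials at a root of unity of odd order -/

section RootOfUnity

variable {Q : Type*} [Field Q] {ζ : Qˣ} {ℓ : ℕ}

/-- Vanishing means ζ^(2c) = 1, and oddness of ℓ removes the factor 2. -/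
theorem qs_ne_zero (hζ : IsPrimitiveRoot ζ ℓ) (hodd : Odd ℓ) {c : ℕ} (hc : ¬ ℓ ∣ c) :
    qs ζ c ≠ 0 := by
  intro h
  rw [qs, sub_eq_zero] at h
  have h2 : ζ ^ (2 * c) = 1 := by
    ext
    have hz : (ζ : Q) ^ (c : ℤ) ≠ 0 := zpow_ne_zero _ ζ.ne_zero
    rw [zpow_neg] at h
    have : (ζ : Q) ^ (c : ℤ) * (ζ : Q) ^ (c : ℤ) = 1 := by
      nth_rewrite 2 [h]; exact mul_inv_cancel₀ hz
    rw [zpow_natCast, ← pow_add, ← two_mul] at this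
    simpa using this
  have h3 := hζ.dvd_of_pow_eq_one _ h2
  exact hc ((Nat.Coprime.dvd_of_dvd_mul_left (Nat.Coprime.symm (Nat.coprime_two_left.mpr hodd))) h3)

theorem unit_zpow_add (hζ : IsPrimitiveRoot ζ ℓ) (n m : ℤ) : ζ ^ (n + ℓ * m) = ζ ^ n := by
  rw [zpow_add, zpow_mul, zpow_natCast, hζ.pow_eq_one, one_zpow, mul_one]

theorem qs_add_mul (hζ : IsPrimitiveRoot ζ ℓ) (n m : ℤ) : qs ζ (n + ℓ * m) = qs ζ n := by
  simp only [qs, ← Units.val_zpow_eq_zpow_val]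
  rw [unit_zpow_add hζ, show -(n + ℓ * m) = -n + ℓ * (-m) by ring, unit_zpow_add hζ]

/-- In the absorption rule the factor [ℓ] vanishes at ζ while [c] does not. -/
theorem qbin_root_middle (hζ : IsPrimitiveRoot ζ ℓ) (hodd : Odd ℓ) {c : ℕ} (h0 : 0 < c)
    (hc : c < ℓ) : qbin ζ ℓ c = 0 := by
  obtain ⟨c, rfl⟩ : ∃ d, c = d + 1 := ⟨c - 1, by omega⟩
  obtain ⟨m, rfl⟩ : ∃ d, ℓ = d + 1 := ⟨ℓ - 1, by omega⟩
  have h := qbin_absorb ζ m c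
  have h1 : qs ζ ((m : ℤ) + 1) = 0 := by
    have := qs_add_mul hζ 0 1
    simpa using this
  rw [h1, zero_mul] at h
  refine (mul_eq_zero.mp h).resolve_left ?_
  exact_mod_cast qs_ne_zero hζ hodd (Nat.not_dvd_of_pos_of_lt h0 hc)

/-- One step of the quantum Lucas theorem. For n = 0 it is the vanishing of the middle binomials.
Pascal's rule propagates it because its coefficients are powers of ζ, unchanged when an exponent
moves by ℓ. -/
theorem qbin_add_root (hζ : IsPrimitiveRoot ζ ℓ) (hodd : Odd ℓ) (n c : ℕ) :
    qbin ζ (n + ℓ) c = qbin ζ n c + if ℓ ≤ c then qbin ζ n (c - ℓ) else 0 := by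
  have hℓ : 0 < ℓ := hodd.pos
  induction n generalizing c with
  | zero =>
    rcases Nat.eq_zero_or_pos c with rfl | h0
    · simp; omega
    rcases lt_trichotomy c ℓ with h | rfl | h
    · rw [zero_add, qbin_root_middle hζ hodd h0 h, if_neg (by omega), qbin_eq_zero ζ h0, add_zero]
    · rw [zero_add, qbin_eq_zero ζ h0]; simp
    · rw [zero_add, qbin_eq_zero ζ h, if_pos (by omega), qbin_eq_zero ζ h0, qbin_eq_zero ζ (by omega),
        add_zero]
  | succ n ih =>
    cases c with
    | zero => simp; omega
    | succ c =>
      rw [show n + 1 + ℓ = (n + ℓ) + 1 by ring, qbin_succ_succ, qbin_succ_succ, ih, ih]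
      have e1 : ζ ^ ((c : ℤ) - ((n + ℓ : ℕ) : ℤ)) = ζ ^ ((c : ℤ) - n) := by
        rw [← unit_zpow_add hζ ((c : ℤ) - n) (-1)]; congr 1; push_cast; ring
      rw [e1]
      rcases lt_trichotomy (c + 1) ℓ with h | h | h
      · rw [if_neg (by omega), if_neg (by omega), if_neg (by omega)]; ring
      · rw [if_pos (by omega), if_neg (by omega), if_pos (by omega), h, hζ.pow_eq_one]; simp
        ring
      · obtain ⟨d, rfl⟩ : ∃ d, c = d + ℓ := ⟨c - ℓ, by omega⟩
        rw [if_pos (by omega), if_pos (by omega), if_pos (by omega), show d + ℓ + 1 - ℓ = d + 1 by omega,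
          show d + ℓ - ℓ = d by omega, qbin_succ_succ]
        have e2 : ζ ^ (d + ℓ + 1) = ζ ^ (d + 1) := by
          rw [show d + ℓ + 1 = d + 1 + ℓ by ring, pow_add, hζ.pow_eq_one, mul_one]
        have e3 : ζ ^ (((d + ℓ : ℕ) : ℤ) - n) = ζ ^ ((d : ℤ) - n) := by
          rw [← unit_zpow_add hζ ((d : ℤ) - n) 1]; congr 1; push_cast; ring
        rw [e2, e3]; ring

theorem qbin_add_mul_root_of_lt (hζ : IsPrimitiveRoot ζ ℓ) (hodd : Odd ℓ) (n m : ℕ) {c : ℕ}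
    (hc : c < ℓ) : qbin ζ (n + ℓ * m) c = qbin ζ n c := by
  induction m with
  | zero => simp
  | succ m ih => rw [mul_add, mul_one, ← add_assoc, qbin_add_root hζ hodd, if_neg (by omega), ih, add_zero]

/-- Adding ℓ to the upper index reproduces Pascal's rule for ordinary binomials. This is how
classical sl₂ appears inside the quantum algebra. -/
theorem qbin_mul_root (hζ : IsPrimitiveRoot ζ ℓ) (hodd : Odd ℓ) (n c : ℕ) :
    qbin ζ (ℓ * n) (ℓ * c) = (n.choose c : Q) := by
  have hℓ : 0 < ℓ := hodd.pos
  induction n generalizing c with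
  | zero =>
    cases c with
    | zero => simp
    | succ c => rw [mul_zero, qbin_eq_zero _ (by positivity)]; simp
  | succ n ih =>
    rw [mul_add, mul_one, qbin_add_root hζ hodd, ih]
    cases c with
    | zero => simp; omega
    | succ c =>
      rw [if_pos (Nat.le_mul_of_pos_right _ (by omega)), mul_add, mul_one, Nat.add_sub_cancel, ih,
        Nat.choose_succ_succ, Nat.cast_add, add_comm]

theorem qbin_mul_root_of_not_dvd (hζ : IsPrimitiveRoot ζ ℓ) (hodd : Odd ℓ) (n : ℕ) {c : ℕ}
    (hc : ¬ ℓ ∣ c) : qbin ζ (ℓ * n) c = 0 := by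
  have h0 : ∀ d, ¬ ℓ ∣ d → 0 < d := fun d hd => Nat.pos_of_ne_zero (by rintro rfl; simp at hd)
  induction n generalizing c with
  | zero => rw [mul_zero, qbin_eq_zero _ (h0 _ hc)]
  | succ n ih =>
    rw [mul_add, mul_one, qbin_add_root hζ hodd, ih hc, zero_add]
    split_ifs with h
    · exact ih fun hd => hc ((Nat.dvd_sub_iff_left h (dvd_refl ℓ)).mp hd)
    · rfl

end RootOfUnity

end Gauss

/-! ### Scalars and divided powers -/

section Scalars

/-- The unit `v` of `ℤ[v, v⁻¹]`. -/
def vZ : ZVˣ := (LaurentPolynomial.isUnit_T 1).unit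

@[simp] theorem val_vZ : (vZ : ZV) = LaurentPolynomial.T 1 := rfl

/-- The unit `v` of `ℚ(v)`. -/
def vQ : QVˣ := Units.map (algebraMap ZV QV).toMonoidHom vZ

@[simp] theorem val_vQ : (vQ : QV) = qv := rfl

theorem val_vZ_zpow (n : ℤ) : ((vZ ^ n : ZVˣ) : ZV) = LaurentPolynomial.T n := by
  have h : ∀ n : ℕ, ((vZ ^ n : ZVˣ) : ZV) = LaurentPolynomial.T n := fun n => by
    rw [Units.val_pow_eq_pow_val, val_vZ, LaurentPolynomial.T_pow, mul_one]
  rcases Int.eq_nat_or_neg n with ⟨m, rfl | rfl⟩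
  · rw [zpow_natCast, h]
  · rw [zpow_neg, zpow_natCast]
    refine Units.inv_eq_of_mul_eq_one_right ?_
    rw [h, ← LaurentPolynomial.T_add, add_neg_cancel, LaurentPolynomial.T_zero]

theorem algebraMap_vZ_zpow (n : ℤ) : algebraMap ZV QV (vZ ^ n : ZVˣ) = qv ^ n := by
  rw [← val_vQ, ← Units.val_zpow_eq_zpow_val, vQ, ← map_zpow]; rfl

theorem algebraMap_qbin (n c : ℕ) : algebraMap ZV QV (qbin vZ n c) = qbin vQ n c :=
  map_qbin vZ (algebraMap ZV QV) n c

theorem algebraMap_injective : Function.Injective (algebraMap ZV QV) :=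
  IsFractionRing.injective ZV QV

theorem qv_zpow_ne_one {n : ℤ} (hn : n ≠ 0) : qv ^ n ≠ 1 := by
  rw [← algebraMap_vZ_zpow, val_vZ_zpow, ← map_one (algebraMap ZV QV)]
  intro h
  have := congrArg (fun p : ZV => p.coeff 0) (algebraMap_injective h)
  rw [← LaurentPolynomial.T_zero] at this
  simp [hn] at this

theorem qs_vQ_ne_zero {n : ℤ} (hn : n ≠ 0) : qs vQ n ≠ 0 := by
  intro h
  rw [qs, sub_eq_zero, val_vQ] at h
  refine qv_zpow_ne_one (n := n + n) (by omega) ?_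
  rw [zpow_add₀ qv_ne_zero]
  nth_rewrite 2 [h]
  rw [← zpow_add₀ qv_ne_zero, add_neg_cancel, zpow_zero]

theorem qInt_eq (n : ℕ) : qInt n = qs vQ n / qs vQ 1 := by
  simp [qInt, qs]

theorem qInt_ne_zero {n : ℕ} (hn : n ≠ 0) : qInt n ≠ 0 := by
  rw [qInt_eq]
  exact div_ne_zero (qs_vQ_ne_zero (by exact_mod_cast hn)) (qs_vQ_ne_zero one_ne_zero)

theorem qFactorial_zero : qFactorial 0 = 1 := by simp [qFactorial]

theorem qFactorial_succ (n : ℕ) : qFactorial (n + 1) = qFactorial n * qInt (n + 1) :=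
  Finset.prod_range_succ _ _

theorem qFactorial_ne_zero (n : ℕ) : qFactorial n ≠ 0 :=
  Finset.prod_ne_zero_iff.mpr fun _ _ => qInt_ne_zero (Nat.succ_ne_zero _)

theorem qFactorial_add (a b : ℕ) :
    qFactorial (a + b) = qbin vQ (a + b) a * qFactorial a * qFactorial b := by
  induction a with
  | zero => simp [qFactorial_zero]
  | succ a ih =>
    have h := qbin_absorb vQ (a + b) a
    have h1 : qs vQ 1 ≠ 0 := qs_vQ_ne_zero one_ne_zero
    rw [show a + 1 + b = a + b + 1 by ring, qFactorial_succ, ih, qFactorial_succ, qInt_eq, qInt_eq]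
    field_simp
    push_cast at h ⊢
    linear_combination (-1 : QV) * h * qFactorial a * qFactorial b

theorem divPow_zero (x : UGen) : divPow x 0 = 1 := by simp [divPow, qFactorial_zero]

theorem divPow_one (x : UGen) : divPow x 1 = x := by
  have : qInt 1 = 1 := by rw [qInt_eq]; exact div_self (qs_vQ_ne_zero one_ne_zero)
  simp [divPow, qFactorial, this]

theorem divPow_mul (x : UGen) (a b : ℕ) :
    divPow x a * divPow x b = qbin vQ (a + b) a • divPow x (a + b) := by
  have ha := qFactorial_ne_zero a
  have hb := qFactorial_ne_zero b
  have hab := qFactorial_ne_zero (a + b)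
  rw [divPow, divPow, divPow, smul_mul_smul_comm, ← pow_add, smul_smul]
  congr 1
  field_simp
  rw [qFactorial_add]
  ring

variable (k : Type*) [Field k] (ζ : kˣ)

@[simp] theorem specHom_vZ_zpow (n : ℤ) : specHom k ζ (vZ ^ n : ZVˣ) = (ζ : k) ^ n := by
  rw [val_vZ_zpow, specHom, LaurentPolynomial.eval₂_T, Units.val_zpow_eq_zpow_val]

theorem specHom_qbin (n c : ℕ) : specHom k ζ (qbin vZ n c) = qbin ζ n c := by
  rw [map_qbin]
  congr 1
  ext
  simpa using specHom_vZ_zpow k ζ 1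

end Scalars

/-! ### The universal property of `U_ζ` -/

section Lift

variable (k : Type*) [Field k] (ζ : kˣ) (ℓ : ℕ)

/-- `K⁻¹` in the integral form. -/
def intKinv : UInt := ⟨Uq.gen QV qv .Kinv, Algebra.subset_adjoin (Or.inl (Or.inr rfl))⟩

theorem intK_mul_intKinv : intK * intKinv = 1 := Subtype.ext Uq.K_mul_Kinv

theorem intKinv_mul_intK : intKinv * intK = 1 := Subtype.ext Uq.Kinv_mul_K

/-- A subring property of the integral form may be checked on generators. -/
theorem uInt_induction {p : UInt → Prop} (hK : p intK) (hKi : p intKinv) (hE : ∀ n, p (intE n))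
    (hF : ∀ n, p (intF n)) (hc : ∀ c : ZV, p (algebraMap ZV UInt c))
    (ha : ∀ x y, p x → p y → p (x + y)) (hm : ∀ x y, p x → p y → p (x * y)) (x : UInt) : p x := by
  obtain ⟨x, hx⟩ := x
  refine Algebra.adjoin_induction (p := fun x hx => p ⟨x, hx⟩) ?_ (fun c => hc c)
    (fun x y hx hy h1 h2 => ha ⟨x, hx⟩ ⟨y, hy⟩ h1 h2)
    (fun x y hx hy h1 h2 => hm ⟨x, hx⟩ ⟨y, hy⟩ h1 h2) hx
  rintro x ((rfl | rfl) | ⟨n, rfl⟩ | ⟨n, rfl⟩)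
  exacts [hK, hKi, hE n, hF n]

namespace UZeta

variable {k ζ ℓ}

theorem sp_algebraMap (c : ZV) :
    sp k ζ ℓ (algebraMap ZV UInt c) = algebraMap k (UZeta k ζ ℓ) (specHom k ζ c) := by
  have h1 : (Algebra.TensorProduct.includeRight : UInt →ₐ[ZV] UHat k ζ) (algebraMap ZV UInt c) =
      algebraMap k (UHat k ζ) (specHom k ζ c) := by
    rw [AlgHom.commutes, Algebra.TensorProduct.algebraMap_apply,
      Algebra.TensorProduct.algebraMap_apply]
    rfl
  change ofHat k ζ ℓ ((Algebra.TensorProduct.includeRight : UInt →ₐ[ZV] UHat k ζ) _) = _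
  rw [h1, AlgHom.commutes]

theorem sp_smul (c : ZV) (x : UInt) : sp k ζ ℓ (c • x) = specHom k ζ c • sp k ζ ℓ x := by
  rw [Algebra.smul_def, map_mul, sp_algebraMap, ← Algebra.smul_def]

theorem K_pow : K k ζ ℓ ^ ℓ = 1 := by
  have h := RingQuot.mkAlgHom_rel k (KRel.K_pow (k := k) (ζ := ζ) (ℓ := ℓ))
  rw [map_pow, map_one] at h
  exact h

theorem span_range_sp : Submodule.span k (Set.range (sp k ζ ℓ)) = ⊤ := by
  rw [eq_top_iff]
  rintro a -
  obtain ⟨t, rfl⟩ := RingQuot.mkAlgHom_surjective k (KRel k ζ ℓ) a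
  induction t using TensorProduct.induction_on with
  | zero => rw [map_zero]; exact zero_mem _
  | add x y hx hy => rw [map_add]; exact add_mem hx hy
  | tmul c x =>
    have h : (c ⊗ₜ[ZV] x : UHat k ζ) = (show k from c) • ((1 : Base k ζ) ⊗ₜ[ZV] x) := by
      rw [TensorProduct.smul_tmul']
      congr 1
      exact (mul_one c).symm
    rw [h, map_smul]
    exact Submodule.smul_mem _ _ (Submodule.subset_span ⟨x, rfl⟩)

theorem sp_induction {p : UZeta k ζ ℓ → Prop} (h : ∀ x, p (sp k ζ ℓ x)) (h0 : p 0)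
    (ha : ∀ x y, p x → p y → p (x + y)) (hs : ∀ (c : k) x, p x → p (c • x)) (a : UZeta k ζ ℓ) :
    p a := by
  have ha' : a ∈ Submodule.span k (Set.range (sp k ζ ℓ)) := by
    rw [span_range_sp]; exact Submodule.mem_top
  induction ha' using Submodule.span_induction with
  | mem x hx => obtain ⟨y, rfl⟩ := hx; exact h y
  | zero => exact h0
  | add x y _ _ hx hy => exact ha x y hx hy
  | smul c x _ hx => exact hs c x hx

/-- U_ζ is a base change followed by a quotient, so a ring map on the integral form that specializes
the scalars and sends K to an element of order dividing ℓ is all that is needed. -/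
theorem exists_lift {D : Type*} [Ring D] [Algebra k D] (g : UInt →+* D)
    (hg : ∀ c : ZV, g (algebraMap ZV UInt c) = algebraMap k D (specHom k ζ c))
    (hK : g intK ^ ℓ = 1) : ∃ Ψ : UZeta k ζ ℓ →ₐ[k] D, ∀ x, Ψ (sp k ζ ℓ x) = g x := by
  -- The target becomes an algebra over ℤ[v, v⁻¹] through v ↦ ζ, as the universal property of the
  -- tensor product requires.
  let _ : Algebra ZV k := (specHom k ζ).toAlgebra
  let _ : Algebra ZV D := Algebra.compHom D (specHom k ζ)
  have _ : IsScalarTower ZV k D := IsScalarTower.of_algebraMap_eq fun _ => rfl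
  have _ : IsScalarTower ZV k (Base k ζ) := IsScalarTower.of_algebraMap_eq fun _ => rfl
  let g' : UInt →ₐ[ZV] D := { g with commutes' := hg }
  let b : Base k ζ →ₐ[k] D := Algebra.ofId k D
  have hcomm : ∀ x y, Commute (b x) (g' y) := fun x y => Algebra.commutes (R := k) (A := D) (show k from x) (g' y)
  let Ψ : UHat k ζ →ₐ[k] D := Algebra.TensorProduct.lift b g' hcomm
  have hΨ : ∀ x : UInt, Ψ (1 ⊗ₜ x) = g x := fun x => by
    change Algebra.TensorProduct.lift b g' _ _ = _
    rw [Algebra.TensorProduct.lift_tmul, map_one, one_mul]; rfl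
  refine ⟨RingQuot.liftAlgHom k ⟨Ψ, ?_⟩, fun x => ?_⟩
  · rintro _ _ ⟨⟩
    rw [map_pow, hΨ, hK, map_one]
  · exact (RingQuot.liftAlgHom_mkAlgHom_apply (S := k) _ _ _).trans (hΨ x)

/-- Construction of algebra maps out of `U_ζ` from a multiplicative relation between a ring that
receives the generic quantum algebra and the target algebra. -/
theorem exists_lift_of_rel {A D : Type*} [Ring A] [Ring D] [Algebra k D] (j : UGen →+* A)
    (P : Subring (A × D)) (h0 : ∀ d, ((0 : A), d) ∈ P → d = 0)
    (hc : ∀ c : ZV, (j (algebraMap ZV UGen c), algebraMap k D (specHom k ζ c)) ∈ P)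
    (dK : D) (hK : (j (intK : UGen), dK) ∈ P) (hKℓ : dK ^ ℓ = 1)
    (hKi : ∃ d, (j (intKinv : UGen), d) ∈ P)
    (hE : ∀ n, ∃ d, (j (intE n : UGen), d) ∈ P) (hF : ∀ n, ∃ d, (j (intF n : UGen), d) ∈ P) :
    -- As P is closed under subtraction, single-valuedness at 0 gives it everywhere. As P is closed
    -- under the ring operations, being in its domain needs checking only on generators.
    ∃ Ψ : UZeta k ζ ℓ →ₐ[k] D, ∀ x : UInt, (j (x : UGen), Ψ (sp k ζ ℓ x)) ∈ P := by
  have huniq : ∀ a d d', (a, d) ∈ P → (a, d') ∈ P → d = d' := fun a d d' h h' => by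
    have := P.sub_mem h h'
    rw [Prod.mk_sub_mk, sub_self] at this
    exact sub_eq_zero.mp (h0 _ this)
  have hex : ∀ x : UInt, ∃ d, (j (x : UGen), d) ∈ P := by
    refine uInt_induction ⟨dK, hK⟩ hKi hE hF (fun c => ⟨_, hc c⟩) ?_ ?_
    · rintro x y ⟨d, hd⟩ ⟨d', hd'⟩
      exact ⟨d + d', by simpa using P.add_mem hd hd'⟩
    · rintro x y ⟨d, hd⟩ ⟨d', hd'⟩
      exact ⟨d * d', by simpa using P.mul_mem hd hd'⟩
  choose g hg using hex
  let g' : UInt →+* D :=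
    { toFun := g
      map_one' := huniq _ _ _ (hg 1) (by rw [OneMemClass.coe_one, map_one]; exact P.one_mem)
      map_mul' := fun x y => huniq _ _ _ (hg _) (by simpa using P.mul_mem (hg x) (hg y))
      map_zero' := huniq _ _ _ (hg 0) (by rw [ZeroMemClass.coe_zero, map_zero]; exact P.zero_mem)
      map_add' := fun x y => huniq _ _ _ (hg _) (by simpa using P.add_mem (hg x) (hg y)) }
  obtain ⟨Ψ, hΨ⟩ := exists_lift (k := k) (ζ := ζ) (ℓ := ℓ) g'
    (fun c => huniq _ _ _ (hg _) (hc c)) (by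
      have : g' intK = dK := huniq _ _ _ (hg _) hK
      rw [this, hKℓ])
  exact ⟨Ψ, fun x => by rw [hΨ]; exact hg x⟩

theorem sp_intKinv_mul_K : sp k ζ ℓ intKinv * K k ζ ℓ = 1 := by
  rw [K, ← map_mul, intKinv_mul_intK, map_one]

theorem K_mul_sp_intKinv : K k ζ ℓ * sp k ζ ℓ intKinv = 1 := by
  rw [K, ← map_mul, intK_mul_intKinv, map_one]

theorem sp_intKinv_pow : sp k ζ ℓ intKinv ^ ℓ = 1 := by
  have h : Commute (K k ζ ℓ) (sp k ζ ℓ intKinv) := by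
    rw [Commute, SemiconjBy, sp_intKinv_mul_K, K_mul_sp_intKinv]
  have := h.mul_pow ℓ
  rwa [K_mul_sp_intKinv, one_pow, K_pow, one_mul, eq_comm] at this

theorem sp_intKinv (hℓ : 0 < ℓ) : sp k ζ ℓ intKinv = K k ζ ℓ ^ (ℓ - 1) := by
  have h : K k ζ ℓ ^ (ℓ - 1) * K k ζ ℓ = 1 := by
    rw [← pow_succ, Nat.sub_add_cancel hℓ, K_pow]
  calc _ = K k ζ ℓ ^ (ℓ - 1) * K k ζ ℓ * sp k ζ ℓ intKinv := by rw [h, one_mul]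
    _ = _ := by rw [mul_assoc, K_mul_sp_intKinv, mul_one]

theorem intE_mul (a b : ℕ) : intE a * intE b = qbin vZ (a + b) a • intE (a + b) := by
  ext
  change divPow _ a * divPow _ b = qbin vZ (a + b) a • divPow _ (a + b)
  rw [divPow_mul, ← algebraMap_qbin, algebraMap_smul]

theorem intF_mul (a b : ℕ) : intF a * intF b = qbin vZ (a + b) a • intF (a + b) := by
  ext
  change divPow _ a * divPow _ b = qbin vZ (a + b) a • divPow _ (a + b)
  rw [divPow_mul, ← algebraMap_qbin, algebraMap_smul]

theorem E_mul (a b : ℕ) : E k ζ ℓ a * E k ζ ℓ b = qbin ζ (a + b) a • E k ζ ℓ (a + b) := by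
  rw [E, E, ← map_mul, intE_mul, sp_smul, specHom_qbin]; rfl

theorem F_mul (a b : ℕ) : F k ζ ℓ a * F k ζ ℓ b = qbin ζ (a + b) a • F k ζ ℓ (a + b) := by
  rw [F, F, ← map_mul, intF_mul, sp_smul, specHom_qbin]; rfl

theorem E_zero : E k ζ ℓ 0 = 1 := by
  rw [E, show intE 0 = 1 from Subtype.ext (divPow_zero _), map_one]

theorem F_zero : F k ζ ℓ 0 = 1 := by
  rw [F, show intF 0 = 1 from Subtype.ext (divPow_zero _), map_one]

end UZeta

/-! ### Which divided powers generate -/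

section Generation

variable {k ζ ℓ}

variable {A : Type*} [Ring A] [Algebra k A] {x : ℕ → A}

/-- For a < ℓ the quantum integers up to a are invertible at ζ, so these divided powers are
multiples of ordinary powers. -/
theorem dividedPower_mem_of_lt (hodd : Odd ℓ) (hζ : IsPrimitiveRoot ζ ℓ) (h0 : x 0 = 1)
    (hmul : ∀ a b, x a * x b = qbin ζ (a + b) a • x (a + b)) (S : Subalgebra k A) (h1 : x 1 ∈ S)
    {a : ℕ} (ha : a < ℓ) : x a ∈ S := by
  induction a with
  | zero => rw [h0]; exact one_mem S
  | succ a ih =>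
    have h2 := qbin_absorb ζ a 0
    have h3 : qs ζ ((a : ℤ) + 1) ≠ 0 := by
      exact_mod_cast qs_ne_zero hζ hodd (Nat.not_dvd_of_pos_of_lt (Nat.succ_pos a) ha)
    have h4 : qbin ζ (1 + a) 1 ≠ 0 := by
      intro h
      rw [add_comm] at h
      rw [zero_add, h, mul_zero, qbin_zero_right, mul_one] at h2
      exact h3 h2.symm
    have h5 : x (a + 1) = (qbin ζ (1 + a) 1)⁻¹ • (x 1 * x a) := by
      rw [hmul, smul_smul, inv_mul_cancel₀ h4, one_smul, add_comm]
    rw [h5]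
    exact S.smul_mem (S.mul_mem h1 (ih (by omega))) _

theorem dividedPower_mul_root (hodd : Odd ℓ) (hζ : IsPrimitiveRoot ζ ℓ)
    (hmul : ∀ a b, x a * x b = qbin ζ (a + b) a • x (a + b)) (b : ℕ) :
    x ℓ * x (ℓ * b) = ((b + 1 : ℕ) : k) • x (ℓ * (b + 1)) := by
  have h := qbin_mul_root hζ hodd (b + 1) 1
  rw [hmul, show ℓ + ℓ * b = ℓ * (b + 1) by ring]
  rw [mul_one, Nat.choose_one_right] at h
  rw [h]

theorem dividedPower_add_mul_root (hodd : Odd ℓ) (hζ : IsPrimitiveRoot ζ ℓ)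
    (hmul : ∀ a b, x a * x b = qbin ζ (a + b) a • x (a + b)) {a : ℕ} (ha : a < ℓ) (b : ℕ) :
    x (a + ℓ * b) = x a * x (ℓ * b) := by
  rw [hmul, qbin_add_mul_root_of_lt hζ hodd _ _ ha, qbin_self, one_smul]

/-- Write n = r + ℓb with r < ℓ. Then x_n = x_r x_{ℓb}, and x_{ℓb} is x_ℓ^b / b!, which is where
characteristic zero enters. -/
theorem dividedPower_mem [CharZero k] (hodd : Odd ℓ) (hζ : IsPrimitiveRoot ζ ℓ) (h0 : x 0 = 1)
    (hmul : ∀ a b, x a * x b = qbin ζ (a + b) a • x (a + b)) (S : Subalgebra k A) (h1 : x 1 ∈ S)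
    (hℓ : x ℓ ∈ S) (n : ℕ) : x n ∈ S := by
  have hb : ∀ b, x (ℓ * b) ∈ S := by
    intro b
    induction b with
    | zero => rw [mul_zero, h0]; exact one_mem S
    | succ b ih =>
      have hne : ((b + 1 : ℕ) : k) ≠ 0 := Nat.cast_ne_zero.mpr (Nat.succ_ne_zero b)
      have : x (ℓ * (b + 1)) = ((b + 1 : ℕ) : k)⁻¹ • (x ℓ * x (ℓ * b)) := by
        rw [dividedPower_mul_root hodd hζ hmul, smul_smul, inv_mul_cancel₀ hne, one_smul]
      rw [this]
      exact S.smul_mem (S.mul_mem hℓ ih) _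
  rw [← Nat.mod_add_div n ℓ, dividedPower_add_mul_root hodd hζ hmul (Nat.mod_lt _ hodd.pos)]
  exact S.mul_mem (dividedPower_mem_of_lt hodd hζ h0 hmul S h1 (Nat.mod_lt _ hodd.pos)) (hb _)

end Generation

namespace UZeta

variable {k ζ ℓ}

/-- K⁻¹ is K^(ℓ-1), and all divided powers come from the first and the ℓ-th. This reduces every
later identity of algebra maps to five elements. -/
theorem subalgebra_eq_top [CharZero k] (hodd : Odd ℓ) (hζ : IsPrimitiveRoot ζ ℓ)
    (S : Subalgebra k (UZeta k ζ ℓ)) (hK : K k ζ ℓ ∈ S) (hE : E k ζ ℓ 1 ∈ S) (hF : F k ζ ℓ 1 ∈ S)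
    (hEℓ : E k ζ ℓ ℓ ∈ S) (hFℓ : F k ζ ℓ ℓ ∈ S) : S = ⊤ := by
  rw [eq_top_iff]
  rintro a -
  refine sp_induction (p := (· ∈ S)) ?_ (zero_mem S) (fun x y => S.add_mem)
    (fun c x hx => S.smul_mem hx c) a
  refine uInt_induction (p := fun x => sp k ζ ℓ x ∈ S) hK ?_
    (dividedPower_mem hodd hζ E_zero E_mul S hE hEℓ)
    (dividedPower_mem hodd hζ F_zero F_mul S hF hFℓ) (fun c => ?_) (fun x y hx hy => ?_)
    (fun x y hx hy => ?_)
  · rw [sp_intKinv hodd.pos]; exact S.pow_mem hK _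
  · rw [sp_algebraMap]; exact S.algebraMap_mem _
  · rw [map_add]; exact S.add_mem hx hy
  · rw [map_mul]; exact S.mul_mem hx hy

theorem algHom_ext [CharZero k] (hodd : Odd ℓ) (hζ : IsPrimitiveRoot ζ ℓ) {D : Type*} [Ring D]
    [Algebra k D] {φ ψ : UZeta k ζ ℓ →ₐ[k] D} (hK : φ (K k ζ ℓ) = ψ (K k ζ ℓ))
    (hE : φ (E k ζ ℓ 1) = ψ (E k ζ ℓ 1)) (hF : φ (F k ζ ℓ 1) = ψ (F k ζ ℓ 1))
    (hEℓ : φ (E k ζ ℓ ℓ) = ψ (E k ζ ℓ ℓ)) (hFℓ : φ (F k ζ ℓ ℓ) = ψ (F k ζ ℓ ℓ)) : φ = ψ := by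
  ext a
  have : a ∈ AlgHom.equalizer φ ψ := by
    rw [subalgebra_eq_top hodd hζ (AlgHom.equalizer φ ψ) hK hE hF hEℓ hFℓ]; trivial
  exact this

end UZeta

end Lift

/-! ### Generic commutation formulas -/

section Combinatorics

open Finset

/-- The common induction step for the q-binomial theorem and for the commutation formula: each term
of level n contributes to two neighbours of level n + 1, and the boundary terms that nobody
contributes to vanish. -/
theorem sum_antidiagonal_shift {M : Type*} [AddCommMonoid M] (g g₁ g₂ : ℕ → ℕ → M)
    (h : ∀ i j, g i j = g₁ i j + g₂ i j) (h₁ : ∀ j, g₁ 0 j = 0) (h₂ : ∀ i, g₂ i 0 = 0) (n : ℕ) :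
    ∑ p ∈ HasAntidiagonal.antidiagonal n, (g₁ (p.1 + 1) p.2 + g₂ p.1 (p.2 + 1)) =
      ∑ p ∈ HasAntidiagonal.antidiagonal (n + 1), g p.1 p.2 := by
  simp only [h, sum_add_distrib]
  congr 1
  · rw [Nat.sum_antidiagonal_succ, h₁, zero_add]
  · rw [Nat.sum_antidiagonal_succ', h₂, zero_add]

end Combinatorics

/-! ### The q-binomial theorem for divided powers -/

section DividedBinomial

variable {B : Type*} [Ring B] [Algebra QV B]

/-- The divided power of an element of a `ℚ(v)`-algebra. -/
def dp (x : B) (n : ℕ) : B := (qFactorial n)⁻¹ • x ^ n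

theorem dp_zero (x : B) : dp x 0 = 1 := by simp [dp, qFactorial_zero]

theorem mul_dp (x : B) (n : ℕ) : x * dp x n = qInt (n + 1) • dp x (n + 1) := by
  have h := qInt_ne_zero (Nat.succ_ne_zero n)
  have h2 := qFactorial_ne_zero n
  rw [dp, dp, smul_smul, mul_smul_comm, ← pow_succ', qFactorial_succ]
  congr 1
  field_simp

theorem qInt_zero : qInt 0 = 0 := by simp [qInt]

/-- This is [i+j] = v^(-j)[i] + v^i[j], multiplied by v^(ij) to stay with natural exponents. The
truncated subtractions are harmless since [0] = 0. -/
theorem qv_pow_mul_qInt_add (i j : ℕ) :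
    qv ^ (i * j) * qInt (i + j) =
      qv ^ ((i - 1) * j) * qInt i + qv ^ (i * (j - 1)) * qv ^ (2 * i) * qInt j := by
  have hv := qv_ne_zero
  have h1 : qs vQ 1 ≠ 0 := qs_vQ_ne_zero one_ne_zero
  rcases Nat.eq_zero_or_pos i with rfl | hi
  · simp [qInt_zero]
  rcases Nat.eq_zero_or_pos j with rfl | hj
  · simp [qInt_zero]
  obtain ⟨i, rfl⟩ : ∃ d, i = d + 1 := ⟨i - 1, by omega⟩
  obtain ⟨j, rfl⟩ : ∃ d, j = d + 1 := ⟨j - 1, by omega⟩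
  rw [qInt_eq, qInt_eq, qInt_eq]
  field_simp
  simp only [qs, val_vQ, mul_sub, ← zpow_natCast, ← zpow_add₀ hv, Nat.add_sub_cancel]
  push_cast; ring_nf

theorem mul_dp_of_mul {x y : B} {c : QV} (h : y * x = c • (x * y)) (n : ℕ) :
    y * dp x n = c ^ n • (dp x n * y) := by
  have : ∀ n, y * x ^ n = c ^ n • (x ^ n * y) := by
    intro n
    induction n with
    | zero => simp
    | succ n ih =>
      rw [pow_succ, ← mul_assoc, ih, smul_mul_assoc, mul_assoc, h, mul_smul_comm, smul_smul,
        mul_assoc, pow_succ]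
  rw [dp, mul_smul_comm, this, smul_comm, smul_mul_assoc]

/-- The `q`-binomial theorem for divided powers. -/
theorem dp_add {x y : B} (h : y * x = qv ^ 2 • (x * y)) (n : ℕ) :
    dp (x + y) n = ∑ p ∈ Finset.HasAntidiagonal.antidiagonal n, qv ^ (p.1 * p.2) • (dp x p.1 * dp y p.2) := by
  induction n with
  | zero => simp [dp_zero]
  | succ n ih =>
    have hn := qInt_ne_zero (Nat.succ_ne_zero n)
    have h1 := mul_dp (x + y) n
    rw [ih] at h1
    have h2 : dp (x + y) (n + 1) = (qInt (n + 1))⁻¹ • ((x + y) *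
        ∑ p ∈ Finset.HasAntidiagonal.antidiagonal n, qv ^ (p.1 * p.2) • (dp x p.1 * dp y p.2)) := by
      rw [h1, smul_smul, inv_mul_cancel₀ hn, one_smul]
    rw [h2, inv_smul_eq_iff₀ hn, Finset.smul_sum, Finset.mul_sum]
    -- Multiplied by [n+1], the coefficient at (i, j) splits into the share coming from left
    -- multiplication by x and the share coming from y, the latter with a factor v^(2i) for passing
    -- y across the i-th divided power of x.
    trans ∑ p ∈ Finset.HasAntidiagonal.antidiagonal (n + 1),
        (qv ^ (p.1 * p.2) * qInt (p.1 + p.2)) • (dp x p.1 * dp y p.2)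
    · rw [← sum_antidiagonal_shift (fun i j => (qv ^ (i * j) * qInt (i + j)) • (dp x i * dp y j))
        (fun i j => (qv ^ ((i - 1) * j) * qInt i) • (dp x i * dp y j))
        (fun i j => (qv ^ (i * (j - 1)) * qv ^ (2 * i) * qInt j) • (dp x i * dp y j))
        (fun i j => by rw [qv_pow_mul_qInt_add, add_smul]) (fun j => by simp [qInt_zero])
        (fun i => by simp [qInt_zero])]
      refine Finset.sum_congr rfl fun p _ => ?_
      rw [add_mul, mul_smul_comm, mul_smul_comm, ← mul_assoc, ← mul_assoc, mul_dp,
        mul_dp_of_mul h, smul_mul_assoc, smul_mul_assoc, mul_assoc (dp x p.1), mul_dp, mul_smul_comm,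
        smul_smul, smul_smul, smul_smul, Nat.add_sub_cancel, Nat.add_sub_cancel, ← pow_mul]
    · refine Finset.sum_congr rfl fun p hp => ?_
      rw [Finset.HasAntidiagonal.mem_antidiagonal.mp hp, mul_comm, mul_smul]

theorem map_dp {B' : Type*} [Ring B'] [Algebra QV B'] (f : B →ₐ[QV] B') (x : B) (n : ℕ) :
    f (dp x n) = dp (f x) n := by
  rw [dp, map_smul, map_pow]; rfl

end DividedBinomial

section Generators

/-- `E` in the generic algebra. -/
abbrev gE : UGen := Uq.gen QV qv .E
/-- `F` in the generic algebra. -/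
abbrev gF : UGen := Uq.gen QV qv .F
/-- `K` in the generic algebra. -/
abbrev gK : UGen := Uq.gen QV qv .K
/-- `K⁻¹` in the generic algebra. -/
abbrev gKi : UGen := Uq.gen QV qv .Kinv

theorem gK_mul_dp_gE (n : ℕ) : gK * dp gE n = qv ^ (2 * n) • (dp gE n * gK) := by
  rw [mul_dp_of_mul (Uq.K_mul_E), pow_mul]

theorem ugen_induction {p : UGen → Prop} (hg : ∀ g, p (Uq.gen QV qv g))
    (hc : ∀ c, p (algebraMap QV UGen c)) (ha : ∀ x y, p x → p y → p (x + y))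
    (hm : ∀ x y, p x → p y → p (x * y)) (x : UGen) : p x := by
  obtain ⟨y, rfl⟩ := RingQuot.mkAlgHom_surjective QV (Rel QV qv) x
  induction y with
  | grade0 r => rw [AlgHom.commutes]; exact hc r
  | grade1 g => exact hg g
  | mul a b h1 h2 => rw [map_mul]; exact hm _ _ h1 h2
  | add a b h1 h2 => rw [map_add]; exact ha _ _ h1 h2

end Generators

/-! ### Coproduct, counit and antipode of divided powers -/

section Coproduct

open Uq

theorem comul_gen (g : Gen) : Uq.comul qv_ne_zero (gen QV qv g) = comulGen g := by
  unfold Uq.comul; rw [lift_gen]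

theorem counit_gen (g : Gen) : Uq.counit (gen QV qv g) = (counitGen g : QV) := by
  unfold Uq.counit; rw [lift_gen]

theorem antipode_gen (g : Gen) : Uq.antipode qv_ne_zero (gen QV qv g) = antipodeGen g := by
  unfold Uq.antipode; rw [lift_gen]

theorem dp_tmul_one (x : UGen) (n : ℕ) : dp (x ⊗ₜ[QV] (1 : UGen)) n = dp x n ⊗ₜ 1 := by
  rw [dp, dp, Algebra.TensorProduct.tmul_pow, one_pow, TensorProduct.smul_tmul']

theorem dp_tmul (x y : UGen) (n : ℕ) : dp (x ⊗ₜ[QV] y) n = (x ^ n) ⊗ₜ dp y n := by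
  rw [dp, dp, Algebra.TensorProduct.tmul_pow, TensorProduct.tmul_smul]

theorem dp_tmul' (x y : UGen) (n : ℕ) : dp (x ⊗ₜ[QV] y) n = dp x n ⊗ₜ (y ^ n) := by
  rw [dp, dp, Algebra.TensorProduct.tmul_pow, TensorProduct.smul_tmul']

/-- The summands E ⊗ 1 and K ⊗ E of ΔE commute up to v², so the q-binomial theorem applies. The
coefficients that come out are integral. -/
theorem comul_dp_gE (n : ℕ) : Uq.comul qv_ne_zero (dp gE n) =
    ∑ p ∈ Finset.HasAntidiagonal.antidiagonal n, (qv ^ (p.1 * p.2) • (dp gE p.1 * gK ^ p.2)) ⊗ₜ[QV] dp gE p.2 := by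
  rw [map_dp, comul_gen, comulGen, dp_add]
  · refine Finset.sum_congr rfl fun p _ => ?_
    rw [dp_tmul_one, dp_tmul, Algebra.TensorProduct.tmul_mul_tmul, one_mul, TensorProduct.smul_tmul']
  · rw [Algebra.TensorProduct.tmul_mul_tmul, Algebra.TensorProduct.tmul_mul_tmul, one_mul, mul_one,
      K_mul_E, TensorProduct.smul_tmul']

/-- Here the q-binomial theorem needs 1 ⊗ F as its first variable and F ⊗ K⁻¹ as its second, hence
the reversed roles of the two indices. -/
theorem comul_dp_gF (n : ℕ) : Uq.comul qv_ne_zero (dp gF n) =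
    ∑ p ∈ Finset.HasAntidiagonal.antidiagonal n, dp gF p.2 ⊗ₜ[QV] (qv ^ (p.1 * p.2) • (dp gF p.1 * gKi ^ p.2)) := by
  rw [map_dp, comul_gen, comulGen, add_comm, dp_add]
  · refine Finset.sum_congr rfl fun p _ => ?_
    rw [dp_tmul, dp_tmul', one_pow, Algebra.TensorProduct.tmul_mul_tmul, one_mul,
      TensorProduct.tmul_smul]
  · rw [Algebra.TensorProduct.tmul_mul_tmul, Algebra.TensorProduct.tmul_mul_tmul, one_mul, mul_one,
      Kinv_mul_F qv_ne_zero, TensorProduct.tmul_smul]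

theorem counit_dp_gE (n : ℕ) : Uq.counit (dp gE n) = if n = 0 then 1 else (0 : QV) := by
  rw [map_dp, counit_gen, counitGen]
  cases n with
  | zero => simp [dp_zero]
  | succ n => simp [dp]

theorem counit_dp_gF (n : ℕ) : Uq.counit (dp gF n) = if n = 0 then 1 else (0 : QV) := by
  rw [map_dp, counit_gen, counitGen]
  cases n with
  | zero => simp [dp_zero]
  | succ n => simp [dp]

/-- Sorting the n factors moves x past y in n(n-1)/2 places at the cost c² each. It gives the powers
of S(E) and S(F). -/
theorem mul_pow_of_mul {B : Type*} [Ring B] [Algebra QV B] {x y : B} {c : QV}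
    (h : x * y = c ^ 2 • (y * x)) (n : ℕ) :
    (y * x) ^ n = c ^ (n * (n - 1)) • (y ^ n * x ^ n) := by
  have h2 : ∀ n, x * y ^ n = (c ^ 2) ^ n • (y ^ n * x) := by
    intro n
    induction n with
    | zero => simp
    | succ n ih =>
      rw [pow_succ, ← mul_assoc, ih, smul_mul_assoc, mul_assoc, h, mul_smul_comm, smul_smul,
        mul_assoc, pow_succ (c ^ 2)]
  induction n with
  | zero => simp
  | succ n ih =>
    rw [pow_succ', ih, mul_smul_comm, mul_assoc, ← mul_assoc x, h2, smul_mul_assoc, mul_smul_comm,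
      smul_smul, ← mul_assoc, ← mul_assoc, ← pow_succ', mul_assoc, ← pow_succ']
    congr 1
    rw [← pow_mul, ← pow_add]
    congr 1
    cases n with
    | zero => rfl
    | succ n => simp only [Nat.add_sub_cancel]; ring

theorem antipode_dp_gE (n : ℕ) : Uq.antipode qv_ne_zero (dp gE n) =
    MulOpposite.op (((-1) ^ n * qv ^ (n * (n - 1))) • (gKi ^ n * dp gE n)) := by
  have h : gE * gKi = qv ^ 2 • (gKi * gE) := by
    rw [Kinv_mul_E qv_ne_zero, smul_smul, mul_inv_cancel₀ (pow_ne_zero 2 qv_ne_zero), one_smul]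
  rw [map_dp, antipode_gen, antipodeGen, dp, ← MulOpposite.op_pow, neg_pow, mul_pow_of_mul h, dp,
    ← MulOpposite.op_smul]
  congr 1
  rw [show (-1 : UGen) ^ n = algebraMap QV UGen ((-1) ^ n) by simp, ← Algebra.smul_def, smul_smul,
    smul_smul, mul_smul_comm, smul_smul]
  congr 1
  ring

theorem antipode_dp_gF (n : ℕ) : Uq.antipode qv_ne_zero (dp gF n) =
    MulOpposite.op (((-1) ^ n * (qv⁻¹) ^ (n * (n - 1))) • (dp gF n * gK ^ n)) := by
  have h : gK * gF = (qv⁻¹) ^ 2 • (gF * gK) := by rw [K_mul_F, inv_pow]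
  rw [map_dp, antipode_gen, antipodeGen, dp, ← MulOpposite.op_pow, neg_pow, mul_pow_of_mul h, dp,
    ← MulOpposite.op_smul]
  congr 1
  rw [show (-1 : UGen) ^ n = algebraMap QV UGen ((-1) ^ n) by simp, ← Algebra.smul_def, smul_smul,
    smul_smul, smul_mul_assoc, smul_smul]
  congr 1
  ring

end Coproduct

/-! ### The antipode axioms for the generic algebra -/

section AntipodeLaw

variable {k H : Type*} [Field k] [Ring H] [Algebra k H] (Δ : H →ₐ[k] H ⊗[k] H) (ε : H →ₐ[k] k)
  (S : H →ₗ[k] H)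

/-- For an antimultiplicative S, the inner factors ∑ S(a₁) a₂ collapse to a scalar, which is
central. Hence the axiom passes to products and may be checked on generators. -/
theorem antipode_left_mul (hS : ∀ a b, S (a * b) = S b * S a) {a b : H}
    (ha : LinearMap.mul' k H (S.rTensor H (Δ a)) = algebraMap k H (ε a))
    (hb : LinearMap.mul' k H (S.rTensor H (Δ b)) = algebraMap k H (ε b)) :
    LinearMap.mul' k H (S.rTensor H (Δ (a * b))) = algebraMap k H (ε (a * b)) := by
  have key : ∀ s t : H ⊗[k] H, ∀ c : k, LinearMap.mul' k H (S.rTensor H s) = algebraMap k H c →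
      LinearMap.mul' k H (S.rTensor H (s * t)) =
        algebraMap k H c * LinearMap.mul' k H (S.rTensor H t) := by
    intro s t c hs
    induction t with
    | zero => simp
    | add x y hx hy => rw [mul_add, map_add, map_add, hx, hy, map_add, map_add, mul_add]
    | tmul x y =>
      have : LinearMap.mul' k H (S.rTensor H (s * x ⊗ₜ[k] y)) =
          S x * LinearMap.mul' k H (S.rTensor H s) * y := by
        clear hs
        induction s with
        | zero => simp
        | add p q hp hq => rw [add_mul, map_add, map_add, hp, hq, map_add, map_add, mul_add, add_mul]
        | tmul p q => simp [hS, mul_assoc]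
      rw [this, hs, ← Algebra.commutes, mul_assoc]
      simp
  rw [map_mul, key _ _ _ ha, hb, map_mul, map_mul]

theorem antipode_right_mul (hS : ∀ a b, S (a * b) = S b * S a) {a b : H}
    (ha : LinearMap.mul' k H (S.lTensor H (Δ a)) = algebraMap k H (ε a))
    (hb : LinearMap.mul' k H (S.lTensor H (Δ b)) = algebraMap k H (ε b)) :
    LinearMap.mul' k H (S.lTensor H (Δ (a * b))) = algebraMap k H (ε (a * b)) := by
  have key : ∀ s t : H ⊗[k] H, ∀ c : k, LinearMap.mul' k H (S.lTensor H t) = algebraMap k H c →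
      LinearMap.mul' k H (S.lTensor H (s * t)) =
        LinearMap.mul' k H (S.lTensor H s) * algebraMap k H c := by
    intro s t c ht
    induction s with
    | zero => simp
    | add x y hx hy => rw [add_mul, map_add, map_add, hx, hy, map_add, map_add, add_mul]
    | tmul x y =>
      have : LinearMap.mul' k H (S.lTensor H (x ⊗ₜ[k] y * t)) =
          x * LinearMap.mul' k H (S.lTensor H t) * S y := by
        clear ht
        induction t with
        | zero => simp
        | add p q hp hq => rw [mul_add, map_add, map_add, hp, hq, map_add, map_add, mul_add, add_mul]
        | tmul p q => simp [hS, mul_assoc]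
      rw [this, ht, mul_assoc, Algebra.commutes, ← mul_assoc]
      simp
  rw [map_mul, key _ _ _ hb, ha, map_mul, map_mul]

/-- The antipode of the generic algebra as a linear map. -/
def genAntipode : UGen →ₗ[QV] UGen :=
  (MulOpposite.opLinearEquiv QV).symm.toLinearMap ∘ₗ (Uq.antipode qv_ne_zero).toLinearMap

theorem genAntipode_mul (a b : UGen) : genAntipode (a * b) = genAntipode b * genAntipode a := by
  simp [genAntipode]

theorem genAntipode_gen (g : Gen) : genAntipode (Uq.gen QV qv g) = (Uq.antipodeGen g).unop := by
  simp [genAntipode, antipode_gen]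

theorem genAntipode_algebraMap (c : QV) : genAntipode (algebraMap QV UGen c) = algebraMap QV UGen c := by
  simp [genAntipode]

theorem gen_antipode_left (x : UGen) :
    LinearMap.mul' QV UGen (genAntipode.rTensor UGen (Uq.comul qv_ne_zero x)) =
      algebraMap QV UGen (Uq.counit x) := by
  have h1 : genAntipode (1 : UGen) = 1 := by simpa using genAntipode_algebraMap 1
  induction x using ugen_induction with
  | hm x y hx hy => exact antipode_left_mul _ _ _ genAntipode_mul hx hy
  | hg g =>
    rw [comul_gen, counit_gen]
    cases g <;> simp [Uq.comulGen, Uq.counitGen, genAntipode_gen, Uq.antipodeGen, h1,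
      Uq.Kinv_mul_K, Uq.K_mul_Kinv, mul_assoc]
  | hc c =>
    rw [AlgHom.commutes, AlgHom.commutes, Algebra.TensorProduct.algebraMap_apply]
    simp [genAntipode_algebraMap]
  | ha x y hx hy => simp only [map_add, hx, hy]

theorem gen_antipode_right (x : UGen) :
    LinearMap.mul' QV UGen (genAntipode.lTensor UGen (Uq.comul qv_ne_zero x)) =
      algebraMap QV UGen (Uq.counit x) := by
  have h1 : genAntipode (1 : UGen) = 1 := by simpa using genAntipode_algebraMap 1
  induction x using ugen_induction with
  | hm x y hx hy => exact antipode_right_mul _ _ _ genAntipode_mul hx hy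
  | hg g =>
    rw [comul_gen, counit_gen]
    cases g <;> simp [Uq.comulGen, Uq.counitGen, genAntipode_gen, Uq.antipodeGen, h1,
      Uq.Kinv_mul_K, Uq.K_mul_Kinv, ← mul_assoc]
  | hc c =>
    rw [AlgHom.commutes, AlgHom.commutes, Algebra.TensorProduct.algebraMap_apply]
    simp [h1]
  | ha x y hx hy => simp only [map_add, hx, hy]

end AntipodeLaw

/-! ### The commutation formula for divided powers -/

section Cartan

open LaurentPolynomial

/-- The unit `K` of the generic algebra. -/
def unitK : UGenˣ := ⟨gK, gKi, Uq.K_mul_Kinv, Uq.Kinv_mul_K⟩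

/-- The map `ℚ(v)[T, T⁻¹] → U_q`, `T ↦ K`. -/
def cartan : LaurentPolynomial QV →ₐ[QV] UGen :=
  AddMonoidAlgebra.lift QV UGen ℤ ((Units.coeHom UGen).comp (zpowersHom _ unitK))

theorem cartan_T (n : ℤ) : cartan (T n) = ((unitK ^ n : UGenˣ) : UGen) := by
  rw [cartan, T, AddMonoidAlgebra.lift_single, one_smul]; rfl

@[simp] theorem cartan_T_one : cartan (T 1) = gK := by rw [cartan_T, zpow_one]; rfl

@[simp] theorem cartan_T_neg_one : cartan (T (-1)) = gKi := by rw [cartan_T, zpow_neg_one]; rfl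

/-- The element `[K; c] = (v^c K - v^{-c} K⁻¹) / (v - v⁻¹)`. -/
def kBr (c : ℤ) : LaurentPolynomial QV :=
  (qs vQ 1)⁻¹ • (qv ^ c • T 1 - qv ^ (-c) • T (-1))

/-- The element `[K; c; t] = [K; c] [K; c - 1] ⋯ [K; c - t + 1] / [t]!`. -/
def kBin (c : ℤ) : ℕ → LaurentPolynomial QV
  | 0 => 1
  | t + 1 => (qInt (t + 1))⁻¹ • (kBin c t * kBr (c - t))

theorem qInt_smul_kBin_succ (c : ℤ) (t : ℕ) :
    qInt (t + 1) • kBin c (t + 1) = kBin c t * kBr (c - t) := by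
  rw [kBin, smul_smul, mul_inv_cancel₀ (qInt_ne_zero (Nat.succ_ne_zero t)), one_smul]

/-- The product defining [K;c+1;t+1] is peeled at its first factor instead of its last. Comparing
both ends yields Pascal's rule. -/
theorem qInt_smul_kBin_add_one (c : ℤ) (t : ℕ) :
    qInt (t + 1) • kBin (c + 1) (t + 1) = kBr (c + 1) * kBin c t := by
  induction t with
  | zero => rw [qInt_smul_kBin_succ]; simp [kBin]
  | succ t ih =>
    have h := qInt_ne_zero (Nat.succ_ne_zero t)
    rw [qInt_smul_kBin_succ, ← smul_right_inj h, ← smul_mul_assoc, ih, mul_assoc,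
      ← mul_smul_comm, qInt_smul_kBin_succ]
    congr 3
    push_cast; ring

theorem qInt_add_smul_kBr (i t : ℕ) (y : ℤ) :
    qInt (i + t) • kBr y = qInt i • kBr (y - t) + qInt t • kBr (y + i) := by
  have hv := qv_ne_zero
  have h1 : qs vQ 1 ≠ 0 := qs_vQ_ne_zero one_ne_zero
  simp only [kBr, qInt_eq, smul_sub, smul_smul]
  rw [sub_add_sub_comm, ← add_smul, ← add_smul]
  congr 2
  · field_simp
    simp only [qs, val_vQ, sub_mul, ← zpow_add₀ hv]
    push_cast; ring_nf
  · field_simp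
    simp only [qs, val_vQ, sub_mul, ← zpow_add₀ hv]
    push_cast; ring_nf

/-- The Pascal rule in the form `qVandermonde` asks for. The elements live in commutative Laurent
polynomials so that the general convolution applies before mapping T to K. -/
theorem kBin_add_one (c : ℤ) (t : ℕ) : kBin (c + 1) (t + 1) =
    qv ^ ((t : ℤ) + 1) • kBin c (t + 1) + qv ^ ((t : ℤ) - c) • (T (-1) * kBin c t) := by
  have hv := qv_ne_zero
  have h1 : qs vQ 1 ≠ 0 := qs_vQ_ne_zero one_ne_zero
  have h := qInt_ne_zero (Nat.succ_ne_zero t)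
  have key : kBr (c + 1) = qv ^ ((t : ℤ) + 1) • kBr (c - t) +
      (qInt (t + 1) * qv ^ ((t : ℤ) - c)) • T (-1) := by
    simp only [kBr, qInt_eq, smul_sub, smul_smul]
    rw [sub_add, ← sub_smul]
    congr 2
    · field_simp
      simp only [← zpow_add₀ hv]
      ring_nf
    · field_simp
      simp only [qs, val_vQ, sub_mul, ← zpow_add₀ hv]
      push_cast; ring_nf
  rw [← smul_right_inj h, qInt_smul_kBin_add_one, key, smul_add, smul_comm (qInt _),
    qInt_smul_kBin_succ, add_mul, smul_mul_assoc, smul_mul_assoc, smul_smul, mul_comm (kBr _)]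

theorem kBin_add (c : ℤ) (n t : ℕ) : kBin (c + n) t = ∑ j ∈ Finset.range (t + 1),
    (qv ^ ((n : ℤ) * ((t : ℤ) - j) - c * j) * qbin vQ n j) • (T (-(j : ℤ)) * kBin c (t - j)) := by
  let C : QV →+* LaurentPolynomial QV := algebraMap QV (LaurentPolynomial QV)
  let u : (LaurentPolynomial QV)ˣ := Units.map C.toMonoidHom vQ
  let K : (LaurentPolynomial QV)ˣ := (isUnit_T 1).unit
  have hu : ∀ n : ℤ, ((u ^ n : (LaurentPolynomial QV)ˣ) : LaurentPolynomial QV) = C (qv ^ n) := by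
    intro n
    rw [← val_vQ, ← Units.val_zpow_eq_zpow_val, ← map_zpow]; rfl
  have hK : ∀ j : ℕ, (((K⁻¹) ^ j : (LaurentPolynomial QV)ˣ) : LaurentPolynomial QV) = T (-(j : ℤ)) := by
    intro j
    rw [inv_pow]
    refine Units.inv_eq_of_mul_eq_one_right ?_
    rw [Units.val_pow_eq_pow_val]
    change T 1 ^ j * _ = _
    rw [T_pow, mul_one, ← T_add, add_neg_cancel, T_zero]
  have h := qVandermonde u K kBin (fun c => rfl) (fun c t => ?_) c n t
  · rw [h]
    refine Finset.sum_congr rfl fun j _ => ?_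
    have hq : qbin u n j = C (qbin vQ n j) := (map_qbin vQ C n j).symm
    rw [Units.val_mul, hu, hK, hq, Algebra.smul_def, map_mul]
    change _ = C _ * C _ * _
    ring
  · have := hK 1
    rw [pow_one, Nat.cast_one] at this
    rw [kBin_add_one, Units.val_mul, hu, hu, this, Algebra.smul_def, Algebra.smul_def, mul_assoc]

theorem cartan_kBr (c : ℤ) : cartan (kBr c) = (qs vQ 1)⁻¹ • (qv ^ c • gK - qv ^ (-c) • gKi) := by
  simp only [kBr, map_smul, map_sub, cartan_T_one, cartan_T_neg_one]

theorem cartan_kBr_mul_gF (c : ℤ) : cartan (kBr c) * gF = gF * cartan (kBr (c - 2)) := by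
  have hv := qv_ne_zero
  rw [cartan_kBr, cartan_kBr, smul_mul_assoc, sub_mul, smul_mul_assoc, smul_mul_assoc, Uq.K_mul_F,
    Uq.Kinv_mul_F hv, mul_smul_comm, mul_sub, mul_smul_comm, mul_smul_comm, smul_smul, smul_smul]
  congr 3
  · rw [zpow_sub₀ hv]; rfl
  · rw [show -(c - 2) = -c + 2 by ring, zpow_add₀ hv]; rfl

theorem gE_mul_cartan_kBr (c : ℤ) : gE * cartan (kBr c) = cartan (kBr (c - 2)) * gE := by
  have hv := qv_ne_zero
  rw [cartan_kBr, cartan_kBr, smul_mul_assoc, sub_mul, smul_mul_assoc, smul_mul_assoc, Uq.K_mul_E,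
    Uq.Kinv_mul_E hv, mul_smul_comm, mul_sub, mul_smul_comm, mul_smul_comm, smul_smul, smul_smul]
  congr 3
  · rw [zpow_sub₀ hv]; exact (div_mul_cancel₀ _ (zpow_ne_zero 2 hv)).symm
  · rw [show -(c - 2) = -c + 2 by ring, zpow_add₀ hv]
    exact (mul_inv_cancel_right₀ (zpow_ne_zero 2 hv) _).symm

theorem cartan_kBin_mul_gF (c : ℤ) (t : ℕ) :
    cartan (kBin c t) * gF = gF * cartan (kBin (c - 2) t) := by
  induction t with
  | zero => simp [kBin]
  | succ t ih =>
    rw [kBin, kBin, map_smul, map_smul, map_mul, map_mul, smul_mul_assoc, mul_assoc,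
      cartan_kBr_mul_gF, ← mul_assoc, ih, mul_assoc, mul_smul_comm]
    congr 5
    ring

theorem gE_mul_gF : gE * gF = gF * gE + cartan (kBr 0) := by
  rw [cartan_kBr, ← sub_eq_iff_eq_add', Uq.E_mul_F]
  simp [qs]

/-- Moving F past one more E adds [K;0] to [n+1][K;-n-2], and `qInt_add_smul_kBr` merges these into
[n+2][K;-n-1]. -/
theorem dp_gE_mul_gF (n : ℕ) :
    dp gE (n + 1) * gF = gF * dp gE (n + 1) + cartan (kBr (-n)) * dp gE n := by
  induction n with
  | zero =>
    have : dp gE 1 = gE := divPow_one gE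
    simp [dp_zero, this, gE_mul_gF]
  | succ n ih =>
    have h := qInt_ne_zero (Nat.succ_ne_zero (n + 1))
    rw [← smul_right_inj h, ← smul_mul_assoc, ← mul_dp, mul_assoc, ih, mul_add, ← mul_assoc,
      ← mul_assoc, gE_mul_gF, gE_mul_cartan_kBr, mul_assoc (cartan _), mul_dp, add_mul, mul_assoc,
      mul_dp, smul_add, mul_smul_comm, mul_smul_comm, add_assoc,
      ← smul_mul_assoc (qInt (n + 1)), ← add_mul, ← smul_mul_assoc _ (cartan _)]
    congr 2
    have key := qInt_add_smul_kBr (n + 1) 1 (-(n + 1 : ℕ))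
    have h1 : qInt 1 = 1 := by rw [qInt_eq]; exact div_self (qs_vQ_ne_zero one_ne_zero)
    rw [h1, one_smul, neg_add_cancel] at key
    rw [← map_smul, ← map_smul, ← map_add, key, add_comm]
    congr 4
    push_cast; ring

theorem dp_mul_self {B : Type*} [Ring B] [Algebra QV B] (x : B) (n : ℕ) :
    dp x n * x = qInt (n + 1) • dp x (n + 1) := by
  rw [← mul_dp, dp, smul_mul_assoc, mul_smul_comm, ← pow_succ, ← pow_succ']

/-- The commutation formula for divided powers of `E` and `F`. -/
theorem dp_gE_mul_dp_gF (b c : ℕ) : dp gE (b + c) * dp gF b =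
    ∑ p ∈ Finset.HasAntidiagonal.antidiagonal b,
      dp gF p.1 * cartan (kBin (-2 * p.1 - c) p.2) * dp gE (p.1 + c) := by
  induction b generalizing c with
  | zero => simp [dp_zero, kBin]
  | succ b ih =>
    have hb := qInt_ne_zero (Nat.succ_ne_zero b)
    -- One factor F is split off on the right. The power of E is unchanged, so the hypothesis is
    -- used with c + 1 in place of c, which is why c is general in the induction.
    rw [← smul_right_inj hb, ← mul_smul_comm, ← dp_mul_self, ← mul_assoc,
      show b + 1 + c = b + (c + 1) by ring, ih, Finset.sum_mul]
    trans ∑ p ∈ Finset.HasAntidiagonal.antidiagonal (b + 1),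
      dp gF p.1 * cartan (qInt (p.1 + p.2) • kBin (-2 * p.1 - c) p.2) * dp gE (p.1 + c)
    -- The first share comes from moving F to the left into the power of F. The second is entered as
    -- the remainder of the target coefficient; `key` identifies it with the contribution of the
    -- Cartan term of `dp_gE_mul_gF`.
    · rw [← sum_antidiagonal_shift
        (fun i t => dp gF i * cartan (qInt (i + t) • kBin (-2 * i - c) t) * dp gE (i + c))
        (fun i t => dp gF i * cartan (qInt i • kBin (-2 * i - c - 1) t) * dp gE (i + c))
        (fun i t => dp gF i * cartan (qInt t • kBin (-2 * i - c) t -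
          (qInt i • kBin (-2 * i - c - 1) t - (qInt (i + t) - qInt t) • kBin (-2 * i - c) t)) *
            dp gE (i + c))
        (fun i t => ?_) (fun t => by simp [qInt_zero]) (fun i => by simp [qInt_zero, kBin])]
      · refine Finset.sum_congr rfl fun p _ => ?_
        obtain ⟨i, t⟩ := p
        simp only
        have key : qInt (t + 1) • kBin (-2 * i - c) (t + 1) -
            (qInt i • kBin (-2 * i - c - 1) (t + 1) -
              (qInt (i + (t + 1)) - qInt (t + 1)) • kBin (-2 * i - c) (t + 1)) =
            kBin (-2 * i - c - 1) t * kBr (-(i + c : ℕ)) := by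
          have ht := qInt_ne_zero (Nat.succ_ne_zero t)
          rw [← smul_right_inj ht]
          have e1 := qInt_smul_kBin_add_one (-2 * i - c - 1) t
          have e2 := qInt_smul_kBin_succ (-2 * i - c - 1) t
          have e3 := qInt_add_smul_kBr i (t + 1) (-2 * i - c)
          rw [sub_add_cancel] at e1
          have e4 : kBr (-2 * (i : ℤ) - c - ((t + 1 : ℕ) : ℤ)) = kBr (-2 * i - c - 1 - t) := by
            congr 1; push_cast; ring
          have e5 : kBr (-2 * (i : ℤ) - c + i) = kBr (-(i + c : ℕ)) := by
            congr 1; push_cast; ring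
          rw [e4, e5] at e3
          simp only [Algebra.smul_def, map_sub] at e1 e2 e3 ⊢
          linear_combination (algebraMap QV (LaurentPolynomial QV)) (qInt (i + (t + 1))) * e1 -
            (algebraMap QV (LaurentPolynomial QV)) (qInt i) * e2 +
            kBin (-2 * i - c - 1) t * e3
        rw [key, mul_assoc, show i + (c + 1) = i + c + 1 by ring, dp_gE_mul_gF, mul_add,
          ← mul_assoc, mul_assoc (dp gF i), cartan_kBin_mul_gF, ← mul_assoc, dp_mul_self,
          map_mul, map_smul, show i + 1 + c = i + c + 1 by ring, mul_smul_comm, smul_mul_assoc]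
        have e6 : kBin (-2 * (i : ℤ) - ((c + 1 : ℕ) : ℤ) - 2) t =
            kBin (-2 * ((i + 1 : ℕ) : ℤ) - c - 1) t := by congr 1; push_cast; ring
        have e7 : kBin (-2 * (i : ℤ) - ((c + 1 : ℕ) : ℤ)) t = kBin (-2 * i - c - 1) t := by
          congr 1; push_cast; ring
        rw [e6, e7]
        simp only [mul_assoc, smul_mul_assoc]
      · rw [← add_mul, ← mul_add, ← map_add]
        congr 3
        rw [sub_smul]; abel
    · rw [Finset.smul_sum]
      refine Finset.sum_congr rfl fun p hp => ?_
      rw [Finset.HasAntidiagonal.mem_antidiagonal.mp hp, map_smul, mul_smul_comm, smul_mul_assoc]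

end Cartan

/-! ### Tensor squares of the integral form -/

section Flat

theorem uInt_smul_eq_zero {c : ZV} (hc : c ≠ 0) {x : UInt} (h : c • x = 0) : x = 0 := by
  have h1 := congrArg (Subtype.val) h
  have h2 : algebraMap ZV QV c • (x : UGen) = 0 := by
    rw [algebraMap_smul]; exact h1
  have h3 : algebraMap ZV QV c ≠ 0 := fun h4 => hc (algebraMap_injective (h4.trans (map_zero _).symm))
  exact Subtype.ext ((smul_eq_zero.mp h2).resolve_left h3)

variable {k : Type*} [Field k] {ζ : kˣ} {ℓ : ℕ}

/-- A root of unity is integral over ℤ, and ℤ is integrally closed, so the minimal polynomial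
divides every integral polynomial vanishing at ζ. Powers of v are units and do not matter. -/
theorem exists_specHom_ker_generator [CharZero k] (hℓ : 0 < ℓ) (hζ : IsPrimitiveRoot ζ ℓ) :
    ∃ φ : ZV, specHom k ζ φ = 0 ∧ ∀ f, specHom k ζ f = 0 → φ ∣ f := by
  have hint : IsIntegral ℤ (ζ : k) := by
    refine IsIntegral.of_pow hℓ ?_
    rw [← Units.val_pow_eq_pow_val, hζ.pow_eq_one]
    exact isIntegral_one
  have hspec : ∀ p : Polynomial ℤ, specHom k ζ (Polynomial.toLaurent p) =
      Polynomial.aeval (ζ : k) p := fun p => LaurentPolynomial.eval₂_toLaurent _ _ _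
  refine ⟨Polynomial.toLaurent (minpoly ℤ (ζ : k)), by rw [hspec, minpoly.aeval], fun f hf => ?_⟩
  obtain ⟨n, p, hp⟩ := LaurentPolynomial.exists_T_pow f
  have h1 : Polynomial.aeval (ζ : k) p = 0 := by rw [← hspec, hp, map_mul, hf, zero_mul]
  obtain ⟨q, hq⟩ := minpoly.isIntegrallyClosed_dvd hint h1
  have h2 : Polynomial.toLaurent (minpoly ℤ (ζ : k)) ∣ f * LaurentPolynomial.T n :=
    ⟨Polynomial.toLaurent q, by rw [← hp, hq, map_mul]⟩
  exact ((LaurentPolynomial.isUnit_T n).dvd_mul_right).mp h2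

instance : IsNoetherianRing ZV :=
  IsLocalization.isNoetherianRing (Submonoid.powers (Polynomial.X : Polynomial ℤ)) ZV inferInstance

/-- A relation whose coefficients all vanish at ζ can be divided by the generator φ of the kernel,
because the integral form has no torsion. This stops, since φ divides a nonzero coefficient only
finitely often. -/
theorem exists_reduced_relation [CharZero k] (hℓ : 0 < ℓ) (hζ : IsPrimitiveRoot ζ ℓ) {ι : Type*}
    (s : Finset ι) (a : ι → UInt) (c : ι → ZV) (h : ∑ i ∈ s, c i • a i = 0)
    (h0 : ∃ i ∈ s, c i ≠ 0) :
    ∃ c' : ι → ZV, ∑ i ∈ s, c' i • a i = 0 ∧ ∃ i ∈ s, specHom k ζ (c' i) ≠ 0 := by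
  obtain ⟨φ, hφ, hdvd⟩ := exists_specHom_ker_generator (k := k) hℓ hζ
  obtain ⟨i₀, hi₀, hc₀⟩ := h0
  have hunit : ¬ IsUnit φ := fun hu => by
    have := hu.map (specHom k ζ)
    rw [hφ] at this
    exact not_isUnit_zero this
  -- The finite multiplicity of φ rests on ℤ[v, v⁻¹] being Noetherian; it bounds the number of
  -- divisions.
  obtain ⟨N, hN⟩ := FiniteMultiplicity.of_not_isUnit hunit hc₀
  have key : ∀ (N : ℕ) (c : ι → ZV), ∑ i ∈ s, c i • a i = 0 → ¬ φ ^ N ∣ c i₀ →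
      ∃ c' : ι → ZV, ∑ i ∈ s, c' i • a i = 0 ∧ ∃ i ∈ s, specHom k ζ (c' i) ≠ 0 := by
    intro N
    induction N with
    | zero => intro c _ h; exact absurd (by simp) h
    | succ N ih =>
      intro c hc hN
      by_cases hall : ∃ i ∈ s, specHom k ζ (c i) ≠ 0
      · exact ⟨c, hc, hall⟩
      push Not at hall
      have hφ0 : φ ≠ 0 := by
        rintro rfl
        have := zero_dvd_iff.mp (hdvd _ (hall i₀ hi₀))
        exact hN (by simp [this])
      have : ∀ i, ∃ d, i ∈ s → c i = φ * d := fun i => by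
        by_cases hi : i ∈ s
        · obtain ⟨d, hd⟩ := hdvd _ (hall i hi)
          exact ⟨d, fun _ => hd⟩
        · exact ⟨0, fun h => absurd h hi⟩
      choose d hd using this
      refine ih d (uInt_smul_eq_zero hφ0 ?_) ?_
      · rw [← hc, Finset.smul_sum]
        exact Finset.sum_congr rfl fun i hi => by rw [hd i hi, mul_smul]
      · rintro ⟨e, he⟩
        exact hN ⟨e, by rw [hd _ hi₀, he, pow_succ', mul_assoc]⟩
  exact key (N + 1) c h hN

/-- A tensor over the integral form that vanishes generically also vanishes in `U_ζ ⊗ U_ζ`. -/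
theorem sum_sp_tmul_sp_eq_zero [CharZero k] (hℓ : 0 < ℓ) (hζ : IsPrimitiveRoot ζ ℓ) {ι : Type*}
    (s : Finset ι) (a b : ι → UInt) (h : ∑ i ∈ s, (a i : UGen) ⊗ₜ[QV] (b i : UGen) = 0) :
    ∑ i ∈ s, UZeta.sp k ζ ℓ (a i) ⊗ₜ[k] UZeta.sp k ζ ℓ (b i) = 0 := by
  classical
  induction hn : s.card generalizing s b with
  | zero => rw [Finset.card_eq_zero.mp hn]; rfl
  | succ n ih =>
    -- If the left factors are independent over ℚ(v), every right factor is zero. Otherwise a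
    -- relation between them, with denominators cleared and reduced, has a coefficient nonzero at ζ,
    -- and the corresponding term can be eliminated.
    by_cases hli : LinearIndependent QV fun i : s => (a i : UGen)
    · have h' : ∑ i : s, (a i : UGen) ⊗ₜ[QV] (b i : UGen) = 0 := by
        rw [← h]; exact Finset.sum_coe_sort s fun i => (a i : UGen) ⊗ₜ[QV] (b i : UGen)
      have hv := TensorProduct.vanishesTrivially_of_sum_tmul_eq_zero_of_rTensor_injective QV
        (Module.Flat.rTensor_preserves_injective_linearMap _ (Submodule.injective_subtype _)) h'
      obtain ⟨κ, u, y, h1, h2⟩ := hv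
      refine Finset.sum_eq_zero fun i hi => ?_
      have hb : (b i : UGen) = 0 := by
        refine (h1 ⟨i, hi⟩).trans ?_
        refine Finset.sum_eq_zero fun j _ => ?_
        rw [Fintype.linearIndependent_iff.mp hli _ (h2 j) ⟨i, hi⟩, zero_smul]
      rw [show b i = 0 from Subtype.ext hb, map_zero, TensorProduct.tmul_zero]
    · obtain ⟨g, hg, ⟨i₁, hi₁⟩, hne⟩ := Fintype.not_linearIndependent_iff.mp hli
      obtain ⟨m, hm⟩ := IsLocalization.exist_integer_multiples_of_finite (nonZeroDivisors ZV) g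
      choose c₀ hc₀ using hm
      have hm0 : algebraMap ZV QV m ≠ 0 := by
        intro h4
        exact nonZeroDivisors.ne_zero m.2 (algebraMap_injective (h4.trans (map_zero _).symm))
      let c : ι → ZV := fun i => if hi : i ∈ s then c₀ ⟨i, hi⟩ else 0
      have hrel : ∑ i ∈ s, c i • a i = 0 := by
        apply Subtype.ext
        rw [AddSubmonoidClass.coe_finsetSum, ZeroMemClass.coe_zero,
          ← smul_zero (algebraMap ZV QV m), ← hg, Finset.smul_sum, ← Finset.sum_coe_sort s]
        refine Finset.sum_congr rfl fun i _ => ?_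
        have : algebraMap ZV QV (c i) = algebraMap ZV QV m * g i := by
          simp only [c, i.2, dif_pos]
          rw [hc₀, ← Algebra.smul_def]
        rw [smul_smul, ← this, algebraMap_smul]; rfl
      obtain ⟨c', hc', i₀, hi₀, hspec⟩ := exists_reduced_relation (k := k) hℓ hζ s a c hrel
        ⟨i₁, hi₁, fun h4 => by
          have := hc₀ ⟨i₁, hi₁⟩
          simp only [c, hi₁, dif_pos] at h4
          rw [h4, map_zero] at this
          have h5 : algebraMap ZV QV m * g ⟨i₁, hi₁⟩ = 0 := by
            rw [← Algebra.smul_def]; exact this.symm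
          exact (mul_ne_zero hm0 hne) h5⟩
      have e1 : c' i₀ • a i₀ = -∑ i ∈ s.erase i₀, c' i • a i := by
        rw [← Finset.add_sum_erase s _ hi₀] at hc'
        exact eq_neg_of_add_eq_zero_left hc'
      -- Multiplying the tensor by c'_{i₀} and substituting the relation for a_{i₀} leaves a shorter
      -- vanishing tensor with integral entries. The same substitution in U_ζ gives `hfin`, where
      -- the factor c'_{i₀}(ζ) can be cancelled.
      have hgen : ∑ i ∈ s.erase i₀,
          (a i : UGen) ⊗ₜ[QV] ((c' i₀ • b i - c' i • b i₀ : UInt) : UGen) = 0 := by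
        have e2 := congrArg (Subtype.val) e1
        rw [← smul_zero (algebraMap ZV QV (c' i₀)), ← h, ← Finset.add_sum_erase s _ hi₀, smul_add,
          TensorProduct.smul_tmul', algebraMap_smul, show c' i₀ • (a i₀ : UGen) = _ from e2,
          NegMemClass.coe_neg, AddSubmonoidClass.coe_finsetSum, TensorProduct.neg_tmul,
          TensorProduct.sum_tmul, Finset.smul_sum, neg_add_eq_sub, ← Finset.sum_sub_distrib]
        refine Finset.sum_congr rfl fun i _ => ?_
        rw [AddSubgroupClass.coe_sub, TensorProduct.tmul_sub, ← TensorProduct.tmul_smul,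
          algebraMap_smul]
        congr 1
        change _ ⊗ₜ (c' i • (b i₀ : UGen)) = (c' i • (a i : UGen)) ⊗ₜ _
        rw [← algebraMap_smul QV (c' i) (b i₀ : UGen), ← algebraMap_smul QV (c' i) (a i : UGen),
          TensorProduct.smul_tmul]
      have hsp := ih (s.erase i₀) (fun i => c' i₀ • b i - c' i • b i₀) hgen
        (by rw [Finset.card_erase_of_mem hi₀, hn]; rfl)
      have e3 := congrArg (UZeta.sp k ζ ℓ) e1
      rw [map_neg, map_sum, UZeta.sp_smul] at e3
      simp only [UZeta.sp_smul] at e3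
      have hfin : specHom k ζ (c' i₀) • ∑ i ∈ s, UZeta.sp k ζ ℓ (a i) ⊗ₜ[k] UZeta.sp k ζ ℓ (b i) = 0 := by
        rw [← hsp, ← Finset.add_sum_erase s _ hi₀, smul_add,
          TensorProduct.smul_tmul', e3, TensorProduct.neg_tmul,
          TensorProduct.sum_tmul, Finset.smul_sum, neg_add_eq_sub, ← Finset.sum_sub_distrib]
        refine Finset.sum_congr rfl fun i _ => ?_
        rw [map_sub, UZeta.sp_smul, UZeta.sp_smul, TensorProduct.tmul_sub,
          ← TensorProduct.tmul_smul, TensorProduct.smul_tmul]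
      exact (smul_eq_zero.mp hfin).resolve_left hspec

end Flat

/-! ### Relations between tensor squares -/

section TensorRel

/-- The ring map `A ⊗ A → C` given by two commuting ring maps `A → C`. -/
def tensorLift {A C : Type*} [Ring A] [Ring C] (f g : A →+* C) (h : ∀ x y, Commute (f x) (g y)) :
    A ⊗[ℤ] A →+* C :=
  (Algebra.TensorProduct.lift (RingHom.toIntAlgHom f) (RingHom.toIntAlgHom g) h).toRingHom

theorem tensorLift_tmul {A C : Type*} [Ring A] [Ring C] (f g : A →+* C)
    (h : ∀ x y, Commute (f x) (g y)) (a b : A) : tensorLift f g h (a ⊗ₜ b) = f a * g b :=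
  Algebra.TensorProduct.lift_tmul _ _ _ _ _

variable {Q k A B D : Type*} [Field Q] [Field k] [Ring A] [Ring B] [Algebra Q B] [Ring D]
  [Algebra k D] (f : A →+* B) (g : A →+* D)

/-- The map `A ⊗ A → (B ⊗ B) × (D ⊗ D)` for a pair of ring homomorphisms `A → B`, `A → D`. -/
def tensorPair : A ⊗[ℤ] A →+* (B ⊗[Q] B) × (D ⊗[k] D) :=
  tensorLift
    ((Algebra.TensorProduct.includeLeftRingHom.comp f).prod
      (Algebra.TensorProduct.includeLeftRingHom.comp g))
    (((Algebra.TensorProduct.includeRight : B →ₐ[Q] B ⊗[Q] B).toRingHom.comp f).prod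
      ((Algebra.TensorProduct.includeRight : D →ₐ[k] D ⊗[k] D).toRingHom.comp g))
    (fun x y => Prod.ext
      (show (f x ⊗ₜ[Q] (1 : B)) * ((1 : B) ⊗ₜ[Q] f y) = ((1 : B) ⊗ₜ[Q] f y) * (f x ⊗ₜ[Q] (1 : B)) by
        simp)
      (show (g x ⊗ₜ[k] (1 : D)) * ((1 : D) ⊗ₜ[k] g y) = ((1 : D) ⊗ₜ[k] g y) * (g x ⊗ₜ[k] (1 : D)) by
        simp))

theorem tensorPair_tmul (a b : A) : tensorPair (Q := Q) (k := k) f g (a ⊗ₜ b) =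
    (f a ⊗ₜ f b, g a ⊗ₜ g b) := by
  refine (tensorLift_tmul _ _ _ a b).trans ?_
  refine Prod.ext ?_ ?_
  · change (f a ⊗ₜ[Q] (1 : B)) * ((1 : B) ⊗ₜ[Q] f b) = _
    simp
  · change (g a ⊗ₜ[k] (1 : D)) * ((1 : D) ⊗ₜ[k] g b) = _
    simp

/-- The relation between `B ⊗ B` and `D ⊗ D` given by the image of `A ⊗ A`. -/
def tensorRel : Subring ((B ⊗[Q] B) × (D ⊗[k] D)) :=
  (tensorPair f g).range

variable {f g}

theorem tmul_mem_tensorRel (a b : A) :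
    (f a ⊗ₜ[Q] f b, g a ⊗ₜ[k] g b) ∈ tensorRel (Q := Q) (k := k) f g :=
  RingHom.mem_range.mpr ⟨a ⊗ₜ b, tensorPair_tmul f g a b⟩

theorem exists_of_mem_tensorRel {p : (B ⊗[Q] B) × (D ⊗[k] D)} (hp : p ∈ tensorRel f g) :
    ∃ s : Finset (A × A), p.1 = ∑ i ∈ s, f i.1 ⊗ₜ[Q] f i.2 ∧ p.2 = ∑ i ∈ s, g i.1 ⊗ₜ[k] g i.2 := by
  obtain ⟨t, rfl⟩ := RingHom.mem_range.mp hp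
  obtain ⟨s, rfl⟩ := TensorProduct.exists_finset t
  refine ⟨s, ?_, ?_⟩
  · change (tensorPair f g _).1 = _
    rw [map_sum, Prod.fst_sum]
    simp only [tensorPair_tmul]
  · change (tensorPair f g _).2 = _
    rw [map_sum, Prod.snd_sum]
    simp only [tensorPair_tmul]

end TensorRel

/-! ### The Hopf structure of `U_ζ` -/

namespace UZeta

variable {k : Type*} [Field k] {ζ : kˣ} {ℓ : ℕ}

/-- `K⁻¹` in `U_ζ`. -/
abbrev Kinv (k : Type*) [Field k] (ζ : kˣ) (ℓ : ℕ) : UZeta k ζ ℓ := sp k ζ ℓ intKinv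

theorem coe_vZ_zpow_smul (n : ℤ) (x : UInt) :
    (((vZ ^ n : ZVˣ) : ZV) • x : UInt) = qv ^ n • (x : UGen) := by
  change ((vZ ^ n : ZVˣ) : ZV) • (x : UGen) = _
  rw [← algebraMap_vZ_zpow, algebraMap_smul]

theorem sp_vZ_zpow_smul (n : ℤ) (x : UInt) :
    sp k ζ ℓ (((vZ ^ n : ZVˣ) : ZV) • x) = (ζ : k) ^ n • sp k ζ ℓ x := by
  rw [sp_smul, specHom_vZ_zpow]

theorem coe_intE (n : ℕ) : (intE n : UGen) = dp gE n := rfl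
theorem coe_intF (n : ℕ) : (intF n : UGen) = dp gF n := rfl
theorem coe_intK : (intK : UGen) = gK := rfl
theorem coe_intKinv : (intKinv : UGen) = gKi := rfl

variable (k ζ ℓ) in
/-- The relation between the tensor squares of `U_q` and `U_ζ`. -/
abbrev comulRel : Subring ((UGen ⊗[QV] UGen) × (UZeta k ζ ℓ ⊗[k] UZeta k ζ ℓ)) :=
  tensorRel UInt.val.toRingHom (sp k ζ ℓ)

/-- This makes Δ_ζ well defined: the specialized coproduct does not depend on the integral tensor
chosen to represent Δx. -/
theorem comulRel_functional [CharZero k] (hℓ : 0 < ℓ) (hζ : IsPrimitiveRoot ζ ℓ)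
    (d : UZeta k ζ ℓ ⊗[k] UZeta k ζ ℓ) (h : ((0 : UGen ⊗[QV] UGen), d) ∈ comulRel k ζ ℓ) : d = 0 := by
  obtain ⟨s, h1, h2⟩ := exists_of_mem_tensorRel h
  exact h2.trans (sum_sp_tmul_sp_eq_zero hℓ hζ s Prod.fst Prod.snd h1.symm)

theorem mem_comulRel_of_eq {a b : UInt} {x y : UGen} {x' y' : UZeta k ζ ℓ} (ha : (a : UGen) = x)
    (hb : (b : UGen) = y) (ha' : sp k ζ ℓ a = x') (hb' : sp k ζ ℓ b = y') :
    (x ⊗ₜ[QV] y, x' ⊗ₜ[k] y') ∈ comulRel k ζ ℓ := by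
  rw [← ha, ← hb, ← ha', ← hb']
  exact tmul_mem_tensorRel a b

theorem sum_mem_comulRel {ι : Type*} (s : Finset ι) (f : ι → UGen ⊗[QV] UGen)
    (g : ι → UZeta k ζ ℓ ⊗[k] UZeta k ζ ℓ) (h : ∀ i ∈ s, (f i, g i) ∈ comulRel k ζ ℓ) :
    (∑ i ∈ s, f i, ∑ i ∈ s, g i) ∈ comulRel k ζ ℓ := by
  have := (comulRel k ζ ℓ).sum_mem h
  rwa [show ∑ i ∈ s, (f i, g i) = (∑ i ∈ s, f i, ∑ i ∈ s, g i) from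
    Prod.ext Prod.fst_sum Prod.snd_sum] at this

/-- Existence of the comultiplication of `U_ζ`. -/
theorem exists_comul [CharZero k] (hℓ : 0 < ℓ) (hζ : IsPrimitiveRoot ζ ℓ) :
    ∃ Δ : UZeta k ζ ℓ →ₐ[k] UZeta k ζ ℓ ⊗[k] UZeta k ζ ℓ,
      (∀ x : UInt, (Uq.comul qv_ne_zero (x : UGen), Δ (sp k ζ ℓ x)) ∈ comulRel k ζ ℓ) ∧
      Δ (K k ζ ℓ) = K k ζ ℓ ⊗ₜ K k ζ ℓ ∧ Δ (Kinv k ζ ℓ) = Kinv k ζ ℓ ⊗ₜ Kinv k ζ ℓ ∧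
      (∀ n, Δ (E k ζ ℓ n) = ∑ p ∈ Finset.HasAntidiagonal.antidiagonal n,
        ((ζ : k) ^ (p.1 * p.2) • (E k ζ ℓ p.1 * K k ζ ℓ ^ p.2)) ⊗ₜ[k] E k ζ ℓ p.2) ∧
      (∀ n, Δ (F k ζ ℓ n) = ∑ p ∈ Finset.HasAntidiagonal.antidiagonal n,
        F k ζ ℓ p.2 ⊗ₜ[k] ((ζ : k) ^ (p.1 * p.2) • (F k ζ ℓ p.1 * Kinv k ζ ℓ ^ p.2))) := by
  have hE : ∀ n, (Uq.comul qv_ne_zero (intE n : UGen), ∑ p ∈ Finset.HasAntidiagonal.antidiagonal n,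
        ((ζ : k) ^ (p.1 * p.2) • (E k ζ ℓ p.1 * K k ζ ℓ ^ p.2)) ⊗ₜ[k] E k ζ ℓ p.2) ∈
          comulRel k ζ ℓ := fun n => by
    rw [coe_intE, comul_dp_gE]
    refine sum_mem_comulRel _ _ _ fun p _ => ?_
    refine mem_comulRel_of_eq (a := ((vZ ^ ((p.1 * p.2 : ℕ) : ℤ) : ZVˣ) : ZV) • (intE p.1 * intK ^ p.2))
      (b := intE p.2) ?_ rfl ?_ rfl
    · rw [coe_vZ_zpow_smul, zpow_natCast]; rfl
    · rw [sp_vZ_zpow_smul, zpow_natCast, map_mul, map_pow]; rfl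
  have hF : ∀ n, (Uq.comul qv_ne_zero (intF n : UGen), ∑ p ∈ Finset.HasAntidiagonal.antidiagonal n,
        F k ζ ℓ p.2 ⊗ₜ[k] ((ζ : k) ^ (p.1 * p.2) • (F k ζ ℓ p.1 * Kinv k ζ ℓ ^ p.2))) ∈
          comulRel k ζ ℓ := fun n => by
    rw [coe_intF, comul_dp_gF]
    refine sum_mem_comulRel _ _ _ fun p _ => ?_
    refine mem_comulRel_of_eq (a := intF p.2)
      (b := ((vZ ^ ((p.1 * p.2 : ℕ) : ℤ) : ZVˣ) : ZV) • (intF p.1 * intKinv ^ p.2)) rfl ?_ rfl ?_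
    · rw [coe_vZ_zpow_smul, zpow_natCast]; rfl
    · rw [sp_vZ_zpow_smul, zpow_natCast, map_mul, map_pow]; rfl
  have hK : (Uq.comul qv_ne_zero (intK : UGen), K k ζ ℓ ⊗ₜ K k ζ ℓ) ∈ comulRel k ζ ℓ := by
    rw [coe_intK, comul_gen]
    exact mem_comulRel_of_eq (a := intK) (b := intK) rfl rfl rfl rfl
  have hKi : (Uq.comul qv_ne_zero (intKinv : UGen), Kinv k ζ ℓ ⊗ₜ Kinv k ζ ℓ) ∈
      comulRel k ζ ℓ := by
    rw [coe_intKinv, comul_gen]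
    exact mem_comulRel_of_eq (a := intKinv) (b := intKinv) rfl rfl rfl rfl
  have h0 := comulRel_functional (k := k) hℓ hζ
  have huniq : ∀ a d d', (a, d) ∈ comulRel k ζ ℓ → (a, d') ∈ comulRel k ζ ℓ → d = d' :=
    fun a d d' h h' => by
      have := (comulRel k ζ ℓ).sub_mem h h'
      rw [Prod.mk_sub_mk, sub_self] at this
      exact sub_eq_zero.mp (h0 _ this)
  obtain ⟨Δ, hΔ⟩ := exists_lift_of_rel (k := k) (ζ := ζ) (ℓ := ℓ)
    (Uq.comul qv_ne_zero : UGen →ₐ[QV] _).toRingHom (comulRel k ζ ℓ) h0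
    (fun c => by
      have h1 : Uq.comul qv_ne_zero (algebraMap ZV UGen c) = (algebraMap ZV UGen c) ⊗ₜ 1 := by
        rw [IsScalarTower.algebraMap_apply ZV QV UGen, AlgHom.commutes,
          Algebra.TensorProduct.algebraMap_apply]
      change (Uq.comul qv_ne_zero (algebraMap ZV UGen c), _) ∈ _
      rw [h1, Algebra.TensorProduct.algebraMap_apply]
      exact mem_comulRel_of_eq (a := algebraMap ZV UInt c) (b := 1) rfl rfl (sp_algebraMap c)
        (map_one _))
    (K k ζ ℓ ⊗ₜ K k ζ ℓ) hK (by rw [Algebra.TensorProduct.tmul_pow, K_pow]; rfl)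
    ⟨_, hKi⟩ (fun n => ⟨_, hE n⟩) (fun n => ⟨_, hF n⟩)
  exact ⟨Δ, hΔ, huniq _ _ _ (hΔ _) hK, huniq _ _ _ (hΔ _) hKi,
    fun n => huniq _ _ _ (hΔ _) (hE n), fun n => huniq _ _ _ (hΔ _) (hF n)⟩

/-- Existence of the counit of `U_ζ`. -/
theorem exists_counit : ∃ ε : UZeta k ζ ℓ →ₐ[k] k,
    (∀ x : UInt, ∃ c : ZV, Uq.counit (x : UGen) = algebraMap ZV QV c ∧
      ε (sp k ζ ℓ x) = specHom k ζ c) ∧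
    ε (K k ζ ℓ) = 1 ∧ ε (Kinv k ζ ℓ) = 1 ∧ (∀ n, ε (E k ζ ℓ n) = if n = 0 then 1 else 0) ∧
    (∀ n, ε (F k ζ ℓ n) = if n = 0 then 1 else 0) := by
  let P : Subring (QV × k) := ((algebraMap ZV QV).prod (specHom k ζ)).range
  have hP : ∀ c, (algebraMap ZV QV c, specHom k ζ c) ∈ P := fun c => ⟨c, rfl⟩
  have h0 : ∀ d, ((0 : QV), d) ∈ P → d = 0 := by
    rintro d ⟨c, hc⟩
    have h1 : algebraMap ZV QV c = 0 := congrArg Prod.fst hc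
    have h2 : specHom k ζ c = d := congrArg Prod.snd hc
    rw [← h2, algebraMap_injective (h1.trans (map_zero _).symm), map_zero]
  have huniq : ∀ a d d', (a, d) ∈ P → (a, d') ∈ P → d = d' := fun a d d' h h' => by
    have := P.sub_mem h h'
    rw [Prod.mk_sub_mk, sub_self] at this
    exact sub_eq_zero.mp (h0 _ this)
  have hK : (Uq.counit (intK : UGen), (1 : k)) ∈ P := by
    rw [coe_intK, counit_gen]; exact P.one_mem
  have hKi : (Uq.counit (intKinv : UGen), (1 : k)) ∈ P := by
    rw [coe_intKinv, counit_gen]; exact P.one_mem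
  have hE : ∀ n, (Uq.counit (intE n : UGen), if n = 0 then (1 : k) else 0) ∈ P := fun n => by
    rw [coe_intE, counit_dp_gE]; split_ifs
    exacts [P.one_mem, P.zero_mem]
  have hF : ∀ n, (Uq.counit (intF n : UGen), if n = 0 then (1 : k) else 0) ∈ P := fun n => by
    rw [coe_intF, counit_dp_gF]; split_ifs
    exacts [P.one_mem, P.zero_mem]
  obtain ⟨ε, hε⟩ := exists_lift_of_rel (k := k) (ζ := ζ) (ℓ := ℓ)
    (Uq.counit : UGen →ₐ[QV] QV).toRingHom P h0
    (fun c => by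
      change (Uq.counit (algebraMap ZV UGen c), _) ∈ _
      rw [IsScalarTower.algebraMap_apply ZV QV UGen, AlgHom.commutes]
      exact hP c)
    1 hK (one_pow _) ⟨_, hKi⟩ (fun n => ⟨_, hE n⟩) (fun n => ⟨_, hF n⟩)
  refine ⟨ε, fun x => ?_, huniq _ _ _ (hε _) hK, huniq _ _ _ (hε _) hKi,
    fun n => huniq _ _ _ (hε _) (hE n), fun n => huniq _ _ _ (hε _) (hF n)⟩
  obtain ⟨c, hc⟩ := hε x
  exact ⟨c, (congrArg Prod.fst hc).symm, (congrArg Prod.snd hc).symm⟩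

/-- Existence of the antipode of `U_ζ`. -/
theorem exists_antipode : ∃ S : UZeta k ζ ℓ →ₐ[k] (UZeta k ζ ℓ)ᵐᵒᵖ,
    (∀ x : UInt, ∃ y : UInt, Uq.antipode qv_ne_zero (x : UGen) = MulOpposite.op (y : UGen) ∧
      S (sp k ζ ℓ x) = MulOpposite.op (sp k ζ ℓ y)) ∧
    S (K k ζ ℓ) = MulOpposite.op (Kinv k ζ ℓ) ∧
    (∀ n, S (E k ζ ℓ n) = MulOpposite.op
      (((-1) ^ n * (ζ : k) ^ (n * (n - 1))) • (Kinv k ζ ℓ ^ n * E k ζ ℓ n))) ∧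
    (∀ n, S (F k ζ ℓ n) = MulOpposite.op
      (((-1) ^ n * ((ζ : k)⁻¹) ^ (n * (n - 1))) • (F k ζ ℓ n * K k ζ ℓ ^ n))) := by
  let P : Subring (UGenᵐᵒᵖ × (UZeta k ζ ℓ)ᵐᵒᵖ) :=
    ((RingHom.op UInt.val.toRingHom).prod (RingHom.op (sp k ζ ℓ))).range
  have hP : ∀ x : UInt, (MulOpposite.op (x : UGen), MulOpposite.op (sp k ζ ℓ x)) ∈ P :=
    fun x => ⟨MulOpposite.op x, rfl⟩
  have h0 : ∀ d, ((0 : UGenᵐᵒᵖ), d) ∈ P → d = 0 := by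
    rintro d ⟨x, hx⟩
    have h1 : MulOpposite.op ((x.unop : UInt) : UGen) = 0 := congrArg Prod.fst hx
    have h2 : MulOpposite.op (sp k ζ ℓ x.unop) = d := congrArg Prod.snd hx
    have h3 : x.unop = 0 := Subtype.ext (MulOpposite.op_injective h1)
    rw [← h2, h3, map_zero]; rfl
  have huniq : ∀ a d d', (a, d) ∈ P → (a, d') ∈ P → d = d' := fun a d d' h h' => by
    have := P.sub_mem h h'
    rw [Prod.mk_sub_mk, sub_self] at this
    exact sub_eq_zero.mp (h0 _ this)
  have hK : (Uq.antipode qv_ne_zero (intK : UGen), MulOpposite.op (Kinv k ζ ℓ)) ∈ P := by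
    rw [coe_intK, antipode_gen]; exact hP intKinv
  have hKi : (Uq.antipode qv_ne_zero (intKinv : UGen), MulOpposite.op (K k ζ ℓ)) ∈ P := by
    rw [coe_intKinv, antipode_gen]; exact hP intK
  have hs : ∀ (n : ℕ) (m : ℤ) (x : UInt), (MulOpposite.op (((-1) ^ n * qv ^ m) • (x : UGen)),
      MulOpposite.op (((-1) ^ n * (ζ : k) ^ m) • sp k ζ ℓ x)) ∈ P := fun n m x => by
    have h := hP (((-1) ^ n * ((vZ ^ m : ZVˣ) : ZV)) • x)
    rw [sp_smul, map_mul, map_pow, map_neg, map_one, specHom_vZ_zpow] at h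
    have e : ((((-1) ^ n * ((vZ ^ m : ZVˣ) : ZV)) • x : UInt) : UGen) =
        ((-1) ^ n * qv ^ m) • (x : UGen) := by
      change ((-1) ^ n * ((vZ ^ m : ZVˣ) : ZV)) • (x : UGen) = _
      rw [← algebraMap_smul QV ((-1) ^ n * ((vZ ^ m : ZVˣ) : ZV)), map_mul, algebraMap_vZ_zpow,
        map_pow, map_neg, map_one]
    rwa [e] at h
  have hE : ∀ n, (Uq.antipode qv_ne_zero (intE n : UGen), MulOpposite.op
      (((-1) ^ n * (ζ : k) ^ (n * (n - 1))) • (Kinv k ζ ℓ ^ n * E k ζ ℓ n))) ∈ P := fun n => by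
    have h := hs n ((n * (n - 1) : ℕ) : ℤ) (intKinv ^ n * intE n)
    rw [zpow_natCast, zpow_natCast, map_mul, map_pow] at h
    rw [coe_intE, antipode_dp_gE]
    exact h
  have hF : ∀ n, (Uq.antipode qv_ne_zero (intF n : UGen), MulOpposite.op
      (((-1) ^ n * ((ζ : k)⁻¹) ^ (n * (n - 1))) • (F k ζ ℓ n * K k ζ ℓ ^ n))) ∈ P := fun n => by
    have h := hs n (-((n * (n - 1) : ℕ) : ℤ)) (intF n * intK ^ n)
    rw [zpow_neg, zpow_neg, zpow_natCast, zpow_natCast, ← inv_pow, ← inv_pow, map_mul, map_pow] at h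
    rw [coe_intF, antipode_dp_gF]
    exact h
  obtain ⟨S, hS⟩ := exists_lift_of_rel (k := k) (ζ := ζ) (ℓ := ℓ)
    (Uq.antipode qv_ne_zero : UGen →ₐ[QV] UGenᵐᵒᵖ).toRingHom P h0
    (fun c => by
      change (Uq.antipode qv_ne_zero (algebraMap ZV UGen c), _) ∈ _
      have := hP (algebraMap ZV UInt c)
      rw [sp_algebraMap] at this
      rw [IsScalarTower.algebraMap_apply ZV QV UGen, AlgHom.commutes]
      exact this)
    (MulOpposite.op (Kinv k ζ ℓ)) hK
    (by rw [← MulOpposite.op_pow, sp_intKinv_pow, MulOpposite.op_one])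
    ⟨_, hKi⟩ (fun n => ⟨_, hE n⟩) (fun n => ⟨_, hF n⟩)
  refine ⟨S, fun x => ?_, huniq _ _ _ (hS _) hK,
    fun n => huniq _ _ _ (hS _) (hE n), fun n => huniq _ _ _ (hS _) (hF n)⟩
  obtain ⟨y, hy⟩ := hS x
  exact ⟨y.unop, (congrArg Prod.fst hy).symm, (congrArg Prod.snd hy).symm⟩

end UZeta

/-! ### The Hopf axioms for U_ζ -/

theorem sum_antidiagonal_assoc {M : Type*} [AddCommMonoid M] (n : ℕ) (f : ℕ → ℕ → ℕ → M) :
    ∑ p ∈ Finset.HasAntidiagonal.antidiagonal n,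
        ∑ q ∈ Finset.HasAntidiagonal.antidiagonal p.1, f q.1 q.2 p.2 =
      ∑ p ∈ Finset.HasAntidiagonal.antidiagonal n,
        ∑ q ∈ Finset.HasAntidiagonal.antidiagonal p.2, f p.1 q.1 q.2 := by
  rw [Finset.sum_sigma', Finset.sum_sigma']
  refine Finset.sum_nbij' (fun x => ⟨(x.2.1, x.2.2 + x.1.2), (x.2.2, x.1.2)⟩)
    (fun x => ⟨(x.1.1 + x.2.1, x.2.2), (x.1.1, x.2.1)⟩) ?_ ?_ ?_ ?_ ?_
  all_goals
    rintro ⟨⟨a, b⟩, ⟨c, d⟩⟩ h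
    simp only [Finset.mem_sigma, Finset.HasAntidiagonal.mem_antidiagonal] at h ⊢
  · exact ⟨by omega, trivial⟩
  · exact ⟨by omega, trivial⟩
  · obtain ⟨-, rfl⟩ := h; rfl
  · obtain ⟨-, rfl⟩ := h; rfl

namespace UZeta

variable {k : Type*} [Field k] {ζ : kˣ} {ℓ : ℕ}

variable (Δ : UZeta k ζ ℓ →ₐ[k] UZeta k ζ ℓ ⊗[k] UZeta k ζ ℓ)

/-- `(Δ ⊗ id) Δ` as an algebra map. -/
def comulLeft : UZeta k ζ ℓ →ₐ[k] UZeta k ζ ℓ ⊗[k] (UZeta k ζ ℓ ⊗[k] UZeta k ζ ℓ) :=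
  (Algebra.TensorProduct.assoc k k k _ _ _).toAlgHom.comp
    ((Algebra.TensorProduct.map Δ (AlgHom.id k _)).comp Δ)

/-- `(id ⊗ Δ) Δ` as an algebra map. -/
def comulRight : UZeta k ζ ℓ →ₐ[k] UZeta k ζ ℓ ⊗[k] (UZeta k ζ ℓ ⊗[k] UZeta k ζ ℓ) :=
  (Algebra.TensorProduct.map (AlgHom.id k _) Δ).comp Δ

variable {Δ}

theorem comulLeft_of_eq_sum {ι : Type*} {s : Finset ι} {a b : ι → UZeta k ζ ℓ} {x : UZeta k ζ ℓ}
    (h : Δ x = ∑ i ∈ s, a i ⊗ₜ[k] b i) : comulLeft Δ x =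
      ∑ i ∈ s, TensorProduct.assoc k _ _ _ (Δ (a i) ⊗ₜ[k] b i) := by
  change TensorProduct.assoc k _ _ _ (Algebra.TensorProduct.map Δ (AlgHom.id k _) (Δ x)) = _
  rw [h, map_sum, map_sum]; rfl

theorem comulRight_of_eq_sum {ι : Type*} {s : Finset ι} {a b : ι → UZeta k ζ ℓ} {x : UZeta k ζ ℓ}
    (h : Δ x = ∑ i ∈ s, a i ⊗ₜ[k] b i) : comulRight Δ x = ∑ i ∈ s, a i ⊗ₜ[k] Δ (b i) := by
  change Algebra.TensorProduct.map (AlgHom.id k _) Δ (Δ x) = _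
  rw [h, map_sum]; rfl

/-- Both sides are the sum over a + b + c = n of ζ^(ab+ac+bc) E⁽ᵃ⁾K^(b+c) ⊗ E⁽ᵇ⁾K^c ⊗ E⁽ᶜ⁾. -/
theorem comulLeft_E (hK : Δ (K k ζ ℓ) = K k ζ ℓ ⊗ₜ K k ζ ℓ)
    (hE : ∀ n, Δ (E k ζ ℓ n) = ∑ p ∈ Finset.HasAntidiagonal.antidiagonal n,
      ((ζ : k) ^ (p.1 * p.2) • (E k ζ ℓ p.1 * K k ζ ℓ ^ p.2)) ⊗ₜ[k] E k ζ ℓ p.2) (n : ℕ) :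
    comulLeft Δ (E k ζ ℓ n) = comulRight Δ (E k ζ ℓ n) := by
  rw [comulLeft_of_eq_sum (hE n), comulRight_of_eq_sum (hE n)]
  have h1 := sum_antidiagonal_assoc n fun a b c =>
    ((ζ : k) ^ (a * b + a * c + b * c) • (E k ζ ℓ a * K k ζ ℓ ^ (b + c))) ⊗ₜ[k]
      ((E k ζ ℓ b * K k ζ ℓ ^ c) ⊗ₜ[k] E k ζ ℓ c)
  refine Eq.trans ?_ (h1.trans ?_)
  · refine Finset.sum_congr rfl fun p _ => ?_
    rw [map_smul, map_mul, map_pow, hE, hK, Algebra.TensorProduct.tmul_pow, Finset.sum_mul,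
      Finset.smul_sum, TensorProduct.sum_tmul, map_sum]
    refine Finset.sum_congr rfl fun q hq => ?_
    rw [Algebra.TensorProduct.tmul_mul_tmul, TensorProduct.smul_tmul', TensorProduct.assoc_tmul,
      smul_mul_assoc, smul_smul, mul_assoc, ← pow_add, ← pow_add,
      ← Finset.HasAntidiagonal.mem_antidiagonal.mp hq]
    congr 3
    ring
  · refine Finset.sum_congr rfl fun p hp => ?_
    rw [hE, TensorProduct.tmul_sum]
    refine Finset.sum_congr rfl fun q hq => ?_
    rw [← TensorProduct.smul_tmul', ← TensorProduct.smul_tmul', ← TensorProduct.smul_tmul',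
      TensorProduct.tmul_smul, smul_smul, ← pow_add, ← Finset.HasAntidiagonal.mem_antidiagonal.mp hq]
    congr 2
    ring

theorem comulLeft_F (hKi : Δ (Kinv k ζ ℓ) = Kinv k ζ ℓ ⊗ₜ Kinv k ζ ℓ)
    (hF : ∀ n, Δ (F k ζ ℓ n) = ∑ p ∈ Finset.HasAntidiagonal.antidiagonal n,
      F k ζ ℓ p.2 ⊗ₜ[k] ((ζ : k) ^ (p.1 * p.2) • (F k ζ ℓ p.1 * Kinv k ζ ℓ ^ p.2))) (n : ℕ) :
    comulLeft Δ (F k ζ ℓ n) = comulRight Δ (F k ζ ℓ n) := by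
  rw [comulLeft_of_eq_sum (hF n), comulRight_of_eq_sum (hF n)]
  have h1 := sum_antidiagonal_assoc n fun a b c => (ζ : k) ^ (a * b + a * c + b * c) •
    (F k ζ ℓ c ⊗ₜ[k] ((F k ζ ℓ b * Kinv k ζ ℓ ^ c) ⊗ₜ[k] (F k ζ ℓ a * Kinv k ζ ℓ ^ (b + c))))
  refine Eq.trans ?_ (h1.symm.trans ?_)
  · refine Finset.sum_congr rfl fun p _ => ?_
    rw [hF, TensorProduct.sum_tmul, map_sum]
    refine Finset.sum_congr rfl fun q hq => ?_
    rw [TensorProduct.assoc_tmul, TensorProduct.tmul_smul, TensorProduct.tmul_smul,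
      ← TensorProduct.smul_tmul', TensorProduct.tmul_smul, smul_smul, ← pow_add,
      ← Finset.HasAntidiagonal.mem_antidiagonal.mp hq]
    congr 2
    ring
  · refine Finset.sum_congr rfl fun p hp => ?_
    rw [map_smul, map_mul, map_pow, hF, hKi, Algebra.TensorProduct.tmul_pow, Finset.sum_mul,
      Finset.smul_sum, TensorProduct.tmul_sum]
    refine Finset.sum_congr rfl fun q hq => ?_
    rw [Algebra.TensorProduct.tmul_mul_tmul, smul_mul_assoc, TensorProduct.tmul_smul,
      TensorProduct.tmul_smul, TensorProduct.tmul_smul, smul_smul, mul_assoc, ← pow_add, ← pow_add,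
      ← Finset.HasAntidiagonal.mem_antidiagonal.mp hq]
    congr 2
    ring

/-- The Hopf structure of `U_ζ`, together with its values on generators. -/
theorem exists_hopfStr [CharZero k] (hodd : Odd ℓ) (hζ : IsPrimitiveRoot ζ ℓ) :
    ∃ 𝓗 : HopfStr k (UZeta k ζ ℓ), 𝓗.IsInduced ∧
      𝓗.comul (K k ζ ℓ) = K k ζ ℓ ⊗ₜ K k ζ ℓ ∧
      (∀ n, 𝓗.comul (E k ζ ℓ n) = ∑ p ∈ Finset.HasAntidiagonal.antidiagonal n,
        ((ζ : k) ^ (p.1 * p.2) • (E k ζ ℓ p.1 * K k ζ ℓ ^ p.2)) ⊗ₜ[k] E k ζ ℓ p.2) ∧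
      (∀ n, 𝓗.comul (F k ζ ℓ n) = ∑ p ∈ Finset.HasAntidiagonal.antidiagonal n,
        F k ζ ℓ p.2 ⊗ₜ[k] ((ζ : k) ^ (p.1 * p.2) • (F k ζ ℓ p.1 * Kinv k ζ ℓ ^ p.2))) ∧
      𝓗.counit (K k ζ ℓ) = 1 ∧ (∀ n, 𝓗.counit (E k ζ ℓ n) = if n = 0 then 1 else 0) ∧
      (∀ n, 𝓗.counit (F k ζ ℓ n) = if n = 0 then 1 else 0) ∧
      (∀ a b, 𝓗.antipode (a * b) = 𝓗.antipode b * 𝓗.antipode a) ∧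
      𝓗.antipode 1 = 1 ∧
      𝓗.antipode (K k ζ ℓ) = Kinv k ζ ℓ ∧
      (∀ n, 𝓗.antipode (E k ζ ℓ n) =
        ((-1) ^ n * (ζ : k) ^ (n * (n - 1))) • (Kinv k ζ ℓ ^ n * E k ζ ℓ n)) ∧
      (∀ n, 𝓗.antipode (F k ζ ℓ n) =
        ((-1) ^ n * ((ζ : k)⁻¹) ^ (n * (n - 1))) • (F k ζ ℓ n * K k ζ ℓ ^ n)) := by
  obtain ⟨Δ, hΔ, ΔK, ΔKi, ΔE, ΔF⟩ := exists_comul (k := k) (ζ := ζ) (ℓ := ℓ) hodd.pos hζ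
  obtain ⟨ε, hε, εK, εKi, εE, εF⟩ := exists_counit (k := k) (ζ := ζ) (ℓ := ℓ)
  obtain ⟨S, hS, SK, SE, SF⟩ := exists_antipode (k := k) (ζ := ζ) (ℓ := ℓ)
  let Sl : UZeta k ζ ℓ →ₗ[k] UZeta k ζ ℓ :=
    (MulOpposite.opLinearEquiv k).symm.toLinearMap ∘ₗ S.toLinearMap
  have hSl : ∀ x y, S x = MulOpposite.op y → Sl x = y := fun x y h => by
    change (S x).unop = y
    rw [h]; rfl
  -- Coassociativity and the counit axioms are equalities of algebra maps, hence are compared on the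
  -- five generators.
  have hcoassoc : comulLeft Δ = comulRight Δ := by
    refine algHom_ext hodd hζ ?_ (comulLeft_E ΔK ΔE 1) (comulLeft_F ΔKi ΔF 1) (comulLeft_E ΔK ΔE ℓ)
      (comulLeft_F ΔKi ΔF ℓ)
    have h : Δ (K k ζ ℓ) = ∑ i ∈ ({()} : Finset Unit), K k ζ ℓ ⊗ₜ[k] K k ζ ℓ := by
      rw [Finset.sum_singleton, ΔK]
    rw [comulLeft_of_eq_sum h, comulRight_of_eq_sum h, Finset.sum_singleton, Finset.sum_singleton, ΔK]
    rfl
  have εE' : ∀ (p : ℕ × ℕ), ε (E k ζ ℓ p.1 * K k ζ ℓ ^ p.2) = if p.1 = 0 then 1 else 0 := fun p => by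
    rw [map_mul, map_pow, εK, one_pow, mul_one, εE]
  have εF' : ∀ (p : ℕ × ℕ), ε (F k ζ ℓ p.1 * Kinv k ζ ℓ ^ p.2) = if p.1 = 0 then 1 else 0 := fun p => by
    rw [map_mul, map_pow, εKi, one_pow, mul_one, εF]
  have hcl : (Algebra.TensorProduct.map ε (AlgHom.id k _)).comp Δ =
      (Algebra.TensorProduct.includeRight : UZeta k ζ ℓ →ₐ[k] k ⊗[k] UZeta k ζ ℓ) := by
    have hcE : ∀ n, Algebra.TensorProduct.map ε (AlgHom.id k _) (Δ (E k ζ ℓ n)) = 1 ⊗ₜ E k ζ ℓ n := by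
      intro n
      rw [ΔE, map_sum, Finset.sum_eq_single (0, n)]
      · rw [Algebra.TensorProduct.map_tmul, map_smul, εE']
        simp
      · rintro ⟨a, b⟩ hab hne
        have : a ≠ 0 := by
          rintro rfl
          simp at hab
          exact hne (by rw [hab])
        rw [Algebra.TensorProduct.map_tmul, map_smul, εE', if_neg this]
        simp
      · simp
    have hcF : ∀ n, Algebra.TensorProduct.map ε (AlgHom.id k _) (Δ (F k ζ ℓ n)) = 1 ⊗ₜ F k ζ ℓ n := by
      intro n
      rw [ΔF, map_sum, Finset.sum_eq_single (n, 0)]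
      · rw [Algebra.TensorProduct.map_tmul, εF]
        simp
      · rintro ⟨a, b⟩ hab hne
        have : b ≠ 0 := by
          rintro rfl
          simp at hab
          exact hne (by rw [hab])
        rw [Algebra.TensorProduct.map_tmul, εF, if_neg this]
        simp
      · simp
    refine algHom_ext hodd hζ ?_ (hcE 1) (hcF 1) (hcE ℓ) (hcF ℓ)
    rw [AlgHom.comp_apply, ΔK, Algebra.TensorProduct.map_tmul, εK]; rfl
  have hcr : (Algebra.TensorProduct.map (AlgHom.id k _) ε).comp Δ =
      (Algebra.TensorProduct.includeLeft : UZeta k ζ ℓ →ₐ[k] UZeta k ζ ℓ ⊗[k] k) := by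
    have hcE : ∀ n, Algebra.TensorProduct.map (AlgHom.id k _) ε (Δ (E k ζ ℓ n)) = E k ζ ℓ n ⊗ₜ 1 := by
      intro n
      rw [ΔE, map_sum, Finset.sum_eq_single (n, 0)]
      · rw [Algebra.TensorProduct.map_tmul, εE]
        simp
      · rintro ⟨a, b⟩ hab hne
        have : b ≠ 0 := by
          rintro rfl
          simp at hab
          exact hne (by rw [hab])
        rw [Algebra.TensorProduct.map_tmul, εE, if_neg this]
        simp
      · simp
    have hcF : ∀ n, Algebra.TensorProduct.map (AlgHom.id k _) ε (Δ (F k ζ ℓ n)) = F k ζ ℓ n ⊗ₜ 1 := by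
      intro n
      rw [ΔF, map_sum, Finset.sum_eq_single (0, n)]
      · rw [Algebra.TensorProduct.map_tmul, map_smul, εF']
        simp
      · rintro ⟨a, b⟩ hab hne
        have : a ≠ 0 := by
          rintro rfl
          simp at hab
          exact hne (by rw [hab])
        rw [Algebra.TensorProduct.map_tmul, map_smul, εF', if_neg this]
        simp
      · simp
    refine algHom_ext hodd hζ ?_ (hcE 1) (hcF 1) (hcE ℓ) (hcF ℓ)
    rw [AlgHom.comp_apply, ΔK, Algebra.TensorProduct.map_tmul, εK]; rfl
  choose y hy hy' using hS
  have hgS : ∀ x : UInt, genAntipode (x : UGen) = (y x : UGen) := fun x => by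
    change (Uq.antipode qv_ne_zero (x : UGen)).unop = _
    rw [hy]; rfl
  -- The antipode axiom is not an equality of algebra maps. It is transferred instead: for x in the
  -- integral form, ∑ S(x₁)x₂ = ε(x) is an identity between integral elements that holds
  -- generically, and specialization preserves it.
  have hleft : ∀ x, LinearMap.mul' k _ (Sl.rTensor _ (Δ x)) = algebraMap k _ (ε x) := by
    intro x
    induction x using sp_induction with
    | h x =>
      obtain ⟨s, h1, h2⟩ := exists_of_mem_tensorRel (hΔ x)
      obtain ⟨c, hc, hc'⟩ := hε x
      have h3 := gen_antipode_left (x : UGen)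
      rw [show Uq.comul qv_ne_zero (x : UGen) = _ from h1, map_sum, map_sum, hc] at h3
      have h4 : ∑ i ∈ s, y i.1 * i.2 = algebraMap ZV UInt c := by
        apply Subtype.ext
        rw [AddSubmonoidClass.coe_finsetSum]
        refine Eq.trans (Finset.sum_congr rfl fun i _ => ?_) h3
        rw [LinearMap.rTensor_tmul, LinearMap.mul'_apply]
        exact congrArg (· * (i.2 : UGen)) (hgS i.1).symm
      rw [show Δ (sp k ζ ℓ x) = _ from h2, map_sum, map_sum, hc', ← sp_algebraMap, ← h4, map_sum]
      refine Finset.sum_congr rfl fun i _ => ?_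
      rw [LinearMap.rTensor_tmul, LinearMap.mul'_apply, hSl _ _ (hy' i.1), map_mul]
    | h0 => simp only [map_zero]
    | ha x y hx hy => simp only [map_add, hx, hy]
    | hs c x hx => simp only [map_smul, hx, Algebra.algebraMap_eq_smul_one, smul_assoc]
  have hright : ∀ x, LinearMap.mul' k _ (Sl.lTensor _ (Δ x)) = algebraMap k _ (ε x) := by
    intro x
    induction x using sp_induction with
    | h x =>
      obtain ⟨s, h1, h2⟩ := exists_of_mem_tensorRel (hΔ x)
      obtain ⟨c, hc, hc'⟩ := hε x
      have h3 := gen_antipode_right (x : UGen)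
      rw [show Uq.comul qv_ne_zero (x : UGen) = _ from h1, map_sum, map_sum, hc] at h3
      have h4 : ∑ i ∈ s, i.1 * y i.2 = algebraMap ZV UInt c := by
        apply Subtype.ext
        rw [AddSubmonoidClass.coe_finsetSum]
        refine Eq.trans (Finset.sum_congr rfl fun i _ => ?_) h3
        rw [LinearMap.lTensor_tmul, LinearMap.mul'_apply]
        exact congrArg ((i.1 : UGen) * ·) (hgS i.2).symm
      rw [show Δ (sp k ζ ℓ x) = _ from h2, map_sum, map_sum, hc', ← sp_algebraMap, ← h4, map_sum]
      refine Finset.sum_congr rfl fun i _ => ?_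
      rw [LinearMap.lTensor_tmul, LinearMap.mul'_apply, hSl _ _ (hy' i.2), map_mul]
    | h0 => simp only [map_zero]
    | ha x y hx hy => simp only [map_add, hx, hy]
    | hs c x hx => simp only [map_smul, hx, Algebra.algebraMap_eq_smul_one, smul_assoc]
  let 𝓗 : HopfStr k (UZeta k ζ ℓ) :=
    { comul := Δ
      counit := ε
      antipode := Sl
      coassoc := fun x => DFunLike.congr_fun hcoassoc x
      counit_left := fun x => DFunLike.congr_fun hcl x
      counit_right := fun x => DFunLike.congr_fun hcr x
      antipode_left := hleft
      antipode_right := hright }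
  refine ⟨𝓗, ⟨fun x => ?_, hε, fun x => ⟨y x, hy x, hSl _ _ (hy' x)⟩⟩, ΔK, ΔE, ΔF, εK, εE, εF, ?_, ?_, hSl _ _ SK,
    fun n => hSl _ _ (SE n), fun n => hSl _ _ (SF n)⟩
  · obtain ⟨s, h1, h2⟩ := exists_of_mem_tensorRel (hΔ x)
    refine ⟨s.card, fun i => (s.equivFin.symm i).1.1, fun i => (s.equivFin.symm i).1.2, ?_, ?_⟩
    · rw [show Uq.comul qv_ne_zero (x : UGen) = _ from h1, ← Finset.sum_coe_sort s,
        ← s.equivFin.symm.sum_comp]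
      rfl
    · rw [show 𝓗.comul (sp k ζ ℓ x) = _ from h2, ← Finset.sum_coe_sort s,
        ← s.equivFin.symm.sum_comp]
  · intro a b
    change (S (a * b)).unop = _
    rw [map_mul, MulOpposite.unop_mul]; rfl
  · change (S 1).unop = _
    rw [map_one, MulOpposite.unop_one]

end UZeta

/-! ### Maps out of `U(sl₂)` -/

section SL2

attribute [local instance 100] LieRing.ofAssociativeRing

variable {k : Type*} [Field k] {A : Type*} [Ring A] [Algebra k A]

theorem sl_val_one_one (x : SL2 k) : x.val 1 1 = -x.val 0 0 := by
  have : Matrix.trace x.val = 0 := x.2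
  rw [Matrix.trace_fin_two] at this
  exact eq_neg_of_add_eq_zero_right this

/-- The algebra map `U(sl₂) → A` given by a pair of elements satisfying the Serre-type relations. -/
def slHom (X Y : A) (hX : (X * Y - Y * X) * X - X * (X * Y - Y * X) = (2 : k) • X)
    (hY : (X * Y - Y * X) * Y - Y * (X * Y - Y * X) = -((2 : k) • Y)) : USl2 k →ₐ[k] A :=
  UniversalEnvelopingAlgebra.lift k
    { toFun := fun x => x.val 0 1 • X + x.val 1 0 • Y + x.val 0 0 • (X * Y - Y * X)
      map_add' := fun x y => by
        change (x.val 0 1 + y.val 0 1) • X + (x.val 1 0 + y.val 1 0) • Y +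
          (x.val 0 0 + y.val 0 0) • (X * Y - Y * X) = _
        simp only [add_smul]; abel
      map_smul' := fun c x => by
        change (c * x.val 0 1) • X + (c * x.val 1 0) • Y + (c * x.val 0 0) • (X * Y - Y * X) = _
        simp only [mul_smul, smul_add, RingHom.id_apply]
      map_lie' := fun {x y} => by
        have hx := sl_val_one_one x
        have hy := sl_val_one_one y
        -- The commutator becomes an opaque H, and all products are brought to one order by the
        -- three commutation rules; what remains is linear.
        have hXY : X * Y = Y * X + (X * Y - Y * X) := by abel
        generalize X * Y - Y * X = H at hX hY hXY ⊢
        have hHX : H * X = X * H + (2 : k) • X := by rw [← hX]; abel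
        have hHY : H * Y = Y * H - (2 : k) • Y := by rw [sub_eq_add_neg, ← hY]; abel
        rw [LieRing.of_associative_ring_bracket, LieAlgebra.SpecialLinear.sl_bracket]
        simp only [Matrix.sub_apply, Matrix.mul_apply, Fin.sum_univ_two, hx, hy, add_mul, mul_add,
          smul_mul_smul_comm, hXY, hHX, hHY]
        simp only [smul_add, smul_sub, smul_smul]
        module }

variable (X Y : A) (hX : (X * Y - Y * X) * X - X * (X * Y - Y * X) = (2 : k) • X)
    (hY : (X * Y - Y * X) * Y - Y * (X * Y - Y * X) = -((2 : k) • Y))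

theorem slHom_ι (x : SL2 k) : slHom X Y hX hY (UniversalEnvelopingAlgebra.ι k x) =
    x.val 0 1 • X + x.val 1 0 • Y + x.val 0 0 • (X * Y - Y * X) := by
  rw [slHom, UniversalEnvelopingAlgebra.lift_ι_apply]; rfl

@[simp] theorem slHom_e : slHom X Y hX hY (e k) = X := by
  rw [e, slHom_ι]
  simp

@[simp] theorem slHom_f : slHom X Y hX hY (f k) = Y := by
  rw [f, slHom_ι]
  simp

theorem e_mul_f_sub : e k * f k - f k * e k = UniversalEnvelopingAlgebra.ι k
    ⁅LieAlgebra.SpecialLinear.single (R := k) (0 : Fin 2) 1 (by decide) (1 : k),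
      LieAlgebra.SpecialLinear.single (1 : Fin 2) 0 (by decide) (1 : k)⁆ := by
  rw [LieHom.map_lie, LieRing.of_associative_ring_bracket]; rfl

theorem sl_eq (x : SL2 k) : x =
    x.val 0 1 • LieAlgebra.SpecialLinear.single (0 : Fin 2) 1 (by decide) (1 : k) +
    x.val 1 0 • LieAlgebra.SpecialLinear.single (1 : Fin 2) 0 (by decide) (1 : k) +
    x.val 0 0 • ⁅LieAlgebra.SpecialLinear.single (R := k) (0 : Fin 2) 1 (by decide) (1 : k),
      LieAlgebra.SpecialLinear.single (1 : Fin 2) 0 (by decide) (1 : k)⁆ := by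
  have hx := sl_val_one_one x
  apply Subtype.ext
  change x.val = x.val 0 1 • Matrix.single 0 1 1 + x.val 1 0 • Matrix.single 1 0 1 + x.val 0 0 •
    (Matrix.single 0 1 1 * Matrix.single 1 0 1 - Matrix.single 1 0 1 * Matrix.single 0 1 1)
  ext i j
  fin_cases i <;> fin_cases j <;> simp [hx]

/-- `U(sl₂)` is generated by `e` and `f`. -/
theorem usl2_subalgebra_eq_top (S : Subalgebra k (USl2 k)) (he : e k ∈ S) (hf : f k ∈ S) : S = ⊤ := by
  rw [eq_top_iff]
  rintro u -
  refine env_mem_of_ι_mem S (fun x => ?_) u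
  have hx := congrArg (UniversalEnvelopingAlgebra.ι k) (sl_eq x)
  rw [map_add, map_add, map_smul, map_smul, map_smul, ← e_mul_f_sub] at hx
  refine hx ▸ ?_
  change _ • e k + _ • f k + _ ∈ S
  exact S.add_mem (S.add_mem (S.smul_mem he _) (S.smul_mem hf _))
    (S.smul_mem (S.sub_mem (S.mul_mem he hf) (S.mul_mem hf he)) _)

theorem usl2_hom_ext {φ ψ : USl2 k →ₐ[k] A} (he : φ (e k) = ψ (e k)) (hf : φ (f k) = ψ (f k)) :
    φ = ψ := by
  refine AlgHom.ext fun u => ?_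
  have : u ∈ AlgHom.equalizer φ ψ := by
    rw [usl2_subalgebra_eq_top (AlgHom.equalizer φ ψ) he hf]; trivial
  exact this

/-- The element `h` of `U(sl₂)`. -/
def hSl (k : Type*) [Field k] : USl2 k := e k * f k - f k * e k

theorem h_mul_e : hSl k * e k = e k * hSl k + 2 * e k := by
  have h1 : ⁅⁅LieAlgebra.SpecialLinear.single (R := k) (0 : Fin 2) 1 (by decide) (1 : k),
      LieAlgebra.SpecialLinear.single (1 : Fin 2) 0 (by decide) (1 : k)⁆,
      LieAlgebra.SpecialLinear.single (R := k) (0 : Fin 2) 1 (by decide) (1 : k)⁆ =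
      (2 : k) • LieAlgebra.SpecialLinear.single (R := k) (0 : Fin 2) 1 (by decide) (1 : k) := by
    apply Subtype.ext
    change (Matrix.single 0 1 1 * Matrix.single 1 0 1 - Matrix.single 1 0 1 * Matrix.single 0 1 1) *
      Matrix.single 0 1 1 - Matrix.single 0 1 1 *
        (Matrix.single 0 1 1 * Matrix.single 1 0 1 - Matrix.single 1 0 1 * Matrix.single 0 1 1) =
      (2 : k) • Matrix.single 0 1 (1 : k)
    ext i j
    fin_cases i <;> fin_cases j <;> simp
    norm_num
  have h2 := congrArg (UniversalEnvelopingAlgebra.ι k) h1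
  rw [LieHom.map_lie, ← e_mul_f_sub, LieRing.of_associative_ring_bracket, map_smul] at h2
  change hSl k * e k - e k * hSl k = (2 : k) • e k at h2
  have h2_two : (2 : k) • e k = 2 * e k := by rw [Algebra.smul_def, map_ofNat]
  rw [← h2_two, ← h2]; abel

theorem h_mul_f : hSl k * f k = f k * hSl k - 2 * f k := by
  have h1 : ⁅⁅LieAlgebra.SpecialLinear.single (R := k) (0 : Fin 2) 1 (by decide) (1 : k),
      LieAlgebra.SpecialLinear.single (1 : Fin 2) 0 (by decide) (1 : k)⁆,
      LieAlgebra.SpecialLinear.single (R := k) (1 : Fin 2) 0 (by decide) (1 : k)⁆ =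
      -((2 : k) • LieAlgebra.SpecialLinear.single (R := k) (1 : Fin 2) 0 (by decide) (1 : k)) := by
    apply Subtype.ext
    change (Matrix.single 0 1 1 * Matrix.single 1 0 1 - Matrix.single 1 0 1 * Matrix.single 0 1 1) *
      Matrix.single 1 0 1 - Matrix.single 1 0 1 *
        (Matrix.single 0 1 1 * Matrix.single 1 0 1 - Matrix.single 1 0 1 * Matrix.single 0 1 1) =
      -((2 : k) • Matrix.single 1 0 (1 : k))
    ext i j
    fin_cases i <;> fin_cases j <;> simp
    norm_num
  have h2 := congrArg (UniversalEnvelopingAlgebra.ι k) h1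
  rw [LieHom.map_lie, ← e_mul_f_sub, LieRing.of_associative_ring_bracket, map_neg, map_smul] at h2
  change hSl k * f k - f k * hSl k = -((2 : k) • f k) at h2
  have h2_two : (2 : k) • f k = 2 * f k := by rw [Algebra.smul_def, map_ofNat]
  rw [sub_eq_add_neg, ← h2_two, ← h2]; abel

end SL2

/-! ### The spanning set `f^a p(h) e^c` -/

section Triangular

open Polynomial

variable (k : Type*) [Field k]

/-- The map `(p_{a,c}) ↦ ∑ f^a p_{a,c}(h) e^c`. -/
def triangular : (ℕ × ℕ →₀ k[X]) →ₗ[k] USl2 k :=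
  Finsupp.lsum k fun q => LinearMap.mulLeft k (f k ^ q.1) ∘ₗ LinearMap.mulRight k (e k ^ q.2) ∘ₗ
    (aeval (hSl k)).toLinearMap

variable {k}

theorem triangular_single (a c : ℕ) (p : k[X]) :
    triangular k (Finsupp.single (a, c) p) = f k ^ a * (aeval (hSl k) p * e k ^ c) := by
  rw [triangular, Finsupp.lsum_single]; rfl

theorem e_mul_aeval_h (p : k[X]) :
    e k * aeval (hSl k) p = aeval (hSl k) (p.comp (X - C 2)) * e k := by
  have h1 : e k * hSl k = (hSl k - 2) * e k := by rw [sub_mul, h_mul_e]; abel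
  rw [aeval_comp, map_sub, aeval_X, aeval_C, map_ofNat]
  induction p using Polynomial.induction_on with
  | C a => rw [aeval_C, aeval_C, Algebra.commutes]
  | add p q hp hq => rw [map_add, map_add, mul_add, add_mul, hp, hq]
  | monomial n a ih =>
    rw [pow_succ, ← mul_assoc, map_mul (aeval (hSl k)) (C a * X ^ n) X,
      map_mul (aeval (hSl k - 2)) (C a * X ^ n) X, ← mul_assoc, ih, aeval_X, aeval_X, mul_assoc, h1,
      mul_assoc]

theorem e_mul_f_pow (a : ℕ) :
    e k * f k ^ (a + 1) = f k ^ (a + 1) * e k + (a + 1 : k) • (f k ^ a * (hSl k - (a : k) • 1)) := by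
  have h0 : e k * f k = f k * e k + hSl k := by rw [hSl]; abel
  induction a with
  | zero => simp [h0]
  | succ a ih =>
    have h2 : hSl k * f k = f k * hSl k - (2 : k) • f k := by
      rw [h_mul_f, Algebra.smul_def, map_ofNat]
    have h3 : f k ^ a * (hSl k - (a : k) • 1) * f k =
        f k ^ (a + 1) * hSl k - (a + 2 : k) • f k ^ (a + 1) := by
      rw [mul_assoc, sub_mul, h2, smul_one_mul, mul_sub, mul_sub, mul_smul_comm, mul_smul_comm,
        ← mul_assoc, ← pow_succ]
      module
    have h4 : f k ^ (a + 1) * (hSl k - ((a + 1 : ℕ) : k) • 1) =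
        f k ^ (a + 1) * hSl k - (a + 1 : k) • f k ^ (a + 1) := by
      rw [mul_sub, mul_smul_comm, mul_one, Nat.cast_succ]
    rw [h4, pow_succ, ← mul_assoc, ih, add_mul, mul_assoc, h0, smul_mul_assoc, h3, mul_add,
      ← mul_assoc, Nat.cast_succ]
    module

/-- Only the spanning half of the Poincaré–Birkhoff–Witt theorem is needed; independence is absorbed
into the faithfulness of `slRep`. -/
theorem triangular_surjective : Function.Surjective (triangular k) := by
  let R : Submodule k (USl2 k) := LinearMap.range (triangular k)
  have hmem : ∀ (a c : ℕ) (p : k[X]), f k ^ a * (aeval (hSl k) p * e k ^ c) ∈ R := fun a c p =>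
    ⟨Finsupp.single (a, c) p, triangular_single a c p⟩
  -- The elements whose left multiplication preserves the span form a subalgebra. It contains e and
  -- f, hence is everything, and applying it to 1 gives surjectivity.
  let S : Subalgebra k (USl2 k) :=
    { carrier := {u | ∀ w ∈ R, u * w ∈ R}
      mul_mem' := fun {u u'} hu hu' w hw => by rw [mul_assoc]; exact hu _ (hu' _ hw)
      add_mem' := fun {u u'} hu hu' w hw => by rw [add_mul]; exact R.add_mem (hu _ hw) (hu' _ hw)
      algebraMap_mem' := fun c w hw => by
        rw [← Algebra.smul_def]; exact R.smul_mem _ hw }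
  have hred : ∀ u : USl2 k, (∀ (a c : ℕ) (p : k[X]), u * (f k ^ a * (aeval (hSl k) p * e k ^ c)) ∈ R) → u ∈ S := by
    rintro u hu _ ⟨P, rfl⟩
    induction P using Finsupp.induction_linear with
    | zero => rw [map_zero, mul_zero]; exact R.zero_mem
    | add P Q hP hQ => rw [map_add, mul_add]; exact R.add_mem hP hQ
    | single q p => rw [triangular_single]; exact hu _ _ _
  have hS : S = ⊤ := by
    refine usl2_subalgebra_eq_top S (hred _ fun a c p => ?_) (hred _ fun a c p => ?_)
    · have h1 : ∀ a, f k ^ a * e k * (aeval (hSl k) p * e k ^ c) ∈ R := fun a => by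
        rw [mul_assoc, ← mul_assoc (e k), e_mul_aeval_h, mul_assoc (aeval (hSl k) _), ← pow_succ']
        exact hmem _ _ _
      cases a with
      | zero => rw [pow_zero, one_mul]; simpa using h1 0
      | succ a =>
        rw [← mul_assoc, e_mul_f_pow, add_mul, smul_mul_assoc, mul_assoc (f k ^ a), ← mul_assoc (_ - _)]
        refine R.add_mem (h1 _) (R.smul_mem _ ?_)
        have : (hSl k - (a : k) • 1) * aeval (hSl k) p = aeval (hSl k) ((X - C (a : k)) * p) := by
          rw [map_mul, map_sub, aeval_X, aeval_C, Algebra.algebraMap_eq_smul_one]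
        rw [this]
        exact hmem _ _ _
    · rw [← mul_assoc, ← pow_succ']; exact hmem _ _ _
  intro u
  have h1 : u ∈ S := by rw [hS]; trivial
  have h2 := h1 1 (by simpa using hmem 0 0 1)
  rw [mul_one] at h2
  exact h2

end Triangular

/-! ### Weighted shifts on the space with basis `ℕ × ℕ` -/

section WeightedShift

variable {R : Type*} [CommRing R]

/-- The endomorphism `x_p ↦ c_p x_{σ p}` of the free module with basis `x_p`, `p ∈ ℕ × ℕ`. -/
def wshift (c : ℕ × ℕ → R) (σ : ℕ × ℕ → ℕ × ℕ) : Module.End R (ℕ × ℕ →₀ R) :=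
  Finsupp.linearCombination R fun p => Finsupp.single (σ p) (c p)

theorem wshift_single (c : ℕ × ℕ → R) (σ : ℕ × ℕ → ℕ × ℕ) (p : ℕ × ℕ) (r : R) :
    wshift c σ (Finsupp.single p r) = Finsupp.single (σ p) (r * c p) := by
  rw [wshift, Finsupp.linearCombination_single, Finsupp.smul_single, smul_eq_mul]

theorem end_ext_single {S T : Module.End R (ℕ × ℕ →₀ R)}
    (h : ∀ p, S (Finsupp.single p 1) = T (Finsupp.single p 1)) : S = T :=
  Finsupp.lhom_ext' fun p => LinearMap.ext_ring (h p)

theorem wshift_mul (c d : ℕ × ℕ → R) (σ τ : ℕ × ℕ → ℕ × ℕ) :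
    wshift c σ * wshift d τ = wshift (fun p => d p * c (τ p)) (fun p => σ (τ p)) :=
  end_ext_single fun p => by
    rw [Module.End.mul_apply, wshift_single, wshift_single, wshift_single]; simp

theorem smul_wshift (a : R) (c : ℕ × ℕ → R) (σ : ℕ × ℕ → ℕ × ℕ) :
    a • wshift c σ = wshift (fun p => a * c p) σ :=
  end_ext_single fun p => by
    rw [LinearMap.smul_apply, wshift_single, wshift_single, Finsupp.smul_single]; simp

theorem wshift_sub (c d : ℕ × ℕ → R) (σ : ℕ × ℕ → ℕ × ℕ) :
    wshift c σ - wshift d σ = wshift (fun p => c p - d p) σ :=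
  end_ext_single fun p => by
    rw [LinearMap.sub_apply, wshift_single, wshift_single, wshift_single, ← Finsupp.single_sub]; simp

/-- The index maps need to agree only where the coefficient is nonzero, which makes the truncated
subtractions in `raise` and `lower` harmless. -/
theorem wshift_congr {c d : ℕ × ℕ → R} {σ τ : ℕ × ℕ → ℕ × ℕ}
    (h : ∀ p, c p = d p ∧ (d p ≠ 0 → σ p = τ p)) : wshift c σ = wshift d τ :=
  end_ext_single fun p => by
    rw [wshift_single, wshift_single, (h p).1]
    by_cases hp : d p = 0
    · simp [hp]
    · rw [(h p).2 hp]

theorem wshift_id : wshift (fun _ => (1 : R)) id = 1 :=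
  end_ext_single fun p => by rw [wshift_single]; simp

theorem wshift_zero (σ : ℕ × ℕ → ℕ × ℕ) : wshift (fun _ => (0 : R)) σ = 0 :=
  end_ext_single fun p => by rw [wshift_single]; simp

variable (v : Rˣ)

/-- The coefficients of `E⁽ⁿ⁾`. -/
def raiseCoeff (n : ℕ) (p : ℕ × ℕ) : R := if n ≤ p.2 then qbin v (p.1 + n) n else 0

/-- The coefficients of `F⁽ⁿ⁾`. -/
def lowerCoeff (n : ℕ) (p : ℕ × ℕ) : R := if n ≤ p.1 then qbin v (p.2 + n) n else 0

theorem raiseCoeff_of_le {n a b : ℕ} (h : n ≤ b) : raiseCoeff v n (a, b) = qbin v (a + n) n :=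
  if_pos h

theorem raiseCoeff_of_lt {n a b : ℕ} (h : b < n) : raiseCoeff v n (a, b) = 0 :=
  if_neg (not_le.mpr h)

/-- The coefficients of `K`. -/
def weightCoeff (p : ℕ × ℕ) : Rˣ := v ^ ((p.1 : ℤ) - p.2)

theorem lowerCoeff_of_le {n a b : ℕ} (h : n ≤ a) : lowerCoeff v n (a, b) = qbin v (b + n) n :=
  if_pos h

theorem lowerCoeff_of_lt {n a b : ℕ} (h : a < n) : lowerCoeff v n (a, b) = 0 :=
  if_neg (not_le.mpr h)

/-- The index shift of `E⁽ⁿ⁾`. -/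
def raise (n : ℕ) (p : ℕ × ℕ) : ℕ × ℕ := (p.1 + n, p.2 - n)

/-- The index shift of `F⁽ⁿ⁾`. -/
def lower (n : ℕ) (p : ℕ × ℕ) : ℕ × ℕ := (p.1 - n, p.2 + n)

end WeightedShift

/-! ### The action of U_q on divided monomials -/

section GenericRep

/-- The values of the generators of the quantum algebra on the sum of its finite-dimensional
modules of type one. -/
def genRepGen : Gen → Module.End QV (ℕ × ℕ →₀ QV)
  | .E => wshift (raiseCoeff vQ 1) (raise 1)
  | .F => wshift (lowerCoeff vQ 1) (lower 1)
  | .K => wshift (fun p => (weightCoeff vQ p : QV)) id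
  | .Kinv => wshift (fun p => ((weightCoeff vQ p)⁻¹ : QVˣ)) id

theorem qbin_vQ_one (n : ℕ) : qbin vQ (n + 1) 1 = qInt (n + 1) := by
  have h := qbin_absorb vQ n 0
  have h1 := qs_vQ_ne_zero one_ne_zero
  rw [qInt_eq, eq_div_iff h1]
  simpa [mul_comm] using h

/-- The right side is [a-b], the value of (K - K⁻¹)/(v - v⁻¹) on the weight vector with indices (a,
b). -/
theorem qInt_mul_sub (a b : ℕ) :
    qInt a * qInt (b + 1) - qInt b * qInt (a + 1) =
      (qv - qv⁻¹)⁻¹ * (qv ^ ((a : ℤ) - b) - qv ^ (-((a : ℤ) - b))) := by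
  have h1 : qv - qv⁻¹ ≠ 0 := by simpa [qs] using qs_vQ_ne_zero one_ne_zero
  have hv := qv_ne_zero
  have ha : qv ^ a ≠ 0 := pow_ne_zero _ hv
  have hb : qv ^ b ≠ 0 := pow_ne_zero _ hv
  rw [neg_sub, zpow_sub₀ hv, zpow_sub₀ hv, qInt, qInt, qInt, qInt]
  simp only [zpow_natCast]
  have h2 : qv ^ 2 - 1 ≠ 0 := by
    intro h
    apply h1
    field_simp
    rw [h, mul_zero]
  simp only [inv_pow]
  field_simp
  ring

/-- The action of the generic quantum algebra. -/
def genRep : UGen →ₐ[QV] Module.End QV (ℕ × ℕ →₀ QV) :=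
  Uq.lift genRepGen
    (by
      rw [genRepGen, genRepGen, wshift_mul, ← wshift_id]
      exact wshift_congr fun p => ⟨by simp, fun _ => rfl⟩)
    (by
      rw [genRepGen, genRepGen, wshift_mul, ← wshift_id]
      exact wshift_congr fun p => ⟨by simp, fun _ => rfl⟩)
    (by
      rw [genRepGen, genRepGen, wshift_mul, wshift_mul, smul_wshift]
      refine wshift_congr fun p => ⟨?_, fun _ => rfl⟩
      rcases p with ⟨a, b⟩
      simp only [raiseCoeff, weightCoeff, raise, id]
      split_ifs with hb
      · have h : ((a + 1 : ℕ) : ℤ) - ((b - 1 : ℕ) : ℤ) = 2 + ((a : ℤ) - b) := by omega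
        rw [h, zpow_add]
        simp only [Units.val_mul, Units.val_zpow_eq_zpow_val, val_vQ]
        norm_cast
        ring
      · simp)
    (by
      rw [genRepGen, genRepGen, wshift_mul, wshift_mul, smul_wshift]
      refine wshift_congr fun p => ⟨?_, fun _ => rfl⟩
      rcases p with ⟨a, b⟩
      simp only [lowerCoeff, weightCoeff, lower, id]
      split_ifs with hb
      · have h : ((a - 1 : ℕ) : ℤ) - ((b + 1 : ℕ) : ℤ) = -2 + ((a : ℤ) - b) := by omega
        rw [h, zpow_add]
        simp only [Units.val_mul, Units.val_zpow_eq_zpow_val, val_vQ]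
        rw [show qv ^ (-2 : ℤ) = (qv ^ 2)⁻¹ by rw [zpow_neg]; rfl]
        ring
      · simp)
    (by
      have hEF : genRepGen .E * genRepGen .F = wshift (fun p => qInt p.1 * qInt (p.2 + 1)) id := by
        rw [genRepGen, genRepGen, wshift_mul]
        refine wshift_congr fun p => ?_
        rcases p with ⟨a, b⟩
        rcases a with - | a
        · simp [lowerCoeff, qInt_zero]
        · simp [lowerCoeff, raiseCoeff, lower, raise, qbin_vQ_one, mul_comm]
      have hFE : genRepGen .F * genRepGen .E = wshift (fun p => qInt p.2 * qInt (p.1 + 1)) id := by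
        rw [genRepGen, genRepGen, wshift_mul]
        refine wshift_congr fun p => ?_
        rcases p with ⟨a, b⟩
        rcases b with - | b
        · simp [raiseCoeff, qInt_zero]
        · simp [lowerCoeff, raiseCoeff, lower, raise, qbin_vQ_one, mul_comm]
      rw [hEF, hFE, wshift_sub, genRepGen, genRepGen, wshift_sub, smul_wshift]
      refine wshift_congr fun p => ⟨?_, fun _ => rfl⟩
      rw [qInt_mul_sub, weightCoeff, ← zpow_neg]
      simp only [Units.val_zpow_eq_zpow_val, val_vQ])

theorem genRep_gen (g : Gen) : genRep (Uq.gen QV qv g) = genRepGen g := Uq.lift_gen _ _ _ _ _ _ _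

/-- Divided powers are determined by their recursion, because [n+1] is invertible over ℚ(v). -/
theorem dp_eq_of_mul {B : Type*} [Ring B] [Algebra QV B] {x : B} {y : ℕ → B} (h0 : y 0 = 1)
    (h : ∀ n, x * y n = qInt (n + 1) • y (n + 1)) (n : ℕ) : dp x n = y n := by
  induction n with
  | zero => rw [dp_zero, h0]
  | succ n ih =>
    have hn := qInt_ne_zero (Nat.succ_ne_zero n)
    have h1 : qInt (n + 1) • dp x (n + 1) = qInt (n + 1) • y (n + 1) := by
      rw [← mul_dp, ih, h]
    simpa [smul_smul, inv_mul_cancel₀ hn] using congrArg ((qInt (n + 1))⁻¹ • ·) h1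

theorem qbin_vQ_mul_one (a n : ℕ) :
    qbin vQ (a + n) n * qbin vQ (a + n + 1) 1 = qInt (n + 1) * qbin vQ (a + n + 1) (n + 1) := by
  have h := qbin_absorb vQ (a + n) n
  have h1 := qs_vQ_ne_zero one_ne_zero
  rw [qbin_vQ_one, qInt_eq, qInt_eq]
  push_cast at h ⊢
  field_simp
  linear_combination -h

theorem genRep_dp_gE (n : ℕ) : genRep (dp gE n) = wshift (raiseCoeff vQ n) (raise n) := by
  have hg : genRep (dp gE n) = dp (genRepGen .E) n := by
    rw [dp, map_smul, map_pow, gE, genRep_gen]; rfl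
  rw [hg]
  refine dp_eq_of_mul (y := fun n => wshift (raiseCoeff vQ n) (raise n)) ?_ (fun n => ?_) n
  · rw [← wshift_id]
    exact wshift_congr fun p => ⟨by simp [raiseCoeff], fun _ => rfl⟩
  · rw [genRepGen, wshift_mul, smul_wshift]
    refine wshift_congr fun p => ?_
    rcases p with ⟨a, b⟩
    change raiseCoeff vQ n (a, b) * raiseCoeff vQ 1 (a + n, b - n) = qInt (n + 1) * raiseCoeff vQ (n + 1) (a, b) ∧
      (_ → (a + n + 1, b - n - 1) = (a + (n + 1), b - (n + 1)))
    rcases Nat.lt_or_ge n b with h | h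
    · rw [raiseCoeff_of_le _ h.le, raiseCoeff_of_le _ (Nat.succ_le_of_lt h),
        raiseCoeff_of_le _ (Nat.sub_pos_of_lt h), qbin_vQ_mul_one]
      exact ⟨rfl, fun _ => by ext <;> dsimp only <;> omega⟩
    · refine ⟨?_, fun _ => by ext <;> dsimp only <;> omega⟩
      rw [raiseCoeff_of_lt _ (Nat.lt_succ_of_le h), mul_zero, raiseCoeff_of_lt _ (n := 1) (by omega), mul_zero]

theorem genRep_dp_gF (n : ℕ) : genRep (dp gF n) = wshift (lowerCoeff vQ n) (lower n) := by
  have hg : genRep (dp gF n) = dp (genRepGen .F) n := by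
    rw [dp, map_smul, map_pow, gF, genRep_gen]; rfl
  rw [hg]
  refine dp_eq_of_mul (y := fun n => wshift (lowerCoeff vQ n) (lower n)) ?_ (fun n => ?_) n
  · rw [← wshift_id]
    exact wshift_congr fun p => ⟨by simp [lowerCoeff], fun _ => rfl⟩
  · rw [genRepGen, wshift_mul, smul_wshift]
    refine wshift_congr fun p => ?_
    rcases p with ⟨a, b⟩
    change lowerCoeff vQ n (a, b) * lowerCoeff vQ 1 (a - n, b + n) = qInt (n + 1) * lowerCoeff vQ (n + 1) (a, b) ∧
      (_ → (a - n - 1, b + n + 1) = (a - (n + 1), b + (n + 1)))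
    rcases Nat.lt_or_ge n a with h | h
    · rw [lowerCoeff_of_le _ h.le, lowerCoeff_of_le _ (Nat.succ_le_of_lt h),
        lowerCoeff_of_le _ (Nat.sub_pos_of_lt h), qbin_vQ_mul_one]
      exact ⟨rfl, fun _ => by ext <;> dsimp only <;> omega⟩
    · refine ⟨?_, fun _ => by ext <;> dsimp only <;> omega⟩
      rw [lowerCoeff_of_lt _ (Nat.lt_succ_of_le h), mul_zero, lowerCoeff_of_lt _ (n := 1) (by omega), mul_zero]

end GenericRep

/-! ### The representation of `U_ζ` on the `ℓ`-divisible part -/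

section SpecRep

variable (k : Type*) [Field k] (ζ : kˣ) (ℓ : ℕ)

/-- The inclusion of the lattice. -/
def latIncl : (ℕ × ℕ →₀ ZV) →+ (ℕ × ℕ →₀ QV) :=
  Finsupp.mapRange.addMonoidHom (algebraMap ZV QV).toAddMonoidHom

/-- The map `w ↦ ((a, b) ↦ w_{ℓa, ℓb}(ζ))` on the lattice. -/
def latSpec : (ℕ × ℕ →₀ ZV) →+ (ℕ × ℕ →₀ k) :=
  Finsupp.liftAddHom fun p => if ℓ ∣ p.1 ∧ ℓ ∣ p.2 then
    (Finsupp.singleAddHom (p.1 / ℓ, p.2 / ℓ)).comp (specHom k ζ).toAddMonoidHom else 0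

theorem latIncl_single (p : ℕ × ℕ) (s : ZV) :
    latIncl (Finsupp.single p s) = Finsupp.single p (algebraMap ZV QV s) := by
  simp [latIncl]

theorem latIncl_injective : Function.Injective latIncl :=
  Finsupp.mapRange_injective _ (map_zero _) algebraMap_injective

variable {ℓ}

theorem latSpec_single_mul (hℓ : 0 < ℓ) (a b : ℕ) (s : ZV) :
    latSpec k ζ ℓ (Finsupp.single (ℓ * a, ℓ * b) s) = Finsupp.single (a, b) (specHom k ζ s) := by
  rw [latSpec, Finsupp.liftAddHom_apply_single,
    if_pos ⟨Dvd.intro _ rfl, Dvd.intro _ rfl⟩]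
  simp [Nat.mul_div_cancel_left _ hℓ]

theorem latSpec_single_of_not (p : ℕ × ℕ) (hp : ¬ (ℓ ∣ p.1 ∧ ℓ ∣ p.2)) (s : ZV) :
    latSpec k ζ ℓ (Finsupp.single p s) = 0 := by
  rw [latSpec, Finsupp.liftAddHom_apply_single, if_neg hp]; rfl

variable (ℓ) in
/-- The pairs of endomorphisms that are compatible on the lattice. -/
def latRel : Subring (Module.End QV (ℕ × ℕ →₀ QV) × Module.End k (ℕ × ℕ →₀ k)) where
  carrier := {q | ∀ w, ∃ w', q.1 (latIncl w) = latIncl w' ∧ latSpec k ζ ℓ w' = q.2 (latSpec k ζ ℓ w)}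
  mul_mem' := fun {q r} hq hr w => by
    obtain ⟨w', h1, h2⟩ := hr w
    obtain ⟨w'', h3, h4⟩ := hq w'
    exact ⟨w'', by rw [← h3, ← h1]; rfl, by rw [h4, h2]; rfl⟩
  one_mem' := fun w => ⟨w, rfl, rfl⟩
  add_mem' := fun {q r} hq hr w => by
    obtain ⟨w', h1, h2⟩ := hr w
    obtain ⟨w'', h3, h4⟩ := hq w
    exact ⟨w'' + w', by rw [map_add, ← h3, ← h1]; rfl, by rw [map_add, h4, h2]; rfl⟩
  zero_mem' := fun w => ⟨0, by simp, by simp⟩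
  neg_mem' := fun {q} hq w => by
    obtain ⟨w', h1, h2⟩ := hq w
    exact ⟨-w', by rw [map_neg, ← h1]; rfl, by rw [map_neg, h2]; rfl⟩

/-- Specialization at the ℓ-divisible indices reaches every basis vector of the target, so an
operator that is zero upstairs induces only zero. -/
theorem latRel_functional (hℓ : 0 < ℓ) (T : Module.End k (ℕ × ℕ →₀ k))
    (hT : ((0 : Module.End QV (ℕ × ℕ →₀ QV)), T) ∈ latRel k ζ ℓ) : T = 0 := by
  refine end_ext_single fun p => ?_
  obtain ⟨w', h1, h2⟩ := hT (Finsupp.single (ℓ * p.1, ℓ * p.2) 1)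
  have h3 : w' = 0 := latIncl_injective (by rw [← h1, map_zero]; rfl)
  rw [h3, map_zero, latSpec_single_mul k ζ hℓ, map_one] at h2
  exact h2.symm

theorem mem_latRel {A : Module.End QV (ℕ × ℕ →₀ QV)} {T : Module.End k (ℕ × ℕ →₀ k)}
    (h : ∀ p s, ∃ w', A (Finsupp.single p (algebraMap ZV QV s)) = latIncl w' ∧
      latSpec k ζ ℓ w' = T (latSpec k ζ ℓ (Finsupp.single p s))) : (A, T) ∈ latRel k ζ ℓ := by
  intro w
  induction w using Finsupp.induction_linear with
  | zero => exact ⟨0, by simp, by simp⟩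
  | add w w' hw hw' =>
    obtain ⟨u, h1, h2⟩ := hw
    obtain ⟨u', h3, h4⟩ := hw'
    exact ⟨u + u', by rw [map_add, map_add, map_add, h1, h3], by
      rw [map_add, map_add, map_add, h2, h4]⟩
  | single p s => rw [latIncl_single]; exact h p s

/-- `h1` gives the induced map on vectors with ℓ-divisible indices. `h2` says that the remaining
vectors, which `latSpec` kills, never return to ℓ-divisible indices with a coefficient that is
nonzero at ζ; thus they span a submodule. -/
theorem wshift_mem_latRel (hℓ : 0 < ℓ) {c : ℕ × ℕ → QV} (c₀ : ℕ × ℕ → ZV) {d : ℕ × ℕ → k}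
    {σ τ : ℕ × ℕ → ℕ × ℕ} (hc : ∀ p, algebraMap ZV QV (c₀ p) = c p)
    (h1 : ∀ a b s, latSpec k ζ ℓ (Finsupp.single (σ (ℓ * a, ℓ * b)) (s * c₀ (ℓ * a, ℓ * b))) =
      Finsupp.single (τ (a, b)) (specHom k ζ s * d (a, b)))
    (h2 : ∀ p, ¬ (ℓ ∣ p.1 ∧ ℓ ∣ p.2) → ∀ a b, σ p = (ℓ * a, ℓ * b) → specHom k ζ (c₀ p) = 0) :
    (wshift c σ, wshift d τ) ∈ latRel k ζ ℓ := by
  refine mem_latRel k ζ fun p s => ⟨Finsupp.single (σ p) (s * c₀ p), ?_, ?_⟩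
  · rw [wshift_single, latIncl_single, map_mul, hc]
  · by_cases hp : ℓ ∣ p.1 ∧ ℓ ∣ p.2
    · obtain ⟨⟨a, ha⟩, ⟨b, hb⟩⟩ := hp
      rw [show p = (ℓ * a, ℓ * b) from Prod.ext ha hb, latSpec_single_mul k ζ hℓ, wshift_single, h1]
    · rw [latSpec_single_of_not k ζ p hp, map_zero]
      by_cases hq : ℓ ∣ (σ p).1 ∧ ℓ ∣ (σ p).2
      · obtain ⟨⟨a, ha⟩, ⟨b, hb⟩⟩ := hq
        rw [show σ p = (ℓ * a, ℓ * b) from Prod.ext ha hb, latSpec_single_mul k ζ hℓ, map_mul,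
          h2 p hp a b (Prod.ext ha hb), mul_zero, Finsupp.single_zero]
      · exact latSpec_single_of_not k ζ _ hq _

/-- A shift by a multiple of ℓ preserves divisibility of indices in both directions, and the
coefficients become ordinary binomials by `qbin_mul_root`. -/
theorem raise_mem_latRel (hodd : Odd ℓ) (hζ : IsPrimitiveRoot ζ ℓ) (m : ℕ) :
    (wshift (raiseCoeff vQ (ℓ * m)) (raise (ℓ * m)),
      wshift (fun p => if m ≤ p.2 then ((p.1 + m).choose m : k) else 0) (raise m)) ∈
      latRel k ζ ℓ := by
  have hℓ := hodd.pos
  refine wshift_mem_latRel k ζ hℓ (raiseCoeff vZ (ℓ * m)) (fun p => ?_) (fun a b s => ?_)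
    fun p hp a b hq => ?_
  · rw [raiseCoeff, raiseCoeff, apply_ite (algebraMap ZV QV), algebraMap_qbin, map_zero]
  · have h : raise (ℓ * m) (ℓ * a, ℓ * b) = (ℓ * (raise m (a, b)).1, ℓ * (raise m (a, b)).2) := by
      simp only [raise, Nat.mul_sub, mul_add]
    rw [h, latSpec_single_mul k ζ hℓ, raiseCoeff, map_mul]
    congr 2
    by_cases hb : m ≤ b
    · rw [if_pos hb, if_pos (Nat.mul_le_mul_left ℓ hb), specHom_qbin, ← mul_add, qbin_mul_root hζ hodd]
    · rw [if_neg hb, if_neg (fun h => hb (Nat.le_of_mul_le_mul_left h hℓ)), map_zero]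
  · rw [raiseCoeff]
    split_ifs with h
    · have h1 : p.1 + ℓ * m = ℓ * a := congrArg (fun q => q.1) hq
      have h2 : p.2 - ℓ * m = ℓ * b := congrArg (fun q => q.2) hq
      have h3 : ℓ ∣ p.1 := (Nat.dvd_add_left (Dvd.intro m rfl)).mp ⟨_, h1⟩
      have h4 : ℓ ∣ p.2 := ⟨b + m, by rw [mul_add]; omega⟩
      exact absurd ⟨h3, h4⟩ hp
    · exact map_zero _

/-- If ℓ does not divide n, an ℓ-divisible index is moved off the multiples of ℓ. Moves in the other
direction have a coefficient with upper index divisible by ℓ and lower index not, which vanishes at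
ζ. -/
theorem raise_mem_latRel_of_not_dvd (hodd : Odd ℓ) (hζ : IsPrimitiveRoot ζ ℓ) {n : ℕ}
    (hn : ¬ ℓ ∣ n) : (wshift (raiseCoeff vQ n) (raise n), 0) ∈ latRel k ζ ℓ := by
  have hℓ := hodd.pos
  rw [← wshift_zero id]
  refine wshift_mem_latRel k ζ hℓ (raiseCoeff vZ n) (fun p => ?_) (fun a b s => ?_)
    fun p hp a b hq => ?_
  · rw [raiseCoeff, raiseCoeff, apply_ite (algebraMap ZV QV), algebraMap_qbin, map_zero]
  · rw [mul_zero, Finsupp.single_zero, latSpec_single_of_not]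
    exact fun h => hn ((Nat.dvd_add_right (Dvd.intro a rfl)).mp h.1)
  · rw [raiseCoeff]
    split_ifs with h
    · rw [specHom_qbin, show p.1 + n = ℓ * a from congrArg (fun q => q.1) hq,
        qbin_mul_root_of_not_dvd hζ hodd a hn]
    · exact map_zero _

theorem lower_mem_latRel (hodd : Odd ℓ) (hζ : IsPrimitiveRoot ζ ℓ) (m : ℕ) :
    (wshift (lowerCoeff vQ (ℓ * m)) (lower (ℓ * m)),
      wshift (fun p => if m ≤ p.1 then ((p.2 + m).choose m : k) else 0) (lower m)) ∈
      latRel k ζ ℓ := by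
  have hℓ := hodd.pos
  refine wshift_mem_latRel k ζ hℓ (lowerCoeff vZ (ℓ * m)) (fun p => ?_) (fun a b s => ?_)
    fun p hp a b hq => ?_
  · rw [lowerCoeff, lowerCoeff, apply_ite (algebraMap ZV QV), algebraMap_qbin, map_zero]
  · have h : lower (ℓ * m) (ℓ * a, ℓ * b) = (ℓ * (lower m (a, b)).1, ℓ * (lower m (a, b)).2) := by
      simp only [lower, Nat.mul_sub, mul_add]
    rw [h, latSpec_single_mul k ζ hℓ, lowerCoeff, map_mul]
    congr 2
    by_cases hb : m ≤ a
    · rw [if_pos hb, if_pos (Nat.mul_le_mul_left ℓ hb), specHom_qbin, ← mul_add, qbin_mul_root hζ hodd]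
    · rw [if_neg hb, if_neg (fun h => hb (Nat.le_of_mul_le_mul_left h hℓ)), map_zero]
  · rw [lowerCoeff]
    split_ifs with h
    · have h2 : p.2 + ℓ * m = ℓ * b := congrArg (fun q => q.2) hq
      have h1 : p.1 - ℓ * m = ℓ * a := congrArg (fun q => q.1) hq
      have h3 : ℓ ∣ p.2 := (Nat.dvd_add_left (Dvd.intro m rfl)).mp ⟨_, h2⟩
      have h4 : ℓ ∣ p.1 := ⟨a + m, by rw [mul_add]; omega⟩
      exact absurd ⟨h4, h3⟩ hp
    · exact map_zero _

theorem lower_mem_latRel_of_not_dvd (hodd : Odd ℓ) (hζ : IsPrimitiveRoot ζ ℓ) {n : ℕ}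
    (hn : ¬ ℓ ∣ n) : (wshift (lowerCoeff vQ n) (lower n), 0) ∈ latRel k ζ ℓ := by
  have hℓ := hodd.pos
  rw [← wshift_zero id]
  refine wshift_mem_latRel k ζ hℓ (lowerCoeff vZ n) (fun p => ?_) (fun a b s => ?_)
    fun p hp a b hq => ?_
  · rw [lowerCoeff, lowerCoeff, apply_ite (algebraMap ZV QV), algebraMap_qbin, map_zero]
  · rw [mul_zero, Finsupp.single_zero, latSpec_single_of_not]
    exact fun h => hn ((Nat.dvd_add_right (Dvd.intro b rfl)).mp h.2)
  · rw [lowerCoeff]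
    split_ifs with h
    · rw [specHom_qbin, show p.2 + n = ℓ * b from congrArg (fun q => q.2) hq,
        qbin_mul_root_of_not_dvd hζ hodd b hn]
    · exact map_zero _

/-- Weights at ℓ-divisible indices are multiples of ℓ, so the eigenvalues specialize to 1. The
exponents s = 1 and s = -1 cover K and K⁻¹. -/
theorem weight_mem_latRel (hodd : Odd ℓ) (hζ : IsPrimitiveRoot ζ ℓ) (s : ℤ) :
    (wshift (fun p => ((weightCoeff vQ p ^ s : QVˣ) : QV)) id, 1) ∈ latRel k ζ ℓ := by
  have hℓ := hodd.pos
  rw [← wshift_id]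
  refine wshift_mem_latRel k ζ hℓ (fun p => ((weightCoeff vZ p ^ s : ZVˣ) : ZV)) (fun p => ?_)
    (fun a b r => ?_) fun p hp a b hq => absurd ?_ hp
  · rw [weightCoeff, weightCoeff, ← zpow_mul, ← zpow_mul, algebraMap_vZ_zpow,
      Units.val_zpow_eq_zpow_val, val_vQ]
  · rw [id, latSpec_single_mul k ζ hℓ, map_mul, weightCoeff, ← zpow_mul, specHom_vZ_zpow]
    have h : (((ℓ * a : ℕ) : ℤ) - ((ℓ * b : ℕ) : ℤ)) * s = 0 + ℓ * ((a - b) * s) := by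
      push_cast; ring
    rw [h, ← Units.val_zpow_eq_zpow_val, unit_zpow_add hζ]
    simp
  · exact ⟨⟨a, congrArg Prod.fst hq⟩, ⟨b, congrArg Prod.snd hq⟩⟩

/-- The representation of `U_ζ` that is obtained from `genRep`. -/
theorem exists_specRep (hodd : Odd ℓ) (hζ : IsPrimitiveRoot ζ ℓ) :
    ∃ τ : UZeta k ζ ℓ →ₐ[k] Module.End k (ℕ × ℕ →₀ k), τ (UZeta.K k ζ ℓ) = 1 ∧
      (∀ n, ¬ ℓ ∣ n → τ (UZeta.E k ζ ℓ n) = 0) ∧ (∀ n, ¬ ℓ ∣ n → τ (UZeta.F k ζ ℓ n) = 0) ∧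
      (∀ m, τ (UZeta.E k ζ ℓ (ℓ * m)) =
        wshift (fun p => if m ≤ p.2 then ((p.1 + m).choose m : k) else 0) (raise m)) ∧
      (∀ m, τ (UZeta.F k ζ ℓ (ℓ * m)) =
        wshift (fun p => if m ≤ p.1 then ((p.2 + m).choose m : k) else 0) (lower m)) := by
  have hℓ := hodd.pos
  have h0 := latRel_functional k ζ hℓ
  have huniq : ∀ a d d', (a, d) ∈ latRel k ζ ℓ → (a, d') ∈ latRel k ζ ℓ → d = d' :=
    fun a d d' h h' => by
      have := (latRel k ζ ℓ).sub_mem h h'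
      rw [Prod.mk_sub_mk, sub_self] at this
      exact sub_eq_zero.mp (h0 _ this)
  have hK : (genRep (intK : UGen), 1) ∈ latRel k ζ ℓ := by
    have := weight_mem_latRel k ζ hodd hζ 1
    simp only [zpow_one] at this
    rwa [UZeta.coe_intK, genRep_gen, genRepGen]
  have hKi : (genRep (intKinv : UGen), 1) ∈ latRel k ζ ℓ := by
    have := weight_mem_latRel k ζ hodd hζ (-1)
    simp only [zpow_neg_one] at this
    rwa [UZeta.coe_intKinv, genRep_gen, genRepGen]
  have hE : ∀ m, (genRep (intE (ℓ * m) : UGen), _) ∈ latRel k ζ ℓ := fun m => by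
    rw [UZeta.coe_intE, genRep_dp_gE]; exact raise_mem_latRel k ζ hodd hζ m
  have hF : ∀ m, (genRep (intF (ℓ * m) : UGen), _) ∈ latRel k ζ ℓ := fun m => by
    rw [UZeta.coe_intF, genRep_dp_gF]; exact lower_mem_latRel k ζ hodd hζ m
  have hE' : ∀ n, ¬ ℓ ∣ n → (genRep (intE n : UGen), 0) ∈ latRel k ζ ℓ := fun n hn => by
    rw [UZeta.coe_intE, genRep_dp_gE]; exact raise_mem_latRel_of_not_dvd k ζ hodd hζ hn
  have hF' : ∀ n, ¬ ℓ ∣ n → (genRep (intF n : UGen), 0) ∈ latRel k ζ ℓ := fun n hn => by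
    rw [UZeta.coe_intF, genRep_dp_gF]; exact lower_mem_latRel_of_not_dvd k ζ hodd hζ hn
  obtain ⟨τ, hτ⟩ := UZeta.exists_lift_of_rel (k := k) (ζ := ζ) (ℓ := ℓ) genRep.toRingHom
    (latRel k ζ ℓ) h0
    (fun c => by
      change (genRep (algebraMap ZV UGen c), _) ∈ _
      rw [IsScalarTower.algebraMap_apply ZV QV UGen, AlgHom.commutes]
      refine mem_latRel k ζ fun p s => ⟨Finsupp.single p (c * s), ?_, ?_⟩
      · rw [Module.algebraMap_end_apply, Finsupp.smul_single, latIncl_single, map_mul, smul_eq_mul]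
      · rw [Module.algebraMap_end_apply]
        by_cases hp : ℓ ∣ p.1 ∧ ℓ ∣ p.2
        · obtain ⟨⟨a, ha⟩, ⟨b, hb⟩⟩ := hp
          rw [show p = (ℓ * a, ℓ * b) from Prod.ext ha hb, latSpec_single_mul k ζ hℓ,
            latSpec_single_mul k ζ hℓ, Finsupp.smul_single, map_mul, smul_eq_mul]
        · rw [latSpec_single_of_not k ζ p hp, latSpec_single_of_not k ζ p hp, smul_zero])
    1 hK (one_pow _) ⟨_, hKi⟩
    (fun n => by
      by_cases hn : ℓ ∣ n
      · obtain ⟨m, rfl⟩ := hn; exact ⟨_, hE m⟩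
      · exact ⟨_, hE' n hn⟩)
    (fun n => by
      by_cases hn : ℓ ∣ n
      · obtain ⟨m, rfl⟩ := hn; exact ⟨_, hF m⟩
      · exact ⟨_, hF' n hn⟩)
  exact ⟨τ, huniq _ _ _ (hτ _) hK, fun n hn => huniq _ _ _ (hτ _) (hE' n hn),
    fun n hn => huniq _ _ _ (hτ _) (hF' n hn), fun m => huniq _ _ _ (hτ _) (hE m),
    fun m => huniq _ _ _ (hτ _) (hF m)⟩

end SpecRep

/-! ### A faithful representation of `U(sl₂)` -/

section SlRep

variable (k : Type*) [Field k]

/-- The action of `e` on the polynomials in two variables, in a basis of divided monomials. -/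
def slRaise : Module.End k (ℕ × ℕ →₀ k) :=
  wshift (fun p => if 1 ≤ p.2 then ((p.1 + 1 : ℕ) : k) else 0) (raise 1)

/-- The action of `f` on the polynomials in two variables, in a basis of divided monomials. -/
def slLower : Module.End k (ℕ × ℕ →₀ k) :=
  wshift (fun p => if 1 ≤ p.1 then ((p.2 + 1 : ℕ) : k) else 0) (lower 1)

variable {k}

theorem slRaise_zero (a : ℕ) (s : k) : slRaise k (Finsupp.single (a, 0) s) = 0 := by
  rw [slRaise, wshift_single]; simp

theorem slLower_zero (b : ℕ) (s : k) : slLower k (Finsupp.single (0, b) s) = 0 := by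
  rw [slLower, wshift_single]; simp

theorem slRaise_succ (a b : ℕ) (s : k) : slRaise k (Finsupp.single (a, b + 1) s) =
    Finsupp.single (a + 1, b) (s * (a + 1 : ℕ)) := by
  rw [slRaise, wshift_single]; simp [raise]

theorem slLower_succ (a b : ℕ) (s : k) : slLower k (Finsupp.single (a + 1, b) s) =
    Finsupp.single (a, b + 1) (s * (b + 1 : ℕ)) := by
  rw [slLower, wshift_single]; simp [lower]

variable (k) in
/-- The action of `h`. -/
def slWeight : Module.End k (ℕ × ℕ →₀ k) := wshift (fun p => (p.1 : k) - p.2) id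

theorem slWeight_single (a b : ℕ) (s : k) : slWeight k (Finsupp.single (a, b) s) =
    Finsupp.single (a, b) (s * ((a : k) - b)) := by
  rw [slWeight, wshift_single]; rfl

theorem slRaise_mul_slLower :
    slRaise k * slLower k - slLower k * slRaise k = slWeight k := by
  refine end_ext_single fun p => ?_
  rcases p with ⟨a, b⟩
  rw [LinearMap.sub_apply, Module.End.mul_apply, Module.End.mul_apply, slWeight_single]
  rcases a with - | a <;> rcases b with - | b
  · simp [slRaise_zero, slLower_zero]
  all_goals
    simp only [slRaise_zero, slRaise_succ, slLower_zero, slLower_succ, map_zero,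
      ← Finsupp.single_sub, ← Finsupp.single_neg, zero_sub, sub_zero]
    congr 1
    push_cast
    ring

variable (k) in
/-- The action of `U(sl₂)` on the polynomials in two variables. -/
def slRep : USl2 k →ₐ[k] Module.End k (ℕ × ℕ →₀ k) :=
  slHom (slRaise k) (slLower k)
    (by
      rw [slRaise_mul_slLower]
      refine end_ext_single fun p => ?_
      rcases p with ⟨a, b⟩
      rw [LinearMap.sub_apply, Module.End.mul_apply, Module.End.mul_apply, slWeight_single,
        LinearMap.smul_apply]
      rcases b with - | b <;>
        simp only [slRaise_zero, slRaise_succ, slWeight_single, map_zero, smul_zero, sub_zero,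
          ← Finsupp.single_sub, Finsupp.smul_single]
      congr 1; push_cast; simp only [smul_eq_mul]; ring)
    (by
      rw [slRaise_mul_slLower]
      refine end_ext_single fun p => ?_
      rcases p with ⟨a, b⟩
      rw [LinearMap.sub_apply, Module.End.mul_apply, Module.End.mul_apply, slWeight_single,
        LinearMap.neg_apply, LinearMap.smul_apply]
      rcases a with - | a <;>
        simp only [slLower_zero, slLower_succ, slWeight_single, map_zero, smul_zero, sub_zero,
          ← Finsupp.single_sub, Finsupp.smul_single, neg_zero, ← Finsupp.single_neg]
      congr 1; push_cast; simp only [smul_eq_mul]; ring)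

theorem slRep_e : slRep k (e k) = slRaise k := slHom_e _ _ _ _

theorem slRep_f : slRep k (f k) = slLower k := slHom_f _ _ _ _

theorem slRep_hSl : slRep k (hSl k) = slWeight k := by
  rw [hSl, map_sub, map_mul, map_mul, slRep_e, slRep_f, slRaise_mul_slLower]

theorem slRaise_pow_eq_zero {b c : ℕ} (h : b < c) (a : ℕ) (s : k) :
    (slRaise k ^ c) (Finsupp.single (a, b) s) = 0 := by
  induction c generalizing a b s with
  | zero => omega
  | succ c ih =>
    rw [pow_succ, Module.End.mul_apply]
    rcases b with - | b
    · rw [slRaise_zero, map_zero]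
    · rw [slRaise_succ]; exact ih (by omega) _ _

theorem slRaise_pow (a b : ℕ) (s : k) : (slRaise k ^ b) (Finsupp.single (a, b) s) =
    Finsupp.single (a + b, 0) (s * ((a + 1).ascFactorial b : ℕ)) := by
  induction b generalizing a s with
  | zero => simp
  | succ b ih =>
    rw [pow_succ, Module.End.mul_apply, slRaise_succ, ih, mul_assoc, ← Nat.cast_mul,
      show a + 1 + b = a + (b + 1) by ring, Nat.ascFactorial_succ, ← Nat.succ_ascFactorial]

theorem slLower_pow (a N : ℕ) (s : k) : (slLower k ^ a) (Finsupp.single (N, 0) s) =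
    if a ≤ N then Finsupp.single (N - a, a) (s * (a.factorial : ℕ)) else 0 := by
  induction a with
  | zero => simp
  | succ a ih =>
    rw [pow_succ', Module.End.mul_apply, ih]
    split_ifs with h1 h2 h2
    · obtain ⟨d, rfl⟩ := Nat.exists_eq_add_of_le h2
      rw [show a + 1 + d - a = d + 1 by omega, slLower_succ, show a + 1 + d - (a + 1) = d by omega,
        mul_assoc, ← Nat.cast_mul, Nat.factorial_succ, mul_comm (a + 1)]
    · rw [show N - a = 0 by omega, slLower_zero]
    · omega
    · rw [map_zero]

open Polynomial in
theorem aeval_slWeight (p : k[X]) (a b : ℕ) (s : k) :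
    aeval (slWeight k) p (Finsupp.single (a, b) s) =
      Finsupp.single (a, b) (s * p.eval ((a : k) - b)) := by
  induction p using Polynomial.induction_on' with
  | add p q hp hq => rw [map_add, LinearMap.add_apply, hp, hq, eval_add, mul_add, Finsupp.single_add]
  | monomial n c =>
    rw [aeval_monomial, eval_monomial, Module.End.mul_apply, Module.algebraMap_end_apply]
    have : (slWeight k ^ n) (Finsupp.single (a, b) s) =
        Finsupp.single (a, b) (s * ((a : k) - b) ^ n) := by
      induction n with
      | zero => simp
      | succ n ih =>
        rw [pow_succ', Module.End.mul_apply, ih, slWeight_single, pow_succ, mul_assoc]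
    rw [this, Finsupp.smul_single, smul_eq_mul]
    congr 1; ring

-- A nonzero combination of f^a p(h) e^c is detected on monomials: e^c kills vectors whose second
-- index is below c, h then acts by evaluating p, and different powers of f end at different
-- indices. Letting the vector vary gives p infinitely many roots in characteristic zero.
open Polynomial in
theorem slRep_injective [CharZero k] : Function.Injective (slRep k) := by
  rw [injective_iff_map_eq_zero]
  intro u hu
  obtain ⟨P, rfl⟩ := triangular_surjective u
  by_contra hne
  have hP : P.support.Nonempty := by
    rw [Finsupp.support_nonempty_iff]
    rintro rfl
    exact hne (map_zero _)
  -- The least power c₀ of e is chosen, so that on a vector with second index c₀ all terms with a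
  -- larger power vanish.
  obtain ⟨⟨a₀, c₀⟩, hq, hmin⟩ := P.support.exists_min_image Prod.snd hP
  refine Finsupp.mem_support_iff.mp hq ?_
  have key : ∀ M : ℕ, (P (a₀, c₀)).eval ((M + a₀ + c₀ : ℕ) : k) = 0 := by
    intro M
    -- Starting at (M + a₀, c₀), e^c₀ leads to (M + a₀ + c₀, 0), and f^a₀ then leads to (M + c₀,
    -- a₀). The summand a₀ in the start guarantees that f^a₀ does not kill the vector, and reading
    -- this coordinate isolates a = a₀.
    let L : USl2 k →ₗ[k] k := Finsupp.lapply (M + c₀, a₀) ∘ₗ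
      LinearMap.applyₗ (Finsupp.single (M + a₀, c₀) 1) ∘ₗ (slRep k).toLinearMap
    have hL : ∀ a c (p : k[X]), L (triangular k (Finsupp.single (a, c) p)) =
        ((slLower k ^ a) ((aeval (slWeight k) p) ((slRaise k ^ c)
          (Finsupp.single (M + a₀, c₀) 1)))) (M + c₀, a₀) := fun a c p => by
      change (slRep k _ _) _ = _
      rw [triangular_single, map_mul, map_mul, map_pow, map_pow, ← Polynomial.aeval_algHom_apply,
        slRep_e, slRep_f, slRep_hSl]
      rfl
    have h1 : ∀ q ∈ P.support, q ≠ (a₀, c₀) → L (triangular k (Finsupp.single q (P q))) = 0 := by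
      rintro ⟨a, c⟩ hq' hne'
      rw [hL]
      rcases (hmin _ hq').lt_or_eq with hlt | heq
      · rw [slRaise_pow_eq_zero hlt, map_zero, map_zero]; rfl
      · obtain rfl : c₀ = c := heq
        rw [slRaise_pow, aeval_slWeight, slLower_pow]
        split_ifs
        · refine Finsupp.single_eq_of_ne ?_
          intro h
          have h' : a₀ = a := congrArg Prod.snd h
          exact hne' (by rw [h'])
        · rfl
    have h2 : L (triangular k P) = L (triangular k (Finsupp.single (a₀, c₀) (P (a₀, c₀)))) := by
      conv_lhs => rw [← Finsupp.sum_single P, Finsupp.sum, map_sum, map_sum]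
      exact Finset.sum_eq_single_of_mem _ hq h1
    have h3 : L (triangular k P) = 0 := by
      change (slRep k _ _) _ = _
      rw [hu]; rfl
    rw [h3, hL, slRaise_pow, aeval_slWeight, slLower_pow, if_pos (by omega),
      show M + a₀ + c₀ - a₀ = M + c₀ by omega, Finsupp.single_eq_same] at h2
    have h4 := Nat.factorial_ne_zero a₀
    have h5 : (M + a₀ + 1).ascFactorial c₀ ≠ 0 := (Nat.ascFactorial_pos _ _).ne'
    simpa [h4, h5] using h2.symm
  refine Polynomial.eq_zero_of_infinite_isRoot _ (Set.Infinite.mono (s := Set.range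
    fun M : ℕ => ((M + a₀ + c₀ : ℕ) : k)) ?_ (Set.infinite_range_of_injective ?_))
  · rintro _ ⟨M, rfl⟩; exact key M
  · intro M N h
    have := Nat.cast_injective (R := k) h
    omega

end SlRep

/-! ### The Frobenius map -/

section Frobenius

variable {k : Type*} [Field k] [CharZero k] {ζ : kˣ} {ℓ : ℕ}

/-- On generators the representation of U_ζ takes values in the image of the faithful representation
of U(sl₂). Inverting the latter on its image gives Fr. -/
theorem exists_frobenius (hodd : Odd ℓ) (hℓ : 1 < ℓ) (hζ : IsPrimitiveRoot ζ ℓ) :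
    ∃ Fr : UZeta k ζ ℓ →ₐ[k] USl2 k, Fr (UZeta.K k ζ ℓ) = 1 ∧ Fr (UZeta.E k ζ ℓ ℓ) = e k ∧
      Fr (UZeta.F k ζ ℓ ℓ) = f k ∧ (∀ n, ¬ ℓ ∣ n → Fr (UZeta.E k ζ ℓ n) = 0) ∧
      (∀ n, ¬ ℓ ∣ n → Fr (UZeta.F k ζ ℓ n) = 0) := by
  obtain ⟨τ, τK, τE, τF, τEℓ, τFℓ⟩ := exists_specRep k ζ hodd hζ
  have τEℓ : τ (UZeta.E k ζ ℓ ℓ) = slRep k (e k) := by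
    have := τEℓ 1
    rw [mul_one] at this
    rw [this, slRep_e, slRaise]
    simp only [Nat.choose_one_right]
  have τFℓ : τ (UZeta.F k ζ ℓ ℓ) = slRep k (f k) := by
    have := τFℓ 1
    rw [mul_one] at this
    rw [this, slRep_f, slLower]
    simp only [Nat.choose_one_right]
  have hd : ¬ ℓ ∣ 1 := fun h => hℓ.ne' (Nat.dvd_one.mp h)
  have hrange : ∀ x, τ x ∈ (slRep k).range := fun x => by
    have : (slRep k).range.comap τ = ⊤ := by
      refine UZeta.subalgebra_eq_top hodd hζ _ ?_ ?_ ?_ ⟨_, τEℓ.symm⟩ ⟨_, τFℓ.symm⟩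
      · rw [Subalgebra.mem_comap, τK]; exact one_mem _
      · rw [Subalgebra.mem_comap, τE 1 hd]; exact zero_mem _
      · rw [Subalgebra.mem_comap, τF 1 hd]; exact zero_mem _
    have h : x ∈ (slRep k).range.comap τ := by rw [this]; trivial
    exact h
  let Fr : UZeta k ζ ℓ →ₐ[k] USl2 k :=
    (AlgEquiv.ofInjective (slRep k) slRep_injective).symm.toAlgHom.comp
      (τ.codRestrict (slRep k).range hrange)
  have hFr : ∀ x, slRep k (Fr x) = τ x := fun x =>
    congrArg Subtype.val ((AlgEquiv.ofInjective (slRep k) slRep_injective).apply_symm_apply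
      (τ.codRestrict (slRep k).range hrange x))
  refine ⟨Fr, slRep_injective ?_, slRep_injective ?_, slRep_injective ?_,
    fun n hn => slRep_injective ?_, fun n hn => slRep_injective ?_⟩
  · rw [hFr, τK, map_one]
  · rw [hFr, τEℓ]
  · rw [hFr, τFℓ]
  · rw [hFr, τE n hn, map_zero]
  · rw [hFr, τF n hn, map_zero]

end Frobenius

/-! ### Fr is a map of Hopf algebras, and its coaction -/

section FrobeniusHopf

variable {k : Type*} [Field k] {ζ : kˣ} {ℓ : ℕ}

/-- The values of a Hopf structure on the generators of `U_ζ`. -/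
structure HopfStr.HasStandardValues (𝓗 : HopfStr k (UZeta k ζ ℓ)) : Prop where
  comul_K : 𝓗.comul (UZeta.K k ζ ℓ) = UZeta.K k ζ ℓ ⊗ₜ UZeta.K k ζ ℓ
  comul_E : ∀ n, 𝓗.comul (UZeta.E k ζ ℓ n) = ∑ p ∈ Finset.HasAntidiagonal.antidiagonal n,
    ((ζ : k) ^ (p.1 * p.2) • (UZeta.E k ζ ℓ p.1 * UZeta.K k ζ ℓ ^ p.2)) ⊗ₜ[k] UZeta.E k ζ ℓ p.2
  comul_F : ∀ n, 𝓗.comul (UZeta.F k ζ ℓ n) = ∑ p ∈ Finset.HasAntidiagonal.antidiagonal n,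
    UZeta.F k ζ ℓ p.2 ⊗ₜ[k]
      ((ζ : k) ^ (p.1 * p.2) • (UZeta.F k ζ ℓ p.1 * UZeta.Kinv k ζ ℓ ^ p.2))
  counit_K : 𝓗.counit (UZeta.K k ζ ℓ) = 1
  counit_E : ∀ n, 𝓗.counit (UZeta.E k ζ ℓ n) = if n = 0 then 1 else 0
  counit_F : ∀ n, 𝓗.counit (UZeta.F k ζ ℓ n) = if n = 0 then 1 else 0
  antipode_mul : ∀ a b, 𝓗.antipode (a * b) = 𝓗.antipode b * 𝓗.antipode a
  antipode_one : 𝓗.antipode 1 = 1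
  antipode_K : 𝓗.antipode (UZeta.K k ζ ℓ) = UZeta.Kinv k ζ ℓ
  antipode_E : ∀ n, 𝓗.antipode (UZeta.E k ζ ℓ n) =
    ((-1) ^ n * (ζ : k) ^ (n * (n - 1))) • (UZeta.Kinv k ζ ℓ ^ n * UZeta.E k ζ ℓ n)
  antipode_F : ∀ n, 𝓗.antipode (UZeta.F k ζ ℓ n) =
    ((-1) ^ n * ((ζ : k)⁻¹) ^ (n * (n - 1))) • (UZeta.F k ζ ℓ n * UZeta.K k ζ ℓ ^ n)

/-- The values of the Frobenius map on the generators of `U_ζ`. -/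
structure IsFrobeniusOnGenerators (Fr : UZeta k ζ ℓ →ₐ[k] USl2 k) : Prop where
  map_K : Fr (UZeta.K k ζ ℓ) = 1
  map_divE : Fr (UZeta.E k ζ ℓ ℓ) = e k
  map_divF : Fr (UZeta.F k ζ ℓ ℓ) = f k
  map_E : ∀ n, ¬ ℓ ∣ n → Fr (UZeta.E k ζ ℓ n) = 0
  map_F : ∀ n, ¬ ℓ ∣ n → Fr (UZeta.F k ζ ℓ n) = 0

theorem sum_antidiagonal_eq_add {M : Type*} [AddCommMonoid M] {n : ℕ} (hn : 0 < n) (g : ℕ × ℕ → M)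
    (h : ∀ a b, a + b = n → a ≠ 0 → b ≠ 0 → g (a, b) = 0) :
    ∑ p ∈ Finset.HasAntidiagonal.antidiagonal n, g p = g (0, n) + g (n, 0) := by
  have hne : ((0, n) : ℕ × ℕ) ≠ (n, 0) := fun h => hn.ne (congrArg Prod.fst h)
  rw [← Finset.sum_pair hne]
  refine (Finset.sum_subset (fun p hp => ?_) fun p hp hp' => ?_).symm
  · rw [Finset.HasAntidiagonal.mem_antidiagonal]
    simp only [Finset.mem_insert, Finset.mem_singleton] at hp
    rcases hp with rfl | rfl <;> simp
  · rcases p with ⟨a, b⟩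
    rw [Finset.HasAntidiagonal.mem_antidiagonal] at hp
    simp only [Finset.mem_insert, Finset.mem_singleton, Prod.mk.injEq, not_or] at hp'
    dsimp only at hp
    exact h a b hp (by omega) (by omega)

theorem envAntipodeLin_one : envAntipodeLin (1 : USl2 k) = 1 := by simp [envAntipodeLin]

theorem envAntipodeLin_e : envAntipodeLin (e k) = -e k := by
  have h : envAntipode k (SL2 k) (e k) = MulOpposite.op (-e k) := envAntipode_ι _
  change ((envAntipode k (SL2 k) (e k)).unop) = _
  rw [h]; rfl

theorem envAntipodeLin_f : envAntipodeLin (f k) = -f k := by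
  have h : envAntipode k (SL2 k) (f k) = MulOpposite.op (-f k) := envAntipode_ι _
  change ((envAntipode k (SL2 k) (f k)).unop) = _
  rw [h]; rfl

theorem envComul_e : envComul k (SL2 k) (e k) = e k ⊗ₜ 1 + 1 ⊗ₜ e k := envComul_ι _

theorem envComul_f : envComul k (SL2 k) (f k) = f k ⊗ₜ 1 + 1 ⊗ₜ f k := envComul_ι _

theorem envCounit_e : envCounit k (SL2 k) (e k) = 0 := envCounit_ι _

theorem envCounit_f : envCounit k (SL2 k) (f k) = 0 := envCounit_ι _

section Coaction

variable {𝓗 : HopfStr k (UZeta k ζ ℓ)} {Fr : UZeta k ζ ℓ →ₐ[k] USl2 k}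

theorem IsFrobeniusOnGenerators.map_Kinv (hFr : IsFrobeniusOnGenerators Fr) :
    Fr (UZeta.Kinv k ζ ℓ) = 1 := by
  have h := congrArg Fr (UZeta.sp_intKinv_mul_K (k := k) (ζ := ζ) (ℓ := ℓ))
  rwa [map_mul, hFr.map_K, mul_one, map_one] at h

theorem coaction_eq_sum {ι : Type*} {s : Finset ι} {a b : ι → UZeta k ζ ℓ} {x : UZeta k ζ ℓ}
    (h : 𝓗.comul x = ∑ i ∈ s, a i ⊗ₜ[k] b i) :
    coaction 𝓗 Fr x = ∑ i ∈ s, a i ⊗ₜ[k] Fr (b i) := by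
  rw [coaction, AlgHom.comp_apply, h, map_sum]; rfl

theorem coaction_K (h𝓗 : 𝓗.HasStandardValues) (hFr : IsFrobeniusOnGenerators Fr) :
    coaction 𝓗 Fr (UZeta.K k ζ ℓ) = UZeta.K k ζ ℓ ⊗ₜ 1 := by
  rw [coaction, AlgHom.comp_apply, h𝓗.comul_K, Algebra.TensorProduct.map_tmul, hFr.map_K]; rfl

theorem coaction_E_one (hℓ : 1 < ℓ) (h𝓗 : 𝓗.HasStandardValues)
    (hFr : IsFrobeniusOnGenerators Fr) :
    coaction 𝓗 Fr (UZeta.E k ζ ℓ 1) = UZeta.E k ζ ℓ 1 ⊗ₜ 1 := by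
  rw [coaction_eq_sum (h𝓗.comul_E 1), Finset.Nat.antidiagonal_succ]
  have h : Fr (UZeta.E k ζ ℓ 1) = 0 := hFr.map_E 1 fun h => hℓ.ne' (Nat.dvd_one.mp h)
  simp [h, UZeta.E_zero]

theorem coaction_F_one (hℓ : 1 < ℓ) (h𝓗 : 𝓗.HasStandardValues)
    (hFr : IsFrobeniusOnGenerators Fr) :
    coaction 𝓗 Fr (UZeta.F k ζ ℓ 1) = UZeta.F k ζ ℓ 1 ⊗ₜ 1 := by
  rw [coaction_eq_sum (h𝓗.comul_F 1), Finset.Nat.antidiagonal_succ]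
  have h : Fr (UZeta.F k ζ ℓ 1) = 0 := hFr.map_F 1 fun h => hℓ.ne' (Nat.dvd_one.mp h)
  simp [h, UZeta.F_zero, hFr.map_Kinv]

/-- Fr kills the divided powers of index strictly between 0 and ℓ, so only the two end terms
survive, and K^ℓ = 1 turns the mixed one into 1 ⊗ e. -/
theorem coaction_E (hℓ : 1 < ℓ) (h𝓗 : 𝓗.HasStandardValues) (hFr : IsFrobeniusOnGenerators Fr) :
    coaction 𝓗 Fr (UZeta.E k ζ ℓ ℓ) = UZeta.E k ζ ℓ ℓ ⊗ₜ 1 + 1 ⊗ₜ e k := by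
  rw [coaction_eq_sum (h𝓗.comul_E ℓ), sum_antidiagonal_eq_add (by omega)]
  · rw [add_comm]
    simp [hFr.map_divE, UZeta.E_zero, UZeta.K_pow]
  · intro a b hab ha hb
    rw [hFr.map_E b (Nat.not_dvd_of_pos_of_lt (by omega) (by omega)), TensorProduct.tmul_zero]

theorem coaction_F (hℓ : 1 < ℓ) (h𝓗 : 𝓗.HasStandardValues) (hFr : IsFrobeniusOnGenerators Fr) :
    coaction 𝓗 Fr (UZeta.F k ζ ℓ ℓ) = UZeta.F k ζ ℓ ℓ ⊗ₜ 1 + 1 ⊗ₜ f k := by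
  rw [coaction_eq_sum (h𝓗.comul_F ℓ), sum_antidiagonal_eq_add (by omega)]
  · simp [hFr.map_divF, UZeta.F_zero, hFr.map_Kinv]
  · intro a b hab ha hb
    rw [map_smul, map_mul, hFr.map_F a (Nat.not_dvd_of_pos_of_lt (by omega) (by omega)), zero_mul,
      smul_zero, TensorProduct.tmul_zero]

theorem map_frobenius_comul (x : UZeta k ζ ℓ) :
    TensorProduct.map Fr.toLinearMap Fr.toLinearMap (𝓗.comul x) =
      Algebra.TensorProduct.map Fr (AlgHom.id k _) (coaction 𝓗 Fr x) := by
  rw [coaction, AlgHom.comp_apply]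
  generalize 𝓗.comul x = t
  induction t with
  | zero => simp
  | add x y hx hy => simp only [map_add, hx, hy]
  | tmul x y => rfl

end Coaction

variable [CharZero k] {𝓗 : HopfStr k (UZeta k ζ ℓ)} {Fr : UZeta k ζ ℓ →ₐ[k] USl2 k}

/-- Comultiplication and counit are compared as algebra maps on generators. For the antipode, the
elements where the two sides agree form a subalgebra; at E⁽ˡ⁾ and F⁽ˡ⁾ the sign is (-1)^ℓ = -1 by
oddness, and ζ^(ℓ(ℓ-1)) = 1. -/
theorem isFrobenius_of_generators (hodd : Odd ℓ) (hℓ : 1 < ℓ) (hζ : IsPrimitiveRoot ζ ℓ)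
    (h𝓗 : 𝓗.HasStandardValues) (hFr : IsFrobeniusOnGenerators Fr) : IsFrobenius 𝓗 Fr := by
  have hE1 : Fr (UZeta.E k ζ ℓ 1) = 0 := hFr.map_E 1 fun h => hℓ.ne' (Nat.dvd_one.mp h)
  have hF1 : Fr (UZeta.F k ζ ℓ 1) = 0 := hFr.map_F 1 fun h => hℓ.ne' (Nat.dvd_one.mp h)
  have hζℓ : (ζ : k) ^ ℓ = 1 := by rw [← Units.val_pow_eq_pow_val, hζ.pow_eq_one, Units.val_one]
  refine ⟨fun x => ?_, fun x => ?_, fun x => ?_, hE1, hF1, hFr.map_K, hFr.map_divE, hFr.map_divF⟩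
  · rw [map_frobenius_comul]
    have : (envComul k (SL2 k)).comp Fr =
        (Algebra.TensorProduct.map Fr (AlgHom.id k _)).comp (coaction 𝓗 Fr) := by
      refine UZeta.algHom_ext hodd hζ ?_ ?_ ?_ ?_ ?_ <;> simp only [AlgHom.comp_apply]
      · rw [coaction_K h𝓗 hFr, hFr.map_K, map_one, Algebra.TensorProduct.map_tmul, hFr.map_K]; rfl
      · rw [coaction_E_one hℓ h𝓗 hFr, Algebra.TensorProduct.map_tmul, hE1]; simp
      · rw [coaction_F_one hℓ h𝓗 hFr, Algebra.TensorProduct.map_tmul, hF1]; simp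
      · rw [coaction_E hℓ h𝓗 hFr, map_add, Algebra.TensorProduct.map_tmul,
          Algebra.TensorProduct.map_tmul, hFr.map_divE, envComul_e, map_one, map_one Fr]; rfl
      · rw [coaction_F hℓ h𝓗 hFr, map_add, Algebra.TensorProduct.map_tmul,
          Algebra.TensorProduct.map_tmul, hFr.map_divF, envComul_f, map_one, map_one Fr]; rfl
    exact congr($this x)
  · have : (envCounit k (SL2 k)).comp Fr = 𝓗.counit := by
      refine UZeta.algHom_ext hodd hζ ?_ ?_ ?_ ?_ ?_ <;> simp only [AlgHom.comp_apply]
      · rw [hFr.map_K, h𝓗.counit_K, map_one]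
      · rw [hE1, h𝓗.counit_E, map_zero, if_neg one_ne_zero]
      · rw [hF1, h𝓗.counit_F, map_zero, if_neg one_ne_zero]
      · rw [hFr.map_divE, h𝓗.counit_E, envCounit_e, if_neg (by omega)]
      · rw [hFr.map_divF, h𝓗.counit_F, envCounit_f, if_neg (by omega)]
    exact congr($this x)
  · let S : Subalgebra k (UZeta k ζ ℓ) :=
      { carrier := {x | envAntipodeLin (Fr x) = Fr (𝓗.antipode x)}
        mul_mem' := fun {a b} (ha : _ = _) (hb : _ = _) => by
          change envAntipodeLin (Fr (a * b)) = Fr (𝓗.antipode (a * b))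
          rw [map_mul, envAntipodeLin_mul, ha, hb, h𝓗.antipode_mul, map_mul]
        add_mem' := fun {a b} (ha : _ = _) (hb : _ = _) => by
          change envAntipodeLin (Fr (a + b)) = Fr (𝓗.antipode (a + b))
          rw [map_add, map_add, map_add, map_add, ha, hb]
        algebraMap_mem' := fun c => by
          change envAntipodeLin (Fr (algebraMap k _ c)) = Fr (𝓗.antipode (algebraMap k _ c))
          rw [AlgHom.commutes, Algebra.algebraMap_eq_smul_one, Algebra.algebraMap_eq_smul_one,
            map_smul, map_smul, map_smul, h𝓗.antipode_one, map_one Fr, envAntipodeLin_one] }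
    have hS : S = ⊤ := by
      refine UZeta.subalgebra_eq_top hodd hζ S ?_ ?_ ?_ ?_ ?_
      · change envAntipodeLin (Fr (UZeta.K k ζ ℓ)) = Fr (𝓗.antipode (UZeta.K k ζ ℓ))
        rw [hFr.map_K, h𝓗.antipode_K, hFr.map_Kinv]
        exact envAntipodeLin_one
      · change envAntipodeLin (Fr (UZeta.E k ζ ℓ 1)) = Fr (𝓗.antipode (UZeta.E k ζ ℓ 1))
        rw [h𝓗.antipode_E, map_smul, map_mul, hE1, mul_zero, smul_zero, map_zero]
      · change envAntipodeLin (Fr (UZeta.F k ζ ℓ 1)) = Fr (𝓗.antipode (UZeta.F k ζ ℓ 1))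
        rw [h𝓗.antipode_F, map_smul, map_mul, hF1, zero_mul, smul_zero, map_zero]
      · change envAntipodeLin (Fr (UZeta.E k ζ ℓ ℓ)) = Fr (𝓗.antipode (UZeta.E k ζ ℓ ℓ))
        rw [h𝓗.antipode_E, map_smul, map_mul, map_pow, hFr.map_Kinv, hFr.map_divE, envAntipodeLin_e,
          hodd.neg_one_pow, pow_mul, hζℓ]
        simp
      · change envAntipodeLin (Fr (UZeta.F k ζ ℓ ℓ)) = Fr (𝓗.antipode (UZeta.F k ζ ℓ ℓ))
        rw [h𝓗.antipode_F, map_smul, map_mul, map_pow, hFr.map_K, hFr.map_divF, envAntipodeLin_f,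
          hodd.neg_one_pow, pow_mul, inv_pow, hζℓ]
        simp
    have hx : x ∈ S := by rw [hS]; trivial
    exact hx

theorem IsFrobenius.eq (hodd : Odd ℓ) (hζ : IsPrimitiveRoot ζ ℓ) {Fr' : UZeta k ζ ℓ →ₐ[k] USl2 k}
    (h : IsFrobenius 𝓗 Fr) (h' : IsFrobenius 𝓗 Fr') : Fr' = Fr :=
  UZeta.algHom_ext hodd hζ (by rw [h.map_K, h'.map_K]) (by rw [h.map_E, h'.map_E])
    (by rw [h.map_F, h'.map_F]) (by rw [h.map_divE, h'.map_divE]) (by rw [h.map_divF, h'.map_divF])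

end FrobeniusHopf

/-! ### Specialization of elements of the generic algebra -/

section Specialize

variable {k : Type*} [Field k] {ζ : kˣ} {ℓ : ℕ}

variable (k ζ) in
/-- The rational function `c` is defined at `v = ζ`, with value `c'`. -/
def ScalarSpec (c : QV) (c' : k) : Prop :=
  ∃ s t : ZV, specHom k ζ s ≠ 0 ∧ algebraMap ZV QV s * c = algebraMap ZV QV t ∧
    specHom k ζ t = specHom k ζ s * c'

theorem scalarSpec_algebraMap (c : ZV) : ScalarSpec k ζ (algebraMap ZV QV c) (specHom k ζ c) :=
  ⟨1, c, by rw [map_one]; exact one_ne_zero, by rw [map_one, one_mul], by rw [map_one, one_mul]⟩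

theorem scalarSpec_zpow (n : ℤ) : ScalarSpec k ζ (qv ^ n) ((ζ : k) ^ n) := by
  rw [← algebraMap_vZ_zpow, ← specHom_vZ_zpow]; exact scalarSpec_algebraMap _

theorem scalarSpec_qbin (n c : ℕ) : ScalarSpec k ζ (qbin vQ n c) (qbin ζ n c) := by
  rw [← algebraMap_qbin, ← specHom_qbin]; exact scalarSpec_algebraMap _

theorem scalarSpec_qs (n : ℤ) : ScalarSpec k ζ (qs vQ n) (qs ζ n) := by
  have := scalarSpec_algebraMap (k := k) (ζ := ζ) (((vZ ^ n : ZVˣ) : ZV) - ((vZ ^ (-n) : ZVˣ) : ZV))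
  rwa [map_sub, map_sub, algebraMap_vZ_zpow, algebraMap_vZ_zpow, specHom_vZ_zpow,
    specHom_vZ_zpow] at this

theorem ScalarSpec.inv {c : QV} {c' : k} (h : ScalarSpec k ζ c c') (hc : c' ≠ 0) :
    ScalarSpec k ζ c⁻¹ c'⁻¹ := by
  obtain ⟨s, t, hs, h1, h2⟩ := h
  have ht : specHom k ζ t ≠ 0 := by rw [h2]; exact mul_ne_zero hs hc
  have ht0 : algebraMap ZV QV t ≠ 0 := fun h0 => ht (by
    rw [algebraMap_injective (h0.trans (map_zero _).symm), map_zero])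
  have hc0 : c ≠ 0 := by rintro rfl; exact ht0 (by rw [← h1, mul_zero])
  refine ⟨t, s, ht, ?_, ?_⟩
  · rw [← h1, mul_inv_cancel_right₀ hc0]
  · rw [h2, mul_inv_cancel_right₀ hc]

theorem ScalarSpec.mul {c d : QV} {c' d' : k} (h : ScalarSpec k ζ c c') (h' : ScalarSpec k ζ d d') :
    ScalarSpec k ζ (c * d) (c' * d') := by
  obtain ⟨s, t, hs, h1, h2⟩ := h
  obtain ⟨u, w, hu, h3, h4⟩ := h'
  refine ⟨s * u, t * w, by rw [map_mul]; exact mul_ne_zero hs hu, ?_, ?_⟩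
  · rw [map_mul, map_mul, ← h1, ← h3]; ring
  · rw [map_mul, map_mul, h2, h4]; ring

variable (k ζ ℓ) in
/-- The pairs `(x, y)` such that `x` is defined at `v = ζ`, with value `y` in `U_ζ`. -/
def specRel : Subring (UGen × UZeta k ζ ℓ) where
  carrier := {q | ∃ s : ZV, specHom k ζ s ≠ 0 ∧ ∃ z : UInt, (z : UGen) = s • q.1 ∧
    UZeta.sp k ζ ℓ z = specHom k ζ s • q.2}
  mul_mem' := by
    rintro ⟨x, y⟩ ⟨x', y'⟩ ⟨s, hs, z, h1, h2⟩ ⟨s', hs', z', h3, h4⟩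
    refine ⟨s * s', by rw [map_mul]; exact mul_ne_zero hs hs', z * z', ?_, ?_⟩
    · rw [MulMemClass.coe_mul, h1, h3, smul_mul_smul_comm]; rfl
    · rw [map_mul, h2, h4, smul_mul_smul_comm, map_mul]; rfl
  one_mem' := ⟨1, by rw [map_one]; exact one_ne_zero, 1, by rw [one_smul]; rfl, by
    rw [map_one, map_one, one_smul]; rfl⟩
  add_mem' := by
    rintro ⟨x, y⟩ ⟨x', y'⟩ ⟨s, hs, z, h1, h2⟩ ⟨s', hs', z', h3, h4⟩
    refine ⟨s * s', by rw [map_mul]; exact mul_ne_zero hs hs', s' • z + s • z', ?_, ?_⟩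
    · change s' • (z : UGen) + s • (z' : UGen) = (s * s') • (x + x')
      rw [h1, h3, smul_smul, smul_smul, mul_comm s', smul_add]
    · change _ = specHom k ζ (s * s') • (y + y')
      rw [map_add, UZeta.sp_smul, UZeta.sp_smul, h2, h4, smul_smul, smul_smul, map_mul,
        mul_comm (specHom k ζ s'), smul_add]
  zero_mem' := ⟨1, by rw [map_one]; exact one_ne_zero, 0, by rw [one_smul]; rfl, by
    rw [map_zero]; exact (smul_zero _).symm⟩
  neg_mem' := by
    rintro ⟨x, y⟩ ⟨s, hs, z, h1, h2⟩
    refine ⟨s, hs, -z, ?_, ?_⟩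
    · change -(z : UGen) = s • (-x)
      rw [h1, smul_neg]
    · change _ = specHom k ζ s • (-y)
      rw [map_neg, h2, smul_neg]

/-- An element may be specialized after clearing a denominator nonzero at ζ, and the value is
unique. Hence an identity in U_q holds in U_ζ as soon as all its terms have values. -/
theorem specRel_functional (y : UZeta k ζ ℓ) (h : ((0 : UGen), y) ∈ specRel k ζ ℓ) : y = 0 := by
  obtain ⟨s, hs, z, h1, h2⟩ := h
  have hz : z = 0 := Subtype.ext (h1.trans (smul_zero s))
  rw [hz, map_zero] at h2
  exact (smul_eq_zero.mp h2.symm).resolve_left hs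

theorem specRel_unique {x : UGen} {y y' : UZeta k ζ ℓ} (h : (x, y) ∈ specRel k ζ ℓ)
    (h' : (x, y') ∈ specRel k ζ ℓ) : y = y' := by
  have := (specRel k ζ ℓ).sub_mem h h'
  rw [Prod.mk_sub_mk, sub_self] at this
  exact sub_eq_zero.mp (specRel_functional _ this)

theorem sp_mem_specRel (x : UInt) : ((x : UGen), UZeta.sp k ζ ℓ x) ∈ specRel k ζ ℓ :=
  ⟨1, by rw [map_one]; exact one_ne_zero, x, (one_smul _ _).symm, by
    rw [map_one]; exact (one_smul _ _).symm⟩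

theorem smul_mem_specRel {c : QV} {c' : k} (hc : ScalarSpec k ζ c c') {x : UGen} {y : UZeta k ζ ℓ}
    (h : (x, y) ∈ specRel k ζ ℓ) : (c • x, c' • y) ∈ specRel k ζ ℓ := by
  obtain ⟨s, t, hs, h1, h2⟩ := hc
  obtain ⟨u, hu, z, h3, h4⟩ := h
  refine ⟨s * u, by rw [map_mul]; exact mul_ne_zero hs hu, t • z, ?_, ?_⟩
  · change t • (z : UGen) = (s * u) • c • x
    rw [h3, ← algebraMap_smul QV t, ← algebraMap_smul QV u, ← algebraMap_smul QV (s * u), map_mul,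
      smul_smul, smul_smul, ← h1]
    congr 1; ring
  · change _ = specHom k ζ (s * u) • c' • y
    rw [UZeta.sp_smul, h4, h2, smul_smul, smul_smul, map_mul]
    congr 1; ring

section Closure

variable {x x' : UGen} {y y' : UZeta k ζ ℓ}

theorem add_mem_specRel (h : (x, y) ∈ specRel k ζ ℓ) (h' : (x', y') ∈ specRel k ζ ℓ) :
    (x + x', y + y') ∈ specRel k ζ ℓ := (specRel k ζ ℓ).add_mem h h'

theorem sub_mem_specRel (h : (x, y) ∈ specRel k ζ ℓ) (h' : (x', y') ∈ specRel k ζ ℓ) :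
    (x - x', y - y') ∈ specRel k ζ ℓ := (specRel k ζ ℓ).sub_mem h h'

theorem mul_mem_specRel (h : (x, y) ∈ specRel k ζ ℓ) (h' : (x', y') ∈ specRel k ζ ℓ) :
    (x * x', y * y') ∈ specRel k ζ ℓ := (specRel k ζ ℓ).mul_mem h h'

theorem pow_mem_specRel (h : (x, y) ∈ specRel k ζ ℓ) (n : ℕ) :
    (x ^ n, y ^ n) ∈ specRel k ζ ℓ := (specRel k ζ ℓ).pow_mem h n

end Closure

theorem sum_mem_specRel {ι : Type*} (s : Finset ι) (f : ι → UGen) (g : ι → UZeta k ζ ℓ)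
    (h : ∀ i ∈ s, (f i, g i) ∈ specRel k ζ ℓ) :
    (∑ i ∈ s, f i, ∑ i ∈ s, g i) ∈ specRel k ζ ℓ := by
  have := (specRel k ζ ℓ).sum_mem h
  rwa [show ∑ i ∈ s, (f i, g i) = (∑ i ∈ s, f i, ∑ i ∈ s, g i) from
    Prod.ext Prod.fst_sum Prod.snd_sum] at this

theorem dp_gE_mem_specRel (n : ℕ) : (dp gE n, UZeta.E k ζ ℓ n) ∈ specRel k ζ ℓ :=
  sp_mem_specRel (intE n)

theorem dp_gF_mem_specRel (n : ℕ) : (dp gF n, UZeta.F k ζ ℓ n) ∈ specRel k ζ ℓ :=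
  sp_mem_specRel (intF n)

theorem gK_mem_specRel : (gK, UZeta.K k ζ ℓ) ∈ specRel k ζ ℓ := sp_mem_specRel intK

theorem gKi_mem_specRel : (gKi, UZeta.Kinv k ζ ℓ) ∈ specRel k ζ ℓ := sp_mem_specRel intKinv

/-! ### The Cartan part at a root of unity -/

namespace UZeta

variable (k ζ ℓ) in
/-- The value of `[K; c]` in `U_ζ`. -/
def kBr (c : ℤ) : UZeta k ζ ℓ :=
  (qs ζ 1)⁻¹ • ((ζ : k) ^ c • K k ζ ℓ - (ζ : k) ^ (-c) • Kinv k ζ ℓ)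

variable (k ζ ℓ) in
/-- The value of `[K; c; t]` in `U_ζ`, for `t < ℓ`. -/
def kBin (c : ℤ) : ℕ → UZeta k ζ ℓ
  | 0 => 1
  | t + 1 => (qs ζ (t + 1 : ℕ) * (qs ζ 1)⁻¹)⁻¹ • (kBin c t * kBr k ζ ℓ (c - t))

theorem kBr_add_mul (hζ : IsPrimitiveRoot ζ ℓ) (c m : ℤ) :
    kBr k ζ ℓ (c + ℓ * m) = kBr k ζ ℓ c := by
  rw [kBr, kBr, show -(c + ℓ * m) = -c + ℓ * (-m) by ring, ← Units.val_zpow_eq_zpow_val,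
    ← Units.val_zpow_eq_zpow_val, unit_zpow_add hζ, unit_zpow_add hζ, Units.val_zpow_eq_zpow_val,
    Units.val_zpow_eq_zpow_val]

/-- Only powers of ζ depend on c. This periodicity cancels the middle terms of the Serre-type
relation. -/
theorem kBin_add_mul (hζ : IsPrimitiveRoot ζ ℓ) (c m : ℤ) (t : ℕ) :
    kBin k ζ ℓ (c + ℓ * m) t = kBin k ζ ℓ c t := by
  induction t with
  | zero => rfl
  | succ t ih =>
    rw [kBin, kBin, ih, show c + ℓ * m - t = (c - t) + ℓ * m by ring, kBr_add_mul hζ]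

end UZeta

theorem qs_one_ne_zero (hodd : Odd ℓ) (hℓ : 1 < ℓ) (hζ : IsPrimitiveRoot ζ ℓ) : qs ζ 1 ≠ 0 := by
  exact_mod_cast qs_ne_zero hζ hodd (c := 1) fun h => hℓ.ne' (Nat.dvd_one.mp h)

theorem cartan_kBr_mem_specRel (hodd : Odd ℓ) (hℓ : 1 < ℓ) (hζ : IsPrimitiveRoot ζ ℓ) (c : ℤ) :
    (cartan (kBr c), UZeta.kBr k ζ ℓ c) ∈ specRel k ζ ℓ := by
  rw [cartan_kBr]
  exact smul_mem_specRel ((scalarSpec_qs 1).inv (qs_one_ne_zero hodd hℓ hζ))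
    (sub_mem_specRel (smul_mem_specRel (scalarSpec_zpow c) gK_mem_specRel)
      (smul_mem_specRel (scalarSpec_zpow (-c)) gKi_mem_specRel))

/-- For t < ℓ the denominator [t]! is nonzero at ζ, so the defining formula specializes as it
stands. -/
theorem cartan_kBin_mem_specRel (hodd : Odd ℓ) (hℓ : 1 < ℓ) (hζ : IsPrimitiveRoot ζ ℓ) (c : ℤ)
    {t : ℕ} (ht : t < ℓ) :
    (cartan (kBin c t), UZeta.kBin k ζ ℓ c t) ∈ specRel k ζ ℓ := by
  induction t with
  | zero => rw [kBin, map_one]; exact (specRel k ζ ℓ).one_mem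
  | succ t ih =>
    have h1 := qs_one_ne_zero hodd hℓ hζ
    have h2 : qs ζ (t + 1 : ℕ) ≠ 0 := qs_ne_zero hζ hodd (Nat.not_dvd_of_pos_of_lt t.succ_pos ht)
    rw [kBin, map_smul, map_mul, UZeta.kBin, qInt_eq, div_eq_mul_inv]
    refine smul_mem_specRel (((scalarSpec_qs _).mul ((scalarSpec_qs 1).inv h1)).inv
      (mul_ne_zero h2 (inv_ne_zero h1))) ?_
    exact mul_mem_specRel (ih (by omega)) (cartan_kBr_mem_specRel hodd hℓ hζ _)

theorem cartan_T_neg (j : ℕ) : cartan (LaurentPolynomial.T (-(j : ℤ))) = gKi ^ j := by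
  rw [cartan_T, zpow_neg, zpow_natCast, ← inv_pow, Units.val_pow_eq_pow_val]; rfl

/-- The elements `[K; 0; ℓ]` and `[K; -ℓ; ℓ]` are defined at the root of unity, with values that
differ by `1`. -/
theorem exists_cartan_kBin_mem_specRel (hodd : Odd ℓ) (hℓ : 1 < ℓ) (hζ : IsPrimitiveRoot ζ ℓ) :
    ∃ y : UZeta k ζ ℓ,
      (cartan (kBin 0 ℓ), y) ∈ specRel k ζ ℓ ∧ (cartan (kBin (-ℓ) ℓ), y - 1) ∈ specRel k ζ ℓ := by
  have hζn : ∀ n : ℤ, (ζ : k) ^ (ℓ * n) = 1 := fun n => by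
    rw [zpow_mul, zpow_natCast, ← Units.val_pow_eq_pow_val, hζ.pow_eq_one, Units.val_one, one_zpow]
  obtain ⟨L, rfl⟩ : ∃ L, ℓ = L + 1 := ⟨ℓ - 1, by omega⟩
  obtain ⟨y, hy⟩ : ∃ y : UZeta k ζ (L + 1), (cartan (kBin 0 (L + 1)), y) ∈ specRel k ζ (L + 1) := by
    -- Although [ℓ]! vanishes at ζ, the commutation formula expresses [K;0;ℓ] as E⁽ˡ⁾F⁽ˡ⁾ minus
    -- terms whose Cartan parts have t < ℓ, all of which have values.
    have h := dp_gE_mul_dp_gF (L + 1) 0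
    rw [Finset.Nat.sum_antidiagonal_succ] at h
    simp only [add_zero, dp_zero, one_mul, mul_one, Nat.cast_zero, mul_zero, sub_zero] at h
    rw [eq_sub_of_add_eq h.symm]
    refine ⟨_, sub_mem_specRel (mul_mem_specRel (dp_gE_mem_specRel _) (dp_gF_mem_specRel _))
      (sum_mem_specRel _ _ (fun p => UZeta.F k ζ (L + 1) (p.1 + 1) *
        UZeta.kBin k ζ (L + 1) (-2 * (p.1 + 1 : ℕ)) p.2 * UZeta.E k ζ (L + 1) (p.1 + 1)) fun p hp => ?_)⟩
    rw [Finset.HasAntidiagonal.mem_antidiagonal] at hp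
    exact mul_mem_specRel (mul_mem_specRel (dp_gF_mem_specRel _)
      (cartan_kBin_mem_specRel hodd hℓ hζ _ (by omega))) (dp_gE_mem_specRel _)
  refine ⟨y, hy, ?_⟩
  -- The convolution expands [K;0;ℓ] as [K;-ℓ+ℓ;ℓ]. At ζ its middle binomials vanish, the term j = 0
  -- is [K;-ℓ;ℓ], and the term j = ℓ is K^(-ℓ) = 1; this is the difference by 1.
  have h := congrArg cartan (kBin_add (-((L + 1 : ℕ) : ℤ)) (L + 1) (L + 1))
  rw [neg_add_cancel, map_sum, Finset.sum_range_succ', Finset.sum_range_succ] at h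
  simp only [map_smul, map_mul, cartan_T_neg] at h
  have hv : qv ^ (((L + 1 : ℕ) : ℤ) * (L + 1 : ℕ)) ≠ 0 := zpow_ne_zero _ qv_ne_zero
  have h0 : cartan (kBin (-((L + 1 : ℕ) : ℤ)) (L + 1)) =
      qv ^ (((L + 1 : ℕ) : ℤ) * -(L + 1 : ℕ)) • (cartan (kBin 0 (L + 1)) -
        (∑ j ∈ Finset.range L, (qv ^ (((L + 1 : ℕ) : ℤ) * (((L + 1 : ℕ) : ℤ) - (j + 1 : ℕ)) -
          -((L + 1 : ℕ) : ℤ) * (j + 1 : ℕ)) * qbin vQ (L + 1) (j + 1)) •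
          (gKi ^ (j + 1) * cartan (kBin (-((L + 1 : ℕ) : ℤ)) (L + 1 - (j + 1)))) +
        qv ^ (((L + 1 : ℕ) : ℤ) * (L + 1 : ℕ)) • gKi ^ (L + 1))) := by
    rw [h, mul_neg, zpow_neg, eq_inv_smul_iff₀ hv]
    simp only [qbin_self, qbin_zero_right, pow_zero, one_mul, mul_one, Nat.sub_self, Nat.sub_zero,
      Nat.cast_zero, mul_zero, sub_zero, sub_self, neg_mul, sub_neg_eq_add, zero_add, kBin, map_one]
    abel
  rw [h0]
  -- The value is rewritten in the shape of `h0`, so that the closure properties of `specRel` apply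
  -- term by term.
  have h1 : y - 1 = (ζ : k) ^ (((L + 1 : ℕ) : ℤ) * -(L + 1 : ℕ)) • (y -
      (∑ j ∈ Finset.range L, (0 : UZeta k ζ (L + 1)) +
        (ζ : k) ^ (((L + 1 : ℕ) : ℤ) * (L + 1 : ℕ)) • UZeta.Kinv k ζ (L + 1) ^ (L + 1))) := by
    rw [hζn, hζn, UZeta.sp_intKinv_pow, Finset.sum_const_zero, zero_add, one_smul, one_smul]
  rw [h1]
  refine smul_mem_specRel (scalarSpec_zpow _) (sub_mem_specRel hy
    (add_mem_specRel (sum_mem_specRel _ _ _ fun j hj => ?_)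
      (smul_mem_specRel (scalarSpec_zpow _) (pow_mem_specRel gKi_mem_specRel _))))
  have hj' := Finset.mem_range.mp hj
  have h2 := smul_mem_specRel ((scalarSpec_zpow (k := k) (ζ := ζ)
    (((L + 1 : ℕ) : ℤ) * (((L + 1 : ℕ) : ℤ) - (j + 1 : ℕ)) - -((L + 1 : ℕ) : ℤ) * (j + 1 : ℕ))).mul
    (scalarSpec_qbin (L + 1) (j + 1)))
    (mul_mem_specRel (pow_mem_specRel gKi_mem_specRel (j + 1))
      (cartan_kBin_mem_specRel hodd hℓ hζ (-((L + 1 : ℕ) : ℤ)) (t := L + 1 - (j + 1)) (by omega)))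
  rw [qbin_root_middle hζ hodd j.succ_pos (by omega), mul_zero, zero_smul] at h2
  exact h2

/-- The Serre-type relation between `E⁽ˡ⁾` and `F⁽ˡ⁾`. -/
theorem UZeta.serre_E (hodd : Odd ℓ) (hℓ : 1 < ℓ) (hζ : IsPrimitiveRoot ζ ℓ) :
    E k ζ ℓ ℓ * E k ζ ℓ ℓ * F k ζ ℓ ℓ - (2 : k) • (E k ζ ℓ ℓ * F k ζ ℓ ℓ * E k ζ ℓ ℓ) +
      F k ζ ℓ ℓ * E k ζ ℓ ℓ * E k ζ ℓ ℓ = -((2 : k) • E k ζ ℓ ℓ) := by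
  have hB2 : qbin ζ (ℓ + ℓ) ℓ = (2 : k) := by
    have := qbin_mul_root hζ hodd 2 1
    rw [mul_one, mul_two] at this
    rw [this]; norm_num
  have hB1 : ∀ i, i < ℓ → qbin ζ (i + ℓ) ℓ = (1 : k) := fun i hi => by
    rw [qbin_add_root hζ hodd, if_pos le_rfl, qbin_eq_zero _ hi, Nat.sub_self, qbin_zero_right,
      zero_add]
  let B : ℕ → QV := fun i => qbin vQ (i + ℓ) ℓ
  have hB : ∀ i, ScalarSpec k ζ (B i) (qbin ζ (i + ℓ) ℓ) := fun i => scalarSpec_qbin _ _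
  have h2 : ScalarSpec k ζ 2 2 := by
    have := scalarSpec_algebraMap (k := k) (ζ := ζ) 2
    rwa [map_ofNat, map_ofNat] at this
  have hEE : ∀ i, dp gE i * dp gE ℓ = B i • dp gE (i + ℓ) := fun i => by
    have h : dp gE ℓ * dp gE i = B i • dp gE (i + ℓ) := by
      rw [add_comm i ℓ]
      exact (divPow_mul gE ℓ i).trans (by rw [add_comm ℓ i]; rfl)
    rw [← h, dp, dp, smul_mul_smul_comm, smul_mul_smul_comm, mul_comm (qFactorial ℓ)⁻¹, ← pow_add,
      ← pow_add, add_comm]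
  -- Each of the three products is expanded as a sum of terms F⁽ⁱ⁾ · (Cartan part) · E⁽ⁱ⁺ˡ⁾ with i +
  -- t = ℓ. The third is already ordered and contributes only at t = 0.
  have hx : dp gE ℓ * dp gE ℓ * dp gF ℓ - (2 : QV) • (dp gE ℓ * dp gF ℓ * dp gE ℓ) +
      dp gF ℓ * dp gE ℓ * dp gE ℓ =
      ∑ p ∈ Finset.HasAntidiagonal.antidiagonal ℓ, dp gF p.1 *
        (B ℓ • cartan (QuantumSL2.kBin (-2 * p.1 - ℓ) p.2) -
          (2 * B p.1) • cartan (QuantumSL2.kBin (-2 * p.1 - (0 : ℕ)) p.2) +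
          B ℓ • (if p.2 = 0 then 1 else 0)) * dp gE (p.1 + ℓ) := by
    have h1 := dp_gE_mul_dp_gF ℓ ℓ
    have h2 := dp_gE_mul_dp_gF ℓ 0
    have h3 : dp gF ℓ * dp gE (ℓ + ℓ) = ∑ p ∈ Finset.HasAntidiagonal.antidiagonal ℓ,
        dp gF p.1 * (if p.2 = 0 then 1 else 0) * dp gE (p.1 + ℓ) := by
      rw [sum_antidiagonal_eq_add (by omega)]
      · rw [if_neg (by omega), if_pos rfl]; simp
      · intro a b _ _ hb
        rw [if_neg hb]; simp
    rw [mul_assoc (dp gF ℓ), hEE, smul_mul_assoc, mul_smul_comm, h1, h3]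
    rw [add_zero] at h2
    rw [h2, Finset.sum_mul, Finset.smul_sum, Finset.smul_sum, Finset.smul_sum,
      ← Finset.sum_sub_distrib, ← Finset.sum_add_distrib]
    refine Finset.sum_congr rfl fun p _ => ?_
    rw [add_zero, mul_assoc (_ * _) (dp gE p.1), hEE, mul_smul_comm, smul_smul]
    simp only [mul_add, mul_sub, add_mul, sub_mul, mul_smul_comm, smul_mul_assoc]
  have hy : (dp gE ℓ * dp gE ℓ * dp gF ℓ - (2 : QV) • (dp gE ℓ * dp gF ℓ * dp gE ℓ) +
      dp gF ℓ * dp gE ℓ * dp gE ℓ, -((2 : k) • E k ζ ℓ ℓ)) ∈ specRel k ζ ℓ := by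
    obtain ⟨y, hy0, hyℓ⟩ := exists_cartan_kBin_mem_specRel hodd hℓ hζ
    -- The claimed value is spread over the same index set, concentrated at i = 0, to allow
    -- comparison term by term.
    have hg : -((2 : k) • E k ζ ℓ ℓ) = ∑ p ∈ Finset.HasAntidiagonal.antidiagonal ℓ,
        F k ζ ℓ p.1 * (if p.1 = 0 then -((2 : k) • 1) else 0) * E k ζ ℓ (p.1 + ℓ) := by
      rw [sum_antidiagonal_eq_add (by omega)]
      · rw [if_pos rfl, if_neg (by omega), F_zero]; simp
      · intro a b _ ha _
        rw [if_neg ha]; simp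
    rw [hx, hg]
    refine sum_mem_specRel _ _ _ fun p hp => mul_mem_specRel (mul_mem_specRel (dp_gF_mem_specRel _) ?_)
      (dp_gE_mem_specRel _)
    rw [Finset.HasAntidiagonal.mem_antidiagonal] at hp
    rcases p with ⟨i, t⟩
    dsimp only at hp ⊢
    rcases Nat.eq_zero_or_pos t with rfl | ht
    · obtain rfl : i = ℓ := by omega
      rw [if_pos rfl, if_neg (by omega)]
      simp only [QuantumSL2.kBin, map_one]
      -- At i = ℓ the three coefficients cancel already over ℚ(v).
      have : B i • (1 : UGen) - (2 * B i) • 1 + B i • 1 = 0 := by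
        rw [← sub_smul, ← add_smul, show B i - 2 * B i + B i = 0 by ring, zero_smul]
      rw [this]
      exact (specRel k ζ i).zero_mem
    · rw [if_neg (show ¬ t = 0 by omega), smul_zero, add_zero]
      rcases Nat.eq_zero_or_pos i with rfl | hi
      · obtain rfl : t = ℓ := by omega
        have h := sub_mem_specRel (smul_mem_specRel (hB t) hyℓ)
          (smul_mem_specRel (h2.mul (hB 0)) hy0)
        rw [hB2, hB1 0 (by omega)] at h
        -- At i = 0 the values of [K;-ℓ;ℓ] and [K;0;ℓ] differ by 1, leaving -2.
        have h' : (2 : k) • (y - 1) - ((2 : k) * 1) • y = -((2 : k) • 1) := by module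
        rw [h'] at h
        simpa using h
      · have h := sub_mem_specRel (smul_mem_specRel (hB ℓ)
          (cartan_kBin_mem_specRel hodd hℓ hζ (-2 * i - ℓ) (t := t) (by omega)))
          (smul_mem_specRel (h2.mul (hB i))
            (cartan_kBin_mem_specRel hodd hℓ hζ (-2 * i - (0 : ℕ)) (t := t) (by omega)))
        -- For 0 < i < ℓ the binomials specialize to 2 and 1, and the Cartan arguments differ by ℓ,
        -- so the two terms cancel.
        have hper := kBin_add_mul hζ (-2 * i - (0 : ℕ)) (-1) t
        rw [show (-2 * i - (0 : ℕ) + ℓ * (-1) : ℤ) = -2 * i - ℓ by push_cast; ring] at hper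
        rw [hB2, hB1 i (by omega), hper, mul_one, sub_self] at h
        rw [if_neg (show ¬ i = 0 by omega)]
        exact h
  refine specRel_unique (add_mem_specRel (sub_mem_specRel ?_ (smul_mem_specRel h2 ?_)) ?_) hy
  · exact mul_mem_specRel (mul_mem_specRel (dp_gE_mem_specRel ℓ)
      (dp_gE_mem_specRel ℓ)) (dp_gF_mem_specRel ℓ)
  · exact mul_mem_specRel (mul_mem_specRel (dp_gE_mem_specRel ℓ)
      (dp_gF_mem_specRel ℓ)) (dp_gE_mem_specRel ℓ)
  · exact mul_mem_specRel (mul_mem_specRel (dp_gF_mem_specRel ℓ)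
      (dp_gE_mem_specRel ℓ)) (dp_gE_mem_specRel ℓ)

end Specialize

/-! ### The symmetry exchanging `E` and `F` -/

section Flip

/-- The images of the generators under the automorphism `E ↔ F`, `K ↔ K⁻¹`. -/
def genFlipGen : Gen → UGen
  | .E => gF
  | .F => gE
  | .K => gKi
  | .Kinv => gK

/-- The automorphism `E ↔ F`, `K ↔ K⁻¹` of the generic quantum algebra. -/
def genFlip : UGen →ₐ[QV] UGen :=
  Uq.lift genFlipGen Uq.Kinv_mul_K Uq.K_mul_Kinv (Uq.Kinv_mul_F qv_ne_zero)
    (Uq.Kinv_mul_E qv_ne_zero) (by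
      rw [genFlipGen, genFlipGen, genFlipGen, genFlipGen, ← neg_sub (gE * gF), Uq.E_mul_F, ← smul_neg,
        neg_sub])

theorem genFlip_gen (g : Gen) : genFlip (Uq.gen QV qv g) = genFlipGen g := Uq.lift_gen _ _ _ _ _ _ _

theorem genFlip_dp_gE (n : ℕ) : genFlip (dp gE n) = dp gF n := by
  rw [map_dp, genFlip_gen]; rfl

theorem genFlip_dp_gF (n : ℕ) : genFlip (dp gF n) = dp gE n := by
  rw [map_dp, genFlip_gen]; rfl

variable {k : Type*} [Field k] {ζ : kˣ} {ℓ : ℕ}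

variable (k ζ ℓ) in
/-- The automorphism `E ↔ F`, `K ↔ K⁻¹` of `U_ζ`. -/
theorem UZeta.exists_flip : ∃ ω : UZeta k ζ ℓ →ₐ[k] UZeta k ζ ℓ,
    ω (UZeta.K k ζ ℓ) = UZeta.Kinv k ζ ℓ ∧ (∀ n, ω (UZeta.E k ζ ℓ n) = UZeta.F k ζ ℓ n) ∧
      ∀ n, ω (UZeta.F k ζ ℓ n) = UZeta.E k ζ ℓ n := by
  have hK : (genFlip (intK : UGen), UZeta.Kinv k ζ ℓ) ∈ specRel k ζ ℓ := by
    rw [UZeta.coe_intK, genFlip_gen]; exact gKi_mem_specRel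
  have hKi : (genFlip (intKinv : UGen), UZeta.K k ζ ℓ) ∈ specRel k ζ ℓ := by
    rw [UZeta.coe_intKinv, genFlip_gen]; exact gK_mem_specRel
  have hE : ∀ n, (genFlip (intE n : UGen), UZeta.F k ζ ℓ n) ∈ specRel k ζ ℓ := fun n => by
    rw [UZeta.coe_intE, genFlip_dp_gE]; exact dp_gF_mem_specRel n
  have hF : ∀ n, (genFlip (intF n : UGen), UZeta.E k ζ ℓ n) ∈ specRel k ζ ℓ := fun n => by
    rw [UZeta.coe_intF, genFlip_dp_gF]; exact dp_gE_mem_specRel n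
  obtain ⟨ω, hω⟩ := UZeta.exists_lift_of_rel (k := k) (ζ := ζ) (ℓ := ℓ) genFlip.toRingHom
    (specRel k ζ ℓ) specRel_functional
    (fun c => by
      change (genFlip (algebraMap ZV UGen c), _) ∈ _
      rw [IsScalarTower.algebraMap_apply ZV QV UGen, AlgHom.commutes,
        Algebra.algebraMap_eq_smul_one (A := UGen),
        Algebra.algebraMap_eq_smul_one (A := UZeta k ζ ℓ)]
      exact smul_mem_specRel (scalarSpec_algebraMap c) (specRel k ζ ℓ).one_mem)
    (UZeta.Kinv k ζ ℓ) hK UZeta.sp_intKinv_pow ⟨_, hKi⟩ (fun n => ⟨_, hE n⟩) (fun n => ⟨_, hF n⟩)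
  exact ⟨ω, specRel_unique (hω _) hK, fun n => specRel_unique (hω _) (hE n),
    fun n => specRel_unique (hω _) (hF n)⟩

end Flip

/-! ### The splitting of the Frobenius map -/

section Splitting

open UZeta

variable {k : Type*} [Field k] {ζ : kˣ} {ℓ : ℕ}

theorem UZeta.serre_F (hodd : Odd ℓ) (hℓ : 1 < ℓ) (hζ : IsPrimitiveRoot ζ ℓ) :
    F k ζ ℓ ℓ * F k ζ ℓ ℓ * E k ζ ℓ ℓ - (2 : k) • (F k ζ ℓ ℓ * E k ζ ℓ ℓ * F k ζ ℓ ℓ) +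
      E k ζ ℓ ℓ * F k ζ ℓ ℓ * F k ζ ℓ ℓ = -((2 : k) • F k ζ ℓ ℓ) := by
  obtain ⟨ω, -, hE, hF⟩ := exists_flip k ζ ℓ
  have h := congrArg ω (serre_E hodd hℓ hζ)
  simpa only [map_add, map_sub, map_mul, map_smul, map_neg, hE, hF] using h

/-- The splitting `γ : U(sl₂) → U_ζ`, with `e ↦ E⁽ˡ⁾` and `f ↦ F⁽ˡ⁾`. -/
def splitting (hodd : Odd ℓ) (hℓ : 1 < ℓ) (hζ : IsPrimitiveRoot ζ ℓ) : USl2 k →ₐ[k] UZeta k ζ ℓ :=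
  slHom (E k ζ ℓ ℓ) (F k ζ ℓ ℓ)
    (by
      rw [← neg_neg ((2 : k) • _), ← serre_E hodd hℓ hζ, two_smul, sub_mul, mul_sub, ← mul_assoc,
        ← mul_assoc]
      abel)
    (by
      rw [← serre_F hodd hℓ hζ, two_smul, sub_mul, mul_sub, ← mul_assoc, ← mul_assoc]
      abel)

theorem splitting_e (hodd : Odd ℓ) (hℓ : 1 < ℓ) (hζ : IsPrimitiveRoot ζ ℓ) :
    splitting hodd hℓ hζ (e k) = E k ζ ℓ ℓ := slHom_e _ _ _ _

theorem splitting_f (hodd : Odd ℓ) (hℓ : 1 < ℓ) (hζ : IsPrimitiveRoot ζ ℓ) :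
    splitting hodd hℓ hζ (f k) = F k ζ ℓ ℓ := slHom_f _ _ _ _

theorem UZeta.E_comm (m n : ℕ) : E k ζ ℓ m * E k ζ ℓ n = E k ζ ℓ n * E k ζ ℓ m := by
  have h : dp gE m * dp gE n = dp gE n * dp gE m := by
    rw [dp, dp, smul_mul_smul_comm, smul_mul_smul_comm, mul_comm (qFactorial m)⁻¹, ← pow_add,
      ← pow_add, add_comm]
  refine specRel_unique (mul_mem_specRel (dp_gE_mem_specRel m) (dp_gE_mem_specRel n)) ?_
  rw [h]
  exact mul_mem_specRel (dp_gE_mem_specRel n) (dp_gE_mem_specRel m)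

theorem UZeta.K_mul_E (n : ℕ) :
    K k ζ ℓ * E k ζ ℓ n = (ζ : k) ^ ((2 * n : ℕ) : ℤ) • (E k ζ ℓ n * K k ζ ℓ) := by
  have h : gK * dp gE n = qv ^ ((2 * n : ℕ) : ℤ) • (dp gE n * gK) := by
    rw [gK_mul_dp_gE, zpow_natCast]
  refine specRel_unique (mul_mem_specRel gK_mem_specRel (dp_gE_mem_specRel n)) ?_
  rw [h]
  exact smul_mem_specRel (scalarSpec_zpow _) (mul_mem_specRel (dp_gE_mem_specRel n) gK_mem_specRel)

theorem UZeta.K_mul_divE (hζ : IsPrimitiveRoot ζ ℓ) :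
    K k ζ ℓ * E k ζ ℓ ℓ = E k ζ ℓ ℓ * K k ζ ℓ := by
  rw [K_mul_E, zpow_natCast, mul_comm 2, pow_mul, ← Units.val_pow_eq_pow_val, hζ.pow_eq_one,
    Units.val_one, one_pow, one_smul]

theorem frobKernel_K_mem : K k ζ ℓ ∈ frobKernel k ζ ℓ := Algebra.subset_adjoin (by simp)

theorem frobKernel_E_one_mem : E k ζ ℓ 1 ∈ frobKernel k ζ ℓ := Algebra.subset_adjoin (by simp)

theorem frobKernel_F_one_mem : F k ζ ℓ 1 ∈ frobKernel k ζ ℓ := Algebra.subset_adjoin (by simp)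

theorem frobKernel_Kinv_mem (hℓ : 0 < ℓ) : Kinv k ζ ℓ ∈ frobKernel k ζ ℓ := by
  rw [Kinv, sp_intKinv hℓ]; exact pow_mem frobKernel_K_mem _

theorem frobKernel_E_mem (hodd : Odd ℓ) (hζ : IsPrimitiveRoot ζ ℓ) {n : ℕ} (hn : n < ℓ) :
    E k ζ ℓ n ∈ frobKernel k ζ ℓ :=
  dividedPower_mem_of_lt hodd hζ E_zero E_mul _ frobKernel_E_one_mem hn

theorem frobKernel_flip_mem (hℓ : 0 < ℓ) {ω : UZeta k ζ ℓ →ₐ[k] UZeta k ζ ℓ}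
    (hK : ω (K k ζ ℓ) = Kinv k ζ ℓ) (hE : ∀ n, ω (E k ζ ℓ n) = F k ζ ℓ n)
    (hF : ∀ n, ω (F k ζ ℓ n) = E k ζ ℓ n) {a : UZeta k ζ ℓ} (ha : a ∈ frobKernel k ζ ℓ) :
    ω a ∈ frobKernel k ζ ℓ := by
  have : frobKernel k ζ ℓ ≤ (frobKernel k ζ ℓ).comap ω := by
    refine Algebra.adjoin_le ?_
    rintro x (rfl | rfl | rfl)
    · change ω _ ∈ frobKernel k ζ ℓ; rw [hE]; exact frobKernel_F_one_mem
    · change ω _ ∈ frobKernel k ζ ℓ; rw [hF]; exact frobKernel_E_one_mem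
    · change ω _ ∈ frobKernel k ζ ℓ; rw [hK]; exact frobKernel_Kinv_mem hℓ
  exact this ha

/-- If a derivation `[x, -]` maps generators of `u_ζ` into `u_ζ`, then it preserves `u_ζ`. -/
theorem frobKernel_commutator_mem_of_generators {x : UZeta k ζ ℓ}
    (hE : x * E k ζ ℓ 1 - E k ζ ℓ 1 * x ∈ frobKernel k ζ ℓ)
    (hF : x * F k ζ ℓ 1 - F k ζ ℓ 1 * x ∈ frobKernel k ζ ℓ)
    (hK : x * K k ζ ℓ - K k ζ ℓ * x ∈ frobKernel k ζ ℓ) {a : UZeta k ζ ℓ}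
    (ha : a ∈ frobKernel k ζ ℓ) : x * a - a * x ∈ frobKernel k ζ ℓ := by
  induction ha using Algebra.adjoin_induction with
  | mem a ha => rcases ha with rfl | rfl | rfl <;> assumption
  | algebraMap c => rw [Algebra.commutes, sub_self]; exact zero_mem _
  | add a b _ _ iha ihb =>
    rw [mul_add, add_mul, add_sub_add_comm]; exact add_mem iha ihb
  | mul a b ha hb iha ihb =>
    have : x * (a * b) - a * b * x = (x * a - a * x) * b + a * (x * b - b * x) := by
      rw [sub_mul, mul_sub]; simp only [mul_assoc]; abel
    rw [this]
    exact add_mem (mul_mem iha hb) (mul_mem ha ihb)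

/-- E⁽ˡ⁾ commutes with E, and with K since ζ^(2ℓ) = 1; only the commutator with F is nonzero, and it
involves a divided power of index below ℓ. -/
theorem frobKernel_divE_commutator_mem (hodd : Odd ℓ) (hℓ : 1 < ℓ) (hζ : IsPrimitiveRoot ζ ℓ)
    {a : UZeta k ζ ℓ} (ha : a ∈ frobKernel k ζ ℓ) :
    E k ζ ℓ ℓ * a - a * E k ζ ℓ ℓ ∈ frobKernel k ζ ℓ := by
  refine frobKernel_commutator_mem_of_generators ?_ ?_ ?_ ha
  · rw [E_comm, sub_self]; exact zero_mem _
  · obtain ⟨L, rfl⟩ : ∃ L, ℓ = L + 1 := ⟨ℓ - 1, by omega⟩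
    have h1 : (gF, F k ζ (L + 1) 1) ∈ specRel k ζ (L + 1) := by
      have := dp_gF_mem_specRel (k := k) (ζ := ζ) (ℓ := L + 1) 1
      rwa [show dp gF 1 = gF from divPow_one gF] at this
    have h := dp_gE_mul_gF L
    have h2 : E k ζ (L + 1) (L + 1) * F k ζ (L + 1) 1 = F k ζ (L + 1) 1 * E k ζ (L + 1) (L + 1) +
        UZeta.kBr k ζ (L + 1) (-L) * E k ζ (L + 1) L := by
      refine specRel_unique (mul_mem_specRel (dp_gE_mem_specRel _) h1) ?_
      rw [h]
      exact add_mem_specRel (mul_mem_specRel h1 (dp_gE_mem_specRel _))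
        (mul_mem_specRel (cartan_kBr_mem_specRel hodd hℓ hζ _) (dp_gE_mem_specRel _))
    rw [h2, add_sub_cancel_left]
    refine mul_mem ?_ (frobKernel_E_mem hodd hζ (Nat.lt_succ_self L))
    exact Subalgebra.smul_mem _ (sub_mem (Subalgebra.smul_mem _ frobKernel_K_mem _)
      (Subalgebra.smul_mem _ (frobKernel_Kinv_mem L.succ_pos) _)) _
  · rw [K_mul_divE hζ, sub_self]; exact zero_mem _

/-- The statement for E⁽ˡ⁾ is conjugated by the symmetry E ↔ F, which preserves the kernel and is an
involution on it. -/
theorem frobKernel_divF_commutator_mem (hodd : Odd ℓ) (hℓ : 1 < ℓ) (hζ : IsPrimitiveRoot ζ ℓ)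
    {a : UZeta k ζ ℓ} (ha : a ∈ frobKernel k ζ ℓ) :
    F k ζ ℓ ℓ * a - a * F k ζ ℓ ℓ ∈ frobKernel k ζ ℓ := by
  obtain ⟨ω, hK, hE, hF⟩ := exists_flip k ζ ℓ
  have hKi : ω (Kinv k ζ ℓ) = K k ζ ℓ := by
    have h1 := congrArg ω (sp_intKinv_mul_K (k := k) (ζ := ζ) (ℓ := ℓ))
    rw [map_mul, hK, map_one] at h1
    calc ω (Kinv k ζ ℓ) = ω (Kinv k ζ ℓ) * (Kinv k ζ ℓ * K k ζ ℓ) := by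
          rw [sp_intKinv_mul_K, mul_one]
      _ = K k ζ ℓ := by rw [← mul_assoc, h1, one_mul]
  have hinv : ∀ b ∈ frobKernel k ζ ℓ, ω (ω b) = b := fun b hb => by
    induction hb using Algebra.adjoin_induction with
    | mem b hb =>
      rcases hb with rfl | rfl | rfl
      · rw [hE, hF]
      · rw [hF, hE]
      · rw [hK, hKi]
    | algebraMap c => rw [AlgHom.commutes, AlgHom.commutes]
    | add a b _ _ iha ihb => rw [map_add, map_add, iha, ihb]
    | mul a b _ _ iha ihb => rw [map_mul, map_mul, iha, ihb]
  have h := frobKernel_flip_mem (by omega) hK hE hF (frobKernel_divE_commutator_mem hodd hℓ hζ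
    (frobKernel_flip_mem (by omega) hK hE hF ha))
  rwa [map_sub, map_mul, map_mul, hE, hinv a ha] at h

end Splitting

/-! ### The adjoint action and the smash product of a splitting -/

section Cleft

variable {k : Type*} [Field k]

/-- An induction principle for `U(sl₂)`. -/
theorem usl2_induction {p : USl2 k → Prop} (he : p (e k)) (hf : p (f k))
    (hc : ∀ c, p (algebraMap k _ c)) (ha : ∀ u v, p u → p v → p (u + v))
    (hm : ∀ u v, p u → p v → p (u * v)) (u : USl2 k) : p u := by
  let S : Subalgebra k (USl2 k) :=
    { carrier := {u | p u}
      mul_mem' := fun {u v} hu hv => hm u v hu hv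
      add_mem' := fun {u v} hu hv => ha u v hu hv
      algebraMap_mem' := hc }
  have hu : u ∈ S := by rw [usl2_subalgebra_eq_top S he hf]; trivial
  exact hu

/-- A module algebra over `U(sl₂)` is an algebra on which `e` and `f` act by derivations. -/
def slModuleAlgebra {B : Type*} [Ring B] [Algebra k B] (act : USl2 k →ₐ[k] Module.End k B)
    (he : ∀ a b, act (e k) (a * b) = act (e k) a * b + a * act (e k) b)
    (hf : ∀ a b, act (f k) (a * b) = act (f k) a * b + a * act (f k) b) :
    ModuleAlgebra k (USl2 k) B where
  act := act
  act_one v := by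
    -- A derivation kills 1, matching ε(e) = ε(f) = 0.
    have h0 : ∀ D : Module.End k B, (∀ a b, D (a * b) = D a * b + a * D b) → D 1 = 0 := fun D hD => by
      have := hD 1 1
      rwa [one_mul, mul_one, one_mul, left_eq_add] at this
    change act v 1 = algebraMap k B (envCounit k (SL2 k) v)
    induction v using usl2_induction with
    | he => rw [h0 _ he, envCounit_e, map_zero]
    | hf => rw [h0 _ hf, envCounit_f, map_zero]
    | hc c =>
      rw [AlgHom.commutes, AlgHom.commutes, Module.algebraMap_end_apply,
        Algebra.algebraMap_eq_smul_one]; rfl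
    | ha u v hu hv => rw [map_add, LinearMap.add_apply, hu, hv, map_add, map_add]
    | hm u v hu hv =>
      rw [map_mul, Module.End.mul_apply, hv, Algebra.algebraMap_eq_smul_one, map_smul, hu, map_mul,
        map_mul, Algebra.smul_def, (Algebra.commutes _ _)]
  act_mul v := by
    change ∀ a b, act v (a * b) = LinearMap.mul' k B
      (TensorProduct.map (act.toLinearMap.flip a) (act.toLinearMap.flip b) (envComul k (SL2 k) v))
    induction v using usl2_induction with
    | he => intro a b; rw [he, envComul_e]; simp
    | hf => intro a b; rw [hf, envComul_f]; simp
    | hc c =>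
      intro a b
      rw [AlgHom.commutes, AlgHom.commutes, Module.algebraMap_end_apply,
        Algebra.TensorProduct.algebraMap_apply, Algebra.algebraMap_eq_smul_one]
      simp
    | ha u v hu hv =>
      intro a b
      rw [map_add, LinearMap.add_apply, hu, hv, map_add, map_add, map_add]
    | hm u v hu hv =>
      intro a b
      rw [map_mul act, Module.End.mul_apply, hv, map_mul]
      generalize envComul k (SL2 k) v = t
      induction t with
      | zero => simp
      | add x y hx hy => rw [map_add, map_add, map_add, hx, hy, mul_add, map_add, map_add]
      | tmul x y =>
        rw [TensorProduct.map_tmul, LinearMap.mul'_apply, hu]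
        generalize envComul k (SL2 k) u = s
        induction s with
        | zero => simp
        | add p q hp hq => rw [map_add, map_add, hp, hq, add_mul, map_add, map_add]
        | tmul p q => simp

variable {A : Type*} [Ring A] [Algebra k A] (γ : USl2 k →ₐ[k] A)

/-- The convolution inverse of an algebra map. -/
def convInv : USl2 k →ₗ[k] A := γ.toLinearMap ∘ₗ envAntipodeLin

/-- For an algebra map γ the composite γ ∘ S is a convolution inverse, because γ carries the
antipode axioms of U(sl₂) into A. -/
theorem isConvInverse_convInv : IsConvInverse γ.toLinearMap (convInv γ) := by
  constructor
  · intro v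
    have h : ∀ t, LinearMap.mul' k A (TensorProduct.map (convInv γ) γ.toLinearMap t) =
        γ (LinearMap.mul' k _ ((envAntipodeLin (k := k) (L := SL2 k)).rTensor _ t)) := fun t => by
      induction t with
      | zero => simp
      | add x y hx hy => simp only [map_add, hx, hy]
      | tmul x y => simp [convInv]
    rw [h, env_comul_apply, env_antipode_left, AlgHom.commutes]; rfl
  · intro v
    have h : ∀ t, LinearMap.mul' k A (TensorProduct.map γ.toLinearMap (convInv γ) t) =
        γ (LinearMap.mul' k _ ((envAntipodeLin (k := k) (L := SL2 k)).lTensor _ t)) := fun t => by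
      induction t with
      | zero => simp
      | add x y hx hy => simp only [map_add, hx, hy]
      | tmul x y => simp [convInv]
    rw [h, env_comul_apply, env_antipode_right, AlgHom.commutes]; rfl

/-- The adjoint action `v ↦ (a ↦ ∑ γ(v₁) a γ⁻¹(v₂))`. -/
def adjointAction : USl2 k →ₐ[k] Module.End k A :=
  (AlgHom.mulLeftRight k A).comp
    ((Algebra.TensorProduct.map γ ((AlgHom.op γ).comp (envAntipode k (SL2 k)))).comp
      (envComul k (SL2 k)))

theorem adjointAction_apply (v : USl2 k) (a : A) :
    adjointAction γ v a = conj γ.toLinearMap (convInv γ) v a := by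
  rw [adjointAction, conj, env_comul_apply, AlgHom.comp_apply, AlgHom.comp_apply]
  generalize envComul k (SL2 k) v = t
  induction t with
  | zero => simp
  | add x y hx hy => simp only [map_add, LinearMap.add_apply, hx, hy]
  | tmul x y => rw [Algebra.TensorProduct.map_tmul, AlgHom.mulLeftRight_apply]; rfl

theorem convInv_one : convInv γ 1 = 1 := by rw [convInv, LinearMap.comp_apply, envAntipodeLin_one]; simp

theorem adjointAction_e (a : A) : adjointAction γ (e k) a = γ (e k) * a - a * γ (e k) := by
  rw [adjointAction_apply, conj, env_comul_apply, envComul_e]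
  simp [convInv, envAntipodeLin_e, envAntipodeLin_one, sub_eq_add_neg]

theorem adjointAction_f (a : A) : adjointAction γ (f k) a = γ (f k) * a - a * γ (f k) := by
  rw [adjointAction_apply, conj, env_comul_apply, envComul_f]
  simp [convInv, envAntipodeLin_f, envAntipodeLin_one, sub_eq_add_neg]

variable {γ} {B : Subalgebra k A} (hBe : ∀ a ∈ B, γ (e k) * a - a * γ (e k) ∈ B)
  (hBf : ∀ a ∈ B, γ (f k) * a - a * γ (f k) ∈ B)

/-- The adjoint action is an algebra map into endomorphisms, so stability under the commutators with
γ(e) and γ(f) implies stability under all of U(sl₂). -/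
theorem adjointAction_mem {B : Subalgebra k A} (hBe : ∀ a ∈ B, γ (e k) * a - a * γ (e k) ∈ B)
    (hBf : ∀ a ∈ B, γ (f k) * a - a * γ (f k) ∈ B) (v : USl2 k) : ∀ a ∈ B, adjointAction γ v a ∈ B := by
  induction v using usl2_induction with
  | he => intro a ha; rw [adjointAction_e]; exact hBe a ha
  | hf => intro a ha; rw [adjointAction_f]; exact hBf a ha
  | hc c => intro a ha; rw [AlgHom.commutes, Module.algebraMap_end_apply]; exact B.smul_mem ha c
  | ha u v hu hv =>
    intro a ha; rw [map_add, LinearMap.add_apply]; exact B.add_mem (hu a ha) (hv a ha)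
  | hm u v hu hv =>
    intro a ha; rw [map_mul, Module.End.mul_apply]; exact hu _ (hv a ha)

/-- The adjoint action on a subalgebra that is preserved by it. -/
def restrictedAction : USl2 k →ₐ[k] Module.End k B where
  toFun v :=
    { toFun := fun a => ⟨adjointAction γ v a, adjointAction_mem hBe hBf v a a.2⟩
      map_add' := fun a b => Subtype.ext (map_add (adjointAction γ v) (a : A) b)
      map_smul' := fun c a => Subtype.ext (map_smul (adjointAction γ v) c (a : A)) }
  map_one' := LinearMap.ext fun a => Subtype.ext
    (congrArg (fun T : Module.End k A => T a) (map_one (adjointAction γ)))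
  map_mul' u v := LinearMap.ext fun a => Subtype.ext
    (congrArg (fun T : Module.End k A => T a) (map_mul (adjointAction γ) u v))
  map_zero' := LinearMap.ext fun a => Subtype.ext
    (congrArg (fun T : Module.End k A => T a) (map_zero (adjointAction γ)))
  map_add' u v := LinearMap.ext fun a => Subtype.ext
    (congrArg (fun T : Module.End k A => T a) (map_add (adjointAction γ) u v))
  commutes' c := LinearMap.ext fun a => Subtype.ext
    (congrArg (fun T : Module.End k A => T a) (AlgHom.commutes (adjointAction γ) c))

theorem coe_restrictedAction (v : USl2 k) (a : B) :
    (restrictedAction hBe hBf v a : A) = adjointAction γ v a := rfl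

/-- The module algebra given by the adjoint action. -/
def adjointModuleAlgebra : ModuleAlgebra k (USl2 k) B :=
  slModuleAlgebra (restrictedAction hBe hBf)
    (fun a b => Subtype.ext (by
      simp only [Subalgebra.coe_add, Subalgebra.coe_mul, coe_restrictedAction, adjointAction_e,
        sub_mul, mul_sub, mul_assoc]
      abel))
    (fun a b => Subtype.ext (by
      simp only [Subalgebra.coe_add, Subalgebra.coe_mul, coe_restrictedAction, adjointAction_f,
        sub_mul, mul_sub, mul_assoc]
      abel))

theorem coe_adjointModuleAlgebra_act (v : USl2 k) (a : B) :
    ((adjointModuleAlgebra hBe hBf).act v a : A) = adjointAction γ v a := rfl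

variable (γ B) in
/-- The linear map `a ⊗ v ↦ a γ(v)`. -/
def smashLin : B ⊗[k] USl2 k →ₗ[k] A :=
  LinearMap.mul' k A ∘ₗ TensorProduct.map B.val.toLinearMap γ.toLinearMap

theorem smashLin_tmul (a : B) (v : USl2 k) : smashLin γ B (a ⊗ₜ v) = a * γ v := rfl

theorem smashLin_rTensor (a : B) (z : B ⊗[k] USl2 k) :
    smashLin γ B ((LinearMap.mulLeft k a).rTensor _ z) = a * smashLin γ B z := by
  induction z with
  | zero => simp
  | add x y hx hy => rw [map_add, map_add, map_add, hx, hy, mul_add]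
  | tmul x y =>
    rw [LinearMap.rTensor_tmul, smashLin_tmul, smashLin_tmul, LinearMap.mulLeft_apply,
      Subalgebra.coe_mul, mul_assoc]

/-- For primitive v this is γ(v) b = [γ(v), b] + b γ(v). Both sides are multiplicative in v, so the
general case follows, and with it the multiplicativity of a # v ↦ a γ(v). -/
theorem smashLin_diag (v : USl2 k) : ∀ z : B ⊗[k] USl2 k,
    smashLin γ B (SmashProduct.diag (adjointModuleAlgebra hBe hBf) v z) = γ v * smashLin γ B z := by
  induction v using usl2_induction with
  | he =>
    intro z
    induction z with
    | zero => simp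
    | add x y hx hy => simp only [map_add, mul_add, hx, hy]
    | tmul b g =>
      rw [SmashProduct.diag_tmul, env_comul_apply, envComul_e, map_add, TensorProduct.map_tmul,
        TensorProduct.map_tmul, map_add, smashLin_tmul, smashLin_tmul, smashLin_tmul]
      simp only [LinearMap.flip_apply, AlgHom.toLinearMap_apply, coe_adjointModuleAlgebra_act,
        adjointAction_e, LinearMap.mulRight_apply, one_mul, map_one, Module.End.one_apply, map_mul]
      rw [sub_mul]; simp only [mul_assoc]; abel
  | hf =>
    intro z
    induction z with
    | zero => simp
    | add x y hx hy => simp only [map_add, mul_add, hx, hy]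
    | tmul b g =>
      rw [SmashProduct.diag_tmul, env_comul_apply, envComul_f, map_add, TensorProduct.map_tmul,
        TensorProduct.map_tmul, map_add, smashLin_tmul, smashLin_tmul, smashLin_tmul]
      simp only [LinearMap.flip_apply, AlgHom.toLinearMap_apply, coe_adjointModuleAlgebra_act,
        adjointAction_f, LinearMap.mulRight_apply, one_mul, map_one, Module.End.one_apply, map_mul]
      rw [sub_mul]; simp only [mul_assoc]; abel
  | hc c =>
    intro z
    rw [AlgHom.commutes, AlgHom.commutes, Module.algebraMap_end_apply, map_smul, Algebra.smul_def]
  | ha u v hu hv =>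
    intro z; rw [map_add, LinearMap.add_apply, map_add, hu, hv, map_add, add_mul]
  | hm u v hu hv =>
    intro z; rw [map_mul, Module.End.mul_apply, hu, hv, map_mul, mul_assoc]

/-- The algebra map `u # U → A`, `a # v ↦ a γ(v)`. -/
def smashHom : SmashProduct (adjointModuleAlgebra hBe hBf) →ₐ[k] A :=
  AlgHom.ofLinearMap (A := SmashProduct (adjointModuleAlgebra hBe hBf)) (smashLin γ B)
    (by
      change smashLin γ B (1 ⊗ₜ 1) = 1
      rw [smashLin_tmul, map_one, mul_one, Subalgebra.coe_one])
    (by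
      intro x y
      change smashLin γ B (SmashProduct.mulLin (adjointModuleAlgebra hBe hBf) x y) =
        smashLin γ B x * smashLin γ B y
      have key : ∀ x y : B ⊗[k] USl2 k,
          smashLin γ B (SmashProduct.mulLin (adjointModuleAlgebra hBe hBf) x y) =
            smashLin γ B x * smashLin γ B y := by
        intro x y
        induction x with
        | zero => simp
        | add p q hp hq => simp only [map_add, LinearMap.add_apply, hp, hq, add_mul]
        | tmul a v =>
          rw [SmashProduct.mulLin_tmul, smashLin_rTensor, smashLin_diag, smashLin_tmul, mul_assoc]
      exact key x y)

theorem smashHom_mk (a : B) (v : USl2 k) :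
    smashHom hBe hBf (SmashProduct.mk (adjointModuleAlgebra hBe hBf) a v) = a * γ v := rfl

/-! ### Injectivity -/

variable (γ) in
/-- The map `v ↦ ∑ γ⁻¹(v₁) ⊗ v₂`. -/
def untwistVec : USl2 k →ₗ[k] A ⊗[k] USl2 k :=
  (convInv γ).rTensor _ ∘ₗ (envComul k (SL2 k)).toLinearMap

variable (γ) in
/-- The map `a ⊗ v ↦ ∑ a γ⁻¹(v₁) ⊗ v₂`. -/
def untwist : A ⊗[k] USl2 k →ₗ[k] A ⊗[k] USl2 k :=
  LinearMap.mul' k (A ⊗[k] USl2 k) ∘ₗ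
    TensorProduct.map (Algebra.TensorProduct.includeLeft (R := k) (S := k)).toLinearMap (untwistVec γ)

theorem untwist_tmul (a : A) (v : USl2 k) : untwist γ (a ⊗ₜ v) = (a ⊗ₜ 1) * untwistVec γ v := rfl

theorem untwist_tmul_one (a : A) : untwist γ (a ⊗ₜ 1) = a ⊗ₜ 1 := by
  have h : untwistVec γ 1 = 1 := by
    rw [untwistVec, LinearMap.comp_apply, AlgHom.toLinearMap_apply, map_one,
      Algebra.TensorProduct.one_def, LinearMap.rTensor_tmul, convInv_one]; rfl
  rw [untwist_tmul, h, mul_one]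

variable (γ) in
/-- The map `v ↦ ∑ γ(v₁) ⊗ v₂`. -/
def twistHom : USl2 k →ₐ[k] A ⊗[k] USl2 k :=
  (Algebra.TensorProduct.map γ (AlgHom.id k _)).comp (envComul k (SL2 k))

theorem twistHom_apply (v : USl2 k) : twistHom γ v =
    TensorProduct.map γ.toLinearMap LinearMap.id (Coalgebra.comul (R := k) v) := rfl

theorem twistHom_of_primitive {x : USl2 k} (hx : envComul k (SL2 k) x = x ⊗ₜ 1 + 1 ⊗ₜ x) :
    twistHom γ x = γ x ⊗ₜ 1 + 1 ⊗ₜ x := by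
  rw [twistHom, AlgHom.comp_apply, hx, map_add, Algebra.TensorProduct.map_tmul,
    Algebra.TensorProduct.map_tmul, map_one γ]; rfl

theorem untwist_mul_twistHom_of_primitive {x : USl2 k}
    (hx : envComul k (SL2 k) x = x ⊗ₜ 1 + 1 ⊗ₜ x) (hx' : envAntipodeLin x = -x)
    (z : A ⊗[k] USl2 k) : untwist γ (z * twistHom γ x) = untwist γ z * (1 ⊗ₜ x) := by
  -- Since x is primitive and S(x) = -x, multiplying w by x on the right adds x in the second leg
  -- and -γ(x) on the left of the first. The latter cancels the γ(x) ⊗ 1 of `twistHom`.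
  have hθ : ∀ w, untwistVec γ (w * x) =
      untwistVec γ w * (1 ⊗ₜ x) - (γ x ⊗ₜ 1) * untwistVec γ w := fun w => by
    simp only [untwistVec, LinearMap.comp_apply, AlgHom.toLinearMap_apply, map_mul, hx]
    generalize envComul k (SL2 k) w = t
    induction t with
    | zero => simp
    | add p q hp hq =>
      rw [add_mul, map_add, hp, hq, map_add, add_mul, mul_add]; abel
    | tmul p q =>
      simp only [mul_add, Algebra.TensorProduct.tmul_mul_tmul, mul_one, one_mul, map_add,
        LinearMap.rTensor_tmul, convInv, LinearMap.comp_apply, envAntipodeLin_mul, hx',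
        AlgHom.toLinearMap_apply, neg_mul, map_neg, map_mul, TensorProduct.neg_tmul]
      abel
  rw [twistHom_of_primitive hx]
  induction z with
  | zero => simp
  | add p q hp hq => rw [add_mul, map_add, hp, hq, map_add, add_mul]
  | tmul a w =>
    rw [mul_add, Algebra.TensorProduct.tmul_mul_tmul, Algebra.TensorProduct.tmul_mul_tmul, mul_one,
      mul_one, map_add, untwist_tmul, untwist_tmul, untwist_tmul, hθ, mul_sub, ← mul_assoc (a ⊗ₜ 1),
      ← mul_assoc (a ⊗ₜ 1), Algebra.TensorProduct.tmul_mul_tmul, mul_one]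
    abel

theorem untwist_mul_twistHom (v : USl2 k) : ∀ z : A ⊗[k] USl2 k,
    untwist γ (z * twistHom γ v) = untwist γ z * (1 ⊗ₜ v) := by
  induction v using usl2_induction with
  | he => exact untwist_mul_twistHom_of_primitive envComul_e envAntipodeLin_e
  | hf => exact untwist_mul_twistHom_of_primitive envComul_f envAntipodeLin_f
  | hc c =>
    intro z
    rw [AlgHom.commutes, ← Algebra.commutes, ← Algebra.smul_def, map_smul,
      Algebra.algebraMap_eq_smul_one, TensorProduct.tmul_smul, mul_smul_comm,
      ← Algebra.TensorProduct.one_def, mul_one]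
  | ha u v hu hv =>
    intro z; rw [map_add, mul_add, map_add, hu, hv, TensorProduct.tmul_add, mul_add]
  | hm u v hu hv =>
    intro z
    rw [map_mul (twistHom γ), ← mul_assoc, hv, hu, mul_assoc, Algebra.TensorProduct.tmul_mul_tmul, one_mul]

/-- In Sweedler form, b γ(v₁) γ⁻¹(v₂) ⊗ v₃ = b ⊗ v. So ρ followed by `untwist` undoes a γ(v) up to
the inclusion of B, and that inclusion stays injective after tensoring over a field. -/
theorem untwist_comp {ρ : A →ₐ[k] A ⊗[k] USl2 k} (hρ : ∀ a ∈ B, ρ a = a ⊗ₜ 1)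
    (hργ : ∀ v, ρ (γ v) = twistHom γ v) (z : B ⊗[k] USl2 k) :
    untwist γ (ρ (smashLin γ B z)) = B.val.toLinearMap.rTensor _ z := by
  induction z with
  | zero => simp
  | add x y hx hy => simp only [map_add, hx, hy]
  | tmul b v =>
    rw [smashLin_tmul, map_mul, hρ b b.2, hργ, untwist_mul_twistHom, untwist_tmul_one,
      Algebra.TensorProduct.tmul_mul_tmul, mul_one, one_mul]; rfl

theorem smashLin_injective {ρ : A →ₐ[k] A ⊗[k] USl2 k} (hρ : ∀ a ∈ B, ρ a = a ⊗ₜ 1)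
    (hργ : ∀ v, ρ (γ v) = twistHom γ v) : Function.Injective (smashLin γ B) := by
  intro x y hxy
  have h : B.val.toLinearMap.rTensor (USl2 k) x = B.val.toLinearMap.rTensor (USl2 k) y := by
    rw [← untwist_comp hρ hργ, ← untwist_comp hρ hργ, hxy]
  exact Module.Flat.rTensor_preserves_injective_linearMap B.val.toLinearMap
    Subtype.val_injective h

theorem mem_of_coinvariant {ρ : A →ₐ[k] A ⊗[k] USl2 k} (hρ : ∀ a ∈ B, ρ a = a ⊗ₜ 1)
    (hργ : ∀ v, ρ (γ v) = twistHom γ v) (hsurj : Function.Surjective (smashLin γ B)) {a : A}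
    (ha : ρ a = a ⊗ₜ 1) : a ∈ B := by
  obtain ⟨z, rfl⟩ := hsurj a
  have h := untwist_comp hρ hργ z
  rw [ha, untwist_tmul_one] at h
  -- For a coinvariant a the element z becomes a ⊗ 1 in A ⊗ U. Applying id ⊗ ε on both sides
  -- exhibits a as an element of B.
  let c : ∀ (M : Type _) [AddCommGroup M] [Module k M], M ⊗[k] USl2 k →ₗ[k] M := fun M _ _ =>
    (TensorProduct.rid k M).toLinearMap ∘ₗ (envCounit k (SL2 k)).toLinearMap.lTensor M
  have hc : ∀ z : B ⊗[k] USl2 k, c A (B.val.toLinearMap.rTensor _ z) = (c B z : A) := fun z => by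
    induction z with
    | zero => simp
    | add x y hx hy => simp only [map_add, hx, hy, Subalgebra.coe_add]
    | tmul b v => simp [c]
  have h2 := congrArg (c A) h
  rw [hc] at h2
  have h3 : c A (smashLin γ B z ⊗ₜ 1) = smashLin γ B z := by simp [c]
  rw [← h3, h2]
  exact (c B z).2

end Cleft

end QuantumSL2

end

/-! ### Assembly of the theorem -/

open QuantumSL2 in
theorem theorem1 (k : Type*) [Field k] [CharZero k] (ℓ : ℕ) (hodd : Odd ℓ) (hℓ : 1 < ℓ)
    (ζ : kˣ) (hζ : IsPrimitiveRoot ζ ℓ) :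
    ∃ 𝓗 : HopfStr k (UZeta k ζ ℓ), 𝓗.IsInduced ∧
    -- the Frobenius map exists, is unique, and has the Frobenius–Lusztig kernel as coinvariants
    ∃ Fr : UZeta k ζ ℓ →ₐ[k] USl2 k, IsFrobenius 𝓗 Fr ∧
      (∀ Fr' : UZeta k ζ ℓ →ₐ[k] USl2 k, IsFrobenius 𝓗 Fr' → Fr' = Fr) ∧
      (∀ a : UZeta k ζ ℓ, a ∈ frobKernel k ζ ℓ ↔ coaction 𝓗 Fr a = a ⊗ₜ[k] 1) ∧
    -- the splitting map: an algebra map, a right comodule map and a section of `Fr`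
    ∃ γ : USl2 k →ₐ[k] UZeta k ζ ℓ,
      γ (e k) = UZeta.E k ζ ℓ ℓ ∧ γ (f k) = UZeta.F k ζ ℓ ℓ ∧
      Fr.comp γ = AlgHom.id k (USl2 k) ∧
      (∀ v : USl2 k, coaction 𝓗 Fr (γ v) =
        TensorProduct.map γ.toLinearMap LinearMap.id (Coalgebra.comul (R := k) v)) ∧
    ∃ γ' : USl2 k →ₗ[k] UZeta k ζ ℓ, IsConvInverse γ.toLinearMap γ' ∧
    -- the action `v · a = ∑ γ(v₁) a γ⁻¹(v₂)` on the kernel and its smash product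
    ∃ M : ModuleAlgebra k (USl2 k) (frobKernel k ζ ℓ),
      (∀ (v : USl2 k) (a : frobKernel k ζ ℓ),
        (M.act v a : UZeta k ζ ℓ) = conj γ.toLinearMap γ' v (a : UZeta k ζ ℓ)) ∧
    ∃ Φ : SmashProduct M ≃ₐ[k] UZeta k ζ ℓ,
      ∀ (a : frobKernel k ζ ℓ) (v : USl2 k),
        Φ (SmashProduct.mk M a v) = (a : UZeta k ζ ℓ) * γ v := by
  obtain ⟨𝓗, hind, h1, h2, h3, h4, h5, h6, h7, h8, h9, h10, h11⟩ :=
    UZeta.exists_hopfStr (k := k) (ζ := ζ) hodd hζ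
  have h𝓗 : 𝓗.HasStandardValues := ⟨h1, h2, h3, h4, h5, h6, h7, h8, h9, h10, h11⟩
  obtain ⟨Fr, f1, f2, f3, f4, f5⟩ := exists_frobenius (k := k) (ζ := ζ) hodd hℓ hζ
  have hFr : IsFrobeniusOnGenerators Fr := ⟨f1, f2, f3, f4, f5⟩
  have hFrob := isFrobenius_of_generators hodd hℓ hζ h𝓗 hFr
  have hργ : ∀ v, coaction 𝓗 Fr (splitting hodd hℓ hζ v) = twistHom (splitting hodd hℓ hζ) v := by
    have : (coaction 𝓗 Fr).comp (splitting hodd hℓ hζ) = twistHom (splitting hodd hℓ hζ) := by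
      refine usl2_hom_ext ?_ ?_
      · rw [AlgHom.comp_apply, splitting_e, coaction_E hℓ h𝓗 hFr,
          twistHom_of_primitive envComul_e, splitting_e]
      · rw [AlgHom.comp_apply, splitting_f, coaction_F hℓ h𝓗 hFr,
          twistHom_of_primitive envComul_f, splitting_f]
    exact fun v => congr($this v)
  have hρ : ∀ a ∈ frobKernel k ζ ℓ, coaction 𝓗 Fr a = a ⊗ₜ 1 := by
    have : frobKernel k ζ ℓ ≤ AlgHom.equalizer (coaction 𝓗 Fr) Algebra.TensorProduct.includeLeft := by
      refine Algebra.adjoin_le ?_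
      rintro x (rfl | rfl | rfl)
      · exact coaction_E_one hℓ h𝓗 hFr
      · exact coaction_F_one hℓ h𝓗 hFr
      · exact coaction_K h𝓗 hFr
    exact fun a ha => this ha
  have hBe : ∀ a ∈ frobKernel k ζ ℓ, splitting hodd hℓ hζ (e k) * a -
      a * splitting hodd hℓ hζ (e k) ∈ frobKernel k ζ ℓ := fun a ha => by
    rw [splitting_e]; exact frobKernel_divE_commutator_mem hodd hℓ hζ ha
  have hBf : ∀ a ∈ frobKernel k ζ ℓ, splitting hodd hℓ hζ (f k) * a -
      a * splitting hodd hℓ hζ (f k) ∈ frobKernel k ζ ℓ := fun a ha => by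
    rw [splitting_f]; exact frobKernel_divF_commutator_mem hodd hℓ hζ ha
  -- The image contains the kernel, hence K, E and F, and also γ(e) = E⁽ˡ⁾ and γ(f) = F⁽ˡ⁾; these
  -- generate U_ζ.
  have hrange : (smashHom hBe hBf).range = ⊤ := by
    have hleft : ∀ a ∈ frobKernel k ζ ℓ, a ∈ (smashHom hBe hBf).range := fun a ha =>
      ⟨SmashProduct.mk _ ⟨a, ha⟩ 1, (smashHom_mk hBe hBf _ _).trans (by rw [map_one, mul_one])⟩
    refine UZeta.subalgebra_eq_top hodd hζ _ (hleft _ frobKernel_K_mem)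
      (hleft _ frobKernel_E_one_mem) (hleft _ frobKernel_F_one_mem)
      ⟨SmashProduct.mk _ 1 (e k), ?_⟩ ⟨SmashProduct.mk _ 1 (f k), ?_⟩
    · exact (smashHom_mk hBe hBf _ _).trans (by rw [Subalgebra.coe_one, one_mul, splitting_e])
    · exact (smashHom_mk hBe hBf _ _).trans (by rw [Subalgebra.coe_one, one_mul, splitting_f])
  have hsurj : Function.Surjective (smashHom hBe hBf) := AlgHom.range_eq_top _ |>.mp hrange
  have hinj : Function.Injective (smashHom hBe hBf) := smashLin_injective hρ hργ
  refine ⟨𝓗, hind, Fr, hFrob, fun Fr' h => hFrob.eq hodd hζ h,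
    fun a => ⟨hρ a, mem_of_coinvariant hρ hργ hsurj⟩, splitting hodd hℓ hζ, splitting_e hodd hℓ hζ,
    splitting_f hodd hℓ hζ, usl2_hom_ext ?_ ?_, fun v => (hργ v).trans (twistHom_apply v), convInv _,
    isConvInverse_convInv _, adjointModuleAlgebra hBe hBf, fun v a => ?_,
    AlgEquiv.ofBijective (smashHom hBe hBf) ⟨hinj, hsurj⟩, fun a v => smashHom_mk hBe hBf a v⟩
  · rw [AlgHom.comp_apply, splitting_e, hFr.map_divE, AlgHom.id_apply]
  · rw [AlgHom.comp_apply, splitting_f, hFr.map_divF, AlgHom.id_apply]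
  · rw [coe_adjointModuleAlgebra_act, adjointAction_apply]
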